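/- **Conventions.** A *metric graph* is a finite simple undirected graph $G=(V,E)$ whose vertices are distinct points of a metric space $(M,d_M)$; let $n=|V|$, $m=|E|$. Every edge $uv$ has weight $d_M(u,v)$, and $d_G(u,v)\in[0,\infty]$ is the weight of a shortest path from $u$ to $v$ in $G$ ($\infty$ if there is none). The *dilation* of $G$ is the smallest $t\in[1,\infty]$ such that $d_G(u,v)\le t\cdot d_M(u,v)$ for all $u\neq v$ in $V$. For an integer $0\le k\le n^2$ let $t^*$ be the minimum dilation of $(V,E\cup S)$ over all sets $S\subseteq V\times V$ with $|S|=k$, where the pairs in $S$ are read as undirected edges (loops are ignored). The model of computation is the real RAM: unit-cost operations on real numbers (arithmetic and comparison) and on natural numbers (addition, truncated subtraction, comparison), with indirect addressing. The input consists of $n$, $m$, $k$, $t$, a list of the $m$ edges, and the matrix of the distances $d_M(u,v)$, all stored in memory. **Theorem.** There is an algorithm (a single real RAM program) that, given an integer $k\ge 0$, a real number $t$ and a metric graph $G$ with $n$ vertices and $m$ edges, halts after $$O\bigl((m+n\log n+kn)\cdot n\bigr)$$ steps (more precisely, after at most $C\cdot\bigl((m+n\log n+kn)\,n+1\bigr)$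 steps, with an absolute constant $C$) and returns either YES or NO. Suppose $k\le n^2$, so that $t^*$ is defined. If the algorithm returns YES, then $t^*\le t$; if it returns NO, then $t^*>\frac{t}{k+1}$. Moreover, if $t\ge 1$, the answer is that of the greedy construction: put $G_0=G$ and $G_i=G_{i-1}\cup\{a_i\}$, where $a_i$ is a shortest pair in $V\times V$ with $d_{G_{i-1}}(a_i)>t\cdot d_M(a_i)$, as long as such a pair exists. With a suitable choice among pairs of equal length, the algorithm returns NO only if this construction adds (at least) $k+1$ edges, and YES only if it stops, for lack of such a pair, after adding at most $k$ edges. -/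

import Mathlib

open scoped ENNReal

namespace Dilation

/-! ### A real RAM, programmed in a structured language

Memory consists of registers and (unbounded) arrays, both for natural numbers and for real
numbers.  Every arithmetic operation, comparison, memory access and assignment costs one step.
Natural numbers support only addition and truncated subtraction; real numbers support the field
operations and comparisons (no rounding, no conversion to naturals).  Array cells are addressed
indirectly, through natural number expressions.  Programs are finite, and the only literals they
may contain are natural and rational numbers. -/

/-- Memory: registers and arrays are named by natural numbers. -/
structure State where
  natReg : ℕ → ℕ
  realReg : ℕ → ℝ
  natArr : ℕ → ℕ → ℕ
  realArr : ℕ → ℕ → ℝ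

/-- Expressions with values in the natural numbers. -/
inductive NExpr where
  | lit (c : ℕ)
  | reg (x : ℕ)
  | arr (a : ℕ) (i : NExpr)
  | add (e f : NExpr)
  | sub (e f : NExpr)

/-- Expressions with values in the real numbers. -/
inductive RExpr where
  | lit (q : ℚ)
  | reg (x : ℕ)
  | arr (a : ℕ) (i : NExpr)
  | add (e f : RExpr)
  | sub (e f : RExpr)
  | mul (e f : RExpr)
  | div (e f : RExpr)

/-- Tests. -/
inductive BExpr where
  | natLT (e f : NExpr)
  | natEq (e f : NExpr)
  | realLT (e f : RExpr)
  | realEq (e f : RExpr)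
  | not (b : BExpr)
  | and (b c : BExpr)
  | or (b c : BExpr)

/-- The value of a natural number expression. -/
def NExpr.eval (s : State) : NExpr → ℕ
  | lit c => c
  | reg x => s.natReg x
  | arr a i => s.natArr a (i.eval s)
  | add e f => e.eval s + f.eval s
  | sub e f => e.eval s - f.eval s

/-- The number of steps needed to evaluate a natural number expression. -/
def NExpr.cost : NExpr → ℕ
  | lit _ => 1
  | reg _ => 1
  | arr _ i => i.cost + 1
  | add e f => e.cost + f.cost + 1
  | sub e f => e.cost + f.cost + 1

/-- The value of a real expression. -/
noncomputable def RExpr.eval (s : State) : RExpr → ℝ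
  | lit q => (q : ℝ)
  | reg x => s.realReg x
  | arr a i => s.realArr a (i.eval s)
  | add e f => e.eval s + f.eval s
  | sub e f => e.eval s - f.eval s
  | mul e f => e.eval s * f.eval s
  | div e f => e.eval s / f.eval s

/-- The number of steps needed to evaluate a real expression. -/
def RExpr.cost : RExpr → ℕ
  | lit _ => 1
  | reg _ => 1
  | arr _ i => i.cost + 1
  | add e f => e.cost + f.cost + 1
  | sub e f => e.cost + f.cost + 1
  | mul e f => e.cost + f.cost + 1
  | div e f => e.cost + f.cost + 1

/-- The truth value of a test. -/
def BExpr.Holds (s : State) : BExpr → Prop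
  | natLT e f => e.eval s < f.eval s
  | natEq e f => e.eval s = f.eval s
  | realLT e f => e.eval s < f.eval s
  | realEq e f => e.eval s = f.eval s
  | not b => ¬ b.Holds s
  | and b c => b.Holds s ∧ c.Holds s
  | or b c => b.Holds s ∨ c.Holds s

/-- The number of steps needed to evaluate a test. -/
def BExpr.cost : BExpr → ℕ
  | natLT e f => e.cost + f.cost + 1
  | natEq e f => e.cost + f.cost + 1
  | realLT e f => e.cost + f.cost + 1
  | realEq e f => e.cost + f.cost + 1
  | not b => b.cost + 1
  | and b c => b.cost + c.cost + 1
  | or b c => b.cost + c.cost + 1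

/-- Programs. -/
inductive Prog where
  | skip
  | setNat (x : ℕ) (e : NExpr)
  | setReal (x : ℕ) (e : RExpr)
  | storeNat (a : ℕ) (i : NExpr) (e : NExpr)
  | storeReal (a : ℕ) (i : NExpr) (e : RExpr)
  | seq (P Q : Prog)
  | ite (b : BExpr) (P Q : Prog)
  | while (b : BExpr) (P : Prog)

/-- Write a natural number register. -/
def State.setNat (s : State) (x v : ℕ) : State :=
  { s with natReg := Function.update s.natReg x v }

/-- Write a real register. -/
noncomputable def State.setReal (s : State) (x : ℕ) (v : ℝ) : State :=
  { s with realReg := Function.update s.realReg x v }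

/-- Write a cell of a natural number array. -/
def State.storeNat (s : State) (a i v : ℕ) : State :=
  { s with natArr := Function.update s.natArr a (Function.update (s.natArr a) i v) }

/-- Write a cell of a real array. -/
noncomputable def State.storeReal (s : State) (a i : ℕ) (v : ℝ) : State :=
  { s with realArr := Function.update s.realArr a (Function.update (s.realArr a) i v) }

/-- `Exec P s s' c`: started in memory state `s`, the program `P` halts in memory state `s'`
after exactly `c` steps. -/
inductive Exec : Prog → State → State → ℕ → Prop
  | skip (s : State) : Exec .skip s s 1
  | setNat (s : State) (x : ℕ) (e : NExpr) :
      Exec (.setNat x e) s (s.setNat x (e.eval s)) (e.cost + 1)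
  | setReal (s : State) (x : ℕ) (e : RExpr) :
      Exec (.setReal x e) s (s.setReal x (e.eval s)) (e.cost + 1)
  | storeNat (s : State) (a : ℕ) (i e : NExpr) :
      Exec (.storeNat a i e) s (s.storeNat a (i.eval s) (e.eval s)) (i.cost + e.cost + 1)
  | storeReal (s : State) (a : ℕ) (i : NExpr) (e : RExpr) :
      Exec (.storeReal a i e) s (s.storeReal a (i.eval s) (e.eval s)) (i.cost + e.cost + 1)
  | seq {P Q : Prog} {s s' s'' : State} {c d : ℕ} :
      Exec P s s' c → Exec Q s' s'' d → Exec (.seq P Q) s s'' (c + d)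
  | ite_true {b : BExpr} {P Q : Prog} {s s' : State} {c : ℕ} :
      b.Holds s → Exec P s s' c → Exec (.ite b P Q) s s' (b.cost + c + 1)
  | ite_false {b : BExpr} {P Q : Prog} {s s' : State} {c : ℕ} :
      ¬ b.Holds s → Exec Q s s' c → Exec (.ite b P Q) s s' (b.cost + c + 1)
  | while_true {b : BExpr} {P : Prog} {s s' s'' : State} {c d : ℕ} :
      b.Holds s → Exec P s s' c → Exec (.while b P) s' s'' d →
        Exec (.while b P) s s'' (b.cost + c + d + 1)
  | while_false {b : BExpr} {P : Prog} {s : State} :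
      ¬ b.Holds s → Exec (.while b P) s s (b.cost + 1)

/-! ### Metric graphs

A metric graph is a simple graph `G` on `Fin n` with an injection `p` of the vertices into a
metric space. -/

section Metric

variable {n : ℕ} {M : Type*} [MetricSpace M]

/-- The total weight of a walk; an edge `uv` has weight `d_M(u, v)`. -/
noncomputable def walkLength {G : SimpleGraph (Fin n)} (p : Fin n → M) {u v : Fin n}
    (w : G.Walk u v) : ℝ≥0∞ :=
  (w.darts.map fun d => edist (p d.fst) (p d.snd)).sum

/-- The shortest path distance `d_G(u, v)`; it is `∞` if there is no path. -/
noncomputable def graphDist (G : SimpleGraph (Fin n)) (p : Fin n → M) (u v : Fin n) : ℝ≥0∞ :=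
  ⨅ w : G.Walk u v, walkLength p w

/-- The dilation: the smallest `t ≥ 1` for which `G` is a `t`-spanner, `∞` if `G` is
disconnected.  (As soon as there are two vertices, `1 ≤ t` is implied by the spanner property.) -/
noncomputable def dilation (G : SimpleGraph (Fin n)) (p : Fin n → M) : ℝ≥0∞ :=
  sInf {t : ℝ≥0∞ | 1 ≤ t ∧ ∀ u v, graphDist G p u v ≤ t * edist (p u) (p v)}

/-- The graph `(V, E ∪ S)`, pairs in `S` being read as undirected edges. -/
def augment (G : SimpleGraph (Fin n)) (S : Finset (Fin n × Fin n)) : SimpleGraph (Fin n) :=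
  G ⊔ SimpleGraph.fromRel fun u v => (u, v) ∈ S

/-- The minimum dilation `t*` of `(V, E ∪ S)` over all `S ⊆ V × V` with `|S| = k`. -/
noncomputable def minDilation (G : SimpleGraph (Fin n)) (p : Fin n → M) (k : ℕ) : ℝ≥0∞ :=
  ⨅ (S : Finset (Fin n × Fin n)) (_ : S.card = k), dilation (augment G S) p

/-- The pair `e` satisfies `d_G(e) > t · d_M(e)`. -/
def IsViolating (G : SimpleGraph (Fin n)) (p : Fin n → M) (t : ℝ) (e : Fin n × Fin n) : Prop :=
  ENNReal.ofReal t * edist (p e.1) (p e.2) < graphDist G p e.1 e.2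

/-- The pair `e` is a shortest one among those with `d_G(e) > t · d_M(e)`. -/
def IsGreedyEdge (G : SimpleGraph (Fin n)) (p : Fin n → M) (t : ℝ) (e : Fin n × Fin n) : Prop :=
  IsViolating G p t e ∧
    ∀ f, IsViolating G p t f → dist (p e.1) (p e.2) ≤ dist (p f.1) (p f.2)

/-- `GreedyRun p t G i H`: the greedy construction started with `G` can arrive at `H` by adding
`i` edges one after the other (ties between edges of equal length are broken arbitrarily). -/
inductive GreedyRun (p : Fin n → M) (t : ℝ) (G : SimpleGraph (Fin n)) :
    ℕ → SimpleGraph (Fin n) → Prop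
  | start : GreedyRun p t G 0 G
  | step {i : ℕ} {H : SimpleGraph (Fin n)} {e : Fin n × Fin n} :
      GreedyRun p t G i H → IsGreedyEdge H p t e → GreedyRun p t G (i + 1) (augment H {e})

/-- `E` lists every edge of `G` exactly once, in one of its two orientations. -/
def IsEdgeList (G : SimpleGraph (Fin n)) (E : List (Fin n × Fin n)) : Prop :=
  (E.map fun q => s(q.1, q.2)).Nodup ∧
    ∀ e : Sym2 (Fin n), e ∈ E.map (fun q => s(q.1, q.2)) ↔ e ∈ G.edgeSet

/-- The memory holding the input: the natural number registers `1`, `2`, `3` contain `n`, `m`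
and `k`, the real register `0` contains `t`, the natural number arrays `0` and `1` contain the end
points of the `m` edges, and the real array `0` contains the distance `d_M(u, v)` at
position `u * n + v`.  All the rest is `0`. -/
noncomputable def inputState (p : Fin n → M) (E : List (Fin n × Fin n)) (k : ℕ) (t : ℝ) :
    State where
  natReg x := if x = 1 then n else if x = 2 then E.length else if x = 3 then k else 0
  realReg x := if x = 0 then t else 0
  natArr a i :=
    if a = 0 then (E.map fun q => (q.1 : ℕ)).getD i 0
    else if a = 1 then (E.map fun q => (q.2 : ℕ)).getD i 0
    else 0
  realArr a i :=
    if h : a = 0 ∧ i / n < n then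
      dist (p ⟨i / n, h.2⟩) (p ⟨i % n, Nat.mod_lt i (Nat.zero_lt_of_lt h.2)⟩)
    else 0

end Metric

/-- The answer of the machine is found in the natural number register `0`: `1` is YES. -/
def AnswersYes (s : State) : Prop := s.natReg 0 = 1

/-- The answer of the machine is found in the natural number register `0`: `0` is NO. -/
def AnswersNo (s : State) : Prop := s.natReg 0 = 0

end Dilation

/-! The program computes all distances of `G` with Dijkstra's algorithm and then runs the greedy
construction on the distance matrix. If `t < 1` it answers NO at once, which is correct because t* ≥
1 > t/(k+1).

Quality. If the construction stops within `k` edges, these can be padded to exactly `k` pairs, and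
t* ≤ t (`minDilation_le_of_greedyRun`). Suppose that it adds a_0, …, a_k although some `S` with `k`
elements gives dilation at most τ = t/(k+1). Let ℓ_i be the length of a_i. In G ∪ S its end points
are joined by a path of length at most τℓ_i; let g_i be the weight of the path's edges in `G`, and
w_i that of the others. These other edges form k+1 subsets of a set of at most k elements, so over
𝔽₂ some of them, for i in a nonempty set I, add up to zero (`exists_dependent_sets`). Let j = max I;
since the lengths are nondecreasing, a_j is a longest pair. As the edges outside `G` cancel, the end
points of a_j are connected by the G-parts of the paths together with the a_i, i ∈ I \ {j}
(`reachable_of_dependent`). All of these edges are present when a_j is chosen, so its distance is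
then at most Σ g_i + Σ_{i≠j} ℓ_i. On the other hand an edge shorter than a_i was not violating when
a_i was chosen, whence tℓ_i ≤ g_i + t w_i. Together with g_i + w_i ≤ τℓ_i this bounds the sum by
tℓ_j (`sum_le_of_bounds`), so a_j was not violating, a contradiction (`lt_dilation_of_greedyRun`).

Time. Dijkstra's algorithm uses a form of quake heap: a heap-ordered forest in which linking two
roots of equal rank raises the rank of the winner, while cutting a vertex leaves all ranks alone.
The invariant is that level i+1, the set of vertices of rank at least i+1, has at most 3/4 of the
size of level i; so ranks are O(log n). An extraction links the roots until their ranks differ,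
removes the best one, and if level i+1 has become too large for some i, takes the least such i and
lowers all larger ranks to i. A vertex of rank r has r slots for children, one of each smaller rank.
The potential is 180 times the number of roots plus 900 times the number of empty slots. A link
fills the slot that it creates and saves a root; a cut costs O(1); lowering the ranks destroys
enough empty slots to pay for itself (`Quaking.kids_le`). Hence a decrease costs O(1) and an
extraction O(log n) amortised (`decrease_spec`, `extract_spec`).

The machine has no ∞, so distances are cut off at a number `B` larger than t times every distance in
M, which does not affect the test for violating pairs (`isViolating_iff`). Cut-off distances satisfy
the triangle inequality, and inserting an edge changes them by an explicit formula
(`truncDist_augment`). Each greedy round therefore takes O(n²) steps, which accounts for the term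
kn·n. -/

namespace Dilation

/-! ### Reasoning about programs -/

/-- Run the programs of a list one after the other. -/
def Prog.block : List Prog → Prog
  | [] => .skip
  | P :: l => .seq P (Prog.block l)

/-- Does the program contain an assignment to the natural number register `y`? -/
def Prog.writesNatReg : Prog → ℕ → Bool
  | skip, _ => false
  | setNat x _, y => x == y
  | setReal _ _, _ => false
  | storeNat _ _ _, _ => false
  | storeReal _ _ _, _ => false
  | seq P Q, y => P.writesNatReg y || Q.writesNatReg y
  | ite _ P Q, y => P.writesNatReg y || Q.writesNatReg y
  | .while _ P, y => P.writesNatReg y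

/-- Does the program contain an assignment to the real register `y`? -/
def Prog.writesRealReg : Prog → ℕ → Bool
  | skip, _ => false
  | setNat _ _, _ => false
  | setReal x _, y => x == y
  | storeNat _ _ _, _ => false
  | storeReal _ _ _, _ => false
  | seq P Q, y => P.writesRealReg y || Q.writesRealReg y
  | ite _ P Q, y => P.writesRealReg y || Q.writesRealReg y
  | .while _ P, y => P.writesRealReg y

/-- Does the program contain a write to the natural number array `y`? -/
def Prog.writesNatArr : Prog → ℕ → Bool
  | skip, _ => false
  | setNat _ _, _ => false
  | setReal _ _, _ => false
  | storeNat a _ _, y => a == y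
  | storeReal _ _ _, _ => false
  | seq P Q, y => P.writesNatArr y || Q.writesNatArr y
  | ite _ P Q, y => P.writesNatArr y || Q.writesNatArr y
  | .while _ P, y => P.writesNatArr y

/-- Does the program contain a write to the real array `y`? -/
def Prog.writesRealArr : Prog → ℕ → Bool
  | skip, _ => false
  | setNat _ _, _ => false
  | setReal _ _, _ => false
  | storeNat _ _ _, _ => false
  | storeReal a _ _, y => a == y
  | seq P Q, y => P.writesRealArr y || Q.writesRealArr y
  | ite _ P Q, y => P.writesRealArr y || Q.writesRealArr y
  | .while _ P, y => P.writesRealArr y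

/-- Outside the registers and arrays written by `P`, the states `s` and `s'` agree. -/
structure Frame (P : Prog) (s s' : State) : Prop where
  natReg : ∀ x, P.writesNatReg x = false → s'.natReg x = s.natReg x
  realReg : ∀ x, P.writesRealReg x = false → s'.realReg x = s.realReg x
  natArr : ∀ x, P.writesNatArr x = false → s'.natArr x = s.natArr x
  realArr : ∀ x, P.writesRealArr x = false → s'.realArr x = s.realArr x

theorem Frame.refl (P : Prog) (s : State) : Frame P s s :=
  ⟨fun _ _ => rfl, fun _ _ => rfl, fun _ _ => rfl, fun _ _ => rfl⟩

theorem Frame.trans {P : Prog} {s s' s'' : State} (h : Frame P s s') (h' : Frame P s' s'') :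
    Frame P s s'' :=
  ⟨fun x hx => (h'.natReg x hx).trans (h.natReg x hx),
    fun x hx => (h'.realReg x hx).trans (h.realReg x hx),
    fun x hx => (h'.natArr x hx).trans (h.natArr x hx),
    fun x hx => (h'.realArr x hx).trans (h.realArr x hx)⟩

/-- The check for writes is syntactic and decidable by evaluation. Therefore a fact such as
"register 5 is unchanged by this subprogram" is later obtained by giving `rfl` to the frame. -/
theorem Exec.frame {P : Prog} {s s' : State} {c : ℕ} (h : Exec P s s' c) : Frame P s s' := by
  induction h with
  | skip s => exact Frame.refl _ _
  | setNat s x e =>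
    refine ⟨fun y hy => ?_, fun _ _ => rfl, fun _ _ => rfl, fun _ _ => rfl⟩
    simp only [Prog.writesNatReg, beq_eq_false_iff_ne, ne_eq] at hy
    exact Function.update_of_ne (Ne.symm hy) _ _
  | setReal s x e =>
    refine ⟨fun _ _ => rfl, fun y hy => ?_, fun _ _ => rfl, fun _ _ => rfl⟩
    simp only [Prog.writesRealReg, beq_eq_false_iff_ne, ne_eq] at hy
    exact Function.update_of_ne (Ne.symm hy) _ _
  | storeNat s a i e =>
    refine ⟨fun _ _ => rfl, fun _ _ => rfl, fun y hy => ?_, fun _ _ => rfl⟩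
    simp only [Prog.writesNatArr, beq_eq_false_iff_ne, ne_eq] at hy
    exact Function.update_of_ne (Ne.symm hy) _ _
  | storeReal s a i e =>
    refine ⟨fun _ _ => rfl, fun _ _ => rfl, fun _ _ => rfl, fun y hy => ?_⟩
    simp only [Prog.writesRealArr, beq_eq_false_iff_ne, ne_eq] at hy
    exact Function.update_of_ne (Ne.symm hy) _ _
  | seq _ _ h₁ h₂ =>
    refine ⟨fun y hy => ?_, fun y hy => ?_, fun y hy => ?_, fun y hy => ?_⟩
    · simp only [Prog.writesNatReg, Bool.or_eq_false_iff] at hy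
      rw [h₂.natReg y hy.2, h₁.natReg y hy.1]
    · simp only [Prog.writesRealReg, Bool.or_eq_false_iff] at hy
      rw [h₂.realReg y hy.2, h₁.realReg y hy.1]
    · simp only [Prog.writesNatArr, Bool.or_eq_false_iff] at hy
      rw [h₂.natArr y hy.2, h₁.natArr y hy.1]
    · simp only [Prog.writesRealArr, Bool.or_eq_false_iff] at hy
      rw [h₂.realArr y hy.2, h₁.realArr y hy.1]
  | ite_true _ _ h =>
    refine ⟨fun y hy => h.natReg y ?_, fun y hy => h.realReg y ?_, fun y hy => h.natArr y ?_,
      fun y hy => h.realArr y ?_⟩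
    · exact (Bool.or_eq_false_iff.1 hy).1
    · exact (Bool.or_eq_false_iff.1 hy).1
    · exact (Bool.or_eq_false_iff.1 hy).1
    · exact (Bool.or_eq_false_iff.1 hy).1
  | ite_false _ _ h =>
    refine ⟨fun y hy => h.natReg y ?_, fun y hy => h.realReg y ?_, fun y hy => h.natArr y ?_,
      fun y hy => h.realArr y ?_⟩
    · exact (Bool.or_eq_false_iff.1 hy).2
    · exact (Bool.or_eq_false_iff.1 hy).2
    · exact (Bool.or_eq_false_iff.1 hy).2
    · exact (Bool.or_eq_false_iff.1 hy).2
  | while_true _ _ _ h₁ h₂ =>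
    exact ⟨fun y hy => (h₂.natReg y hy).trans (h₁.natReg y hy),
      fun y hy => (h₂.realReg y hy).trans (h₁.realReg y hy),
      fun y hy => (h₂.natArr y hy).trans (h₁.natArr y hy),
      fun y hy => (h₂.realArr y hy).trans (h₁.realArr y hy)⟩
  | while_false _ => exact Frame.refl _ _

/-- `WP P Q s c`: started in state `s` when `c` steps have been made already, the program `P` halts
in a state and at a time that satisfy `Q`. -/
def WP (P : Prog) (Q : State → ℕ → Prop) (s : State) (c : ℕ) : Prop :=
  ∃ s' d, Exec P s s' d ∧ Q s' (c + d)

/-- The postcondition comes with the frame, so specifications need to mention only memory that the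
program writes. -/
theorem WP.conseq {P : Prog} {Q Q' : State → ℕ → Prop} {s : State} {c : ℕ} (h : WP P Q s c)
    (hQ : ∀ s' c', Frame P s s' → Q s' c' → Q' s' c') : WP P Q' s c :=
  let ⟨s', d, hE, hs⟩ := h
  ⟨s', d, hE, hQ _ _ hE.frame hs⟩

theorem WP_skip {Q : State → ℕ → Prop} {s : State} {c : ℕ} :
    WP .skip Q s c ↔ Q s (c + 1) :=
  ⟨fun ⟨_, _, hE, h⟩ => by cases hE; exact h, fun h => ⟨_, _, .skip s, h⟩⟩

theorem WP_setNat {Q : State → ℕ → Prop} {s : State} {c x : ℕ} {e : NExpr} :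
    WP (.setNat x e) Q s c ↔ Q (s.setNat x (e.eval s)) (c + (e.cost + 1)) :=
  ⟨fun ⟨_, _, hE, h⟩ => by cases hE; exact h, fun h => ⟨_, _, .setNat s x e, h⟩⟩

theorem WP_setReal {Q : State → ℕ → Prop} {s : State} {c x : ℕ} {e : RExpr} :
    WP (.setReal x e) Q s c ↔ Q (s.setReal x (e.eval s)) (c + (e.cost + 1)) :=
  ⟨fun ⟨_, _, hE, h⟩ => by cases hE; exact h, fun h => ⟨_, _, .setReal s x e, h⟩⟩

theorem WP_storeNat {Q : State → ℕ → Prop} {s : State} {c a : ℕ} {i e : NExpr} :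
    WP (.storeNat a i e) Q s c ↔
      Q (s.storeNat a (i.eval s) (e.eval s)) (c + (i.cost + e.cost + 1)) :=
  ⟨fun ⟨_, _, hE, h⟩ => by cases hE; exact h, fun h => ⟨_, _, .storeNat s a i e, h⟩⟩

theorem WP_storeReal {Q : State → ℕ → Prop} {s : State} {c a : ℕ} {i : NExpr} {e : RExpr} :
    WP (.storeReal a i e) Q s c ↔
      Q (s.storeReal a (i.eval s) (e.eval s)) (c + (i.cost + e.cost + 1)) :=
  ⟨fun ⟨_, _, hE, h⟩ => by cases hE; exact h, fun h => ⟨_, _, .storeReal s a i e, h⟩⟩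

theorem WP_seq {P P' : Prog} {Q : State → ℕ → Prop} {s : State} {c : ℕ} :
    WP (.seq P P') Q s c ↔ WP P (WP P' Q) s c := by
  constructor
  · rintro ⟨s', d, hE, h⟩
    cases hE with
    | seq h₁ h₂ => exact ⟨_, _, h₁, _, _, h₂, by rwa [add_assoc]⟩
  · rintro ⟨s', d, h₁, s'', d', h₂, h⟩
    exact ⟨_, _, .seq h₁ h₂, by rwa [← add_assoc]⟩

theorem WP_ite {b : BExpr} {P P' : Prog} {Q : State → ℕ → Prop} {s : State} {c : ℕ} :
    WP (.ite b P P') Q s c ↔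
      (b.Holds s → WP P Q s (c + (b.cost + 1))) ∧ (¬ b.Holds s → WP P' Q s (c + (b.cost + 1))) := by
  constructor
  · rintro ⟨s', d, hE, h⟩
    cases hE with
    | ite_true hb h₁ =>
      refine ⟨fun _ => ⟨_, _, h₁, ?_⟩, fun hb' => absurd hb hb'⟩
      convert h using 1; ring
    | ite_false hb h₁ =>
      refine ⟨fun hb' => absurd hb' hb, fun _ => ⟨_, _, h₁, ?_⟩⟩
      convert h using 1; ring
  · rintro ⟨h₁, h₂⟩
    by_cases hb : b.Holds s
    · obtain ⟨s', d, hE, h⟩ := h₁ hb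
      refine ⟨_, _, .ite_true hb hE, ?_⟩
      convert h using 1; ring
    · obtain ⟨s', d, hE, h⟩ := h₂ hb
      refine ⟨_, _, .ite_false hb hE, ?_⟩
      convert h using 1; ring

theorem WP_block_nil {Q : State → ℕ → Prop} {s : State} {c : ℕ} :
    WP (.block []) Q s c ↔ Q s (c + 1) := WP_skip

theorem WP_block_cons {P : Prog} {l : List Prog} {Q : State → ℕ → Prop} {s : State} {c : ℕ} :
    WP (.block (P :: l)) Q s c ↔ WP P (WP (.block l) Q) s c := WP_seq

/-- The rule for loops, with an invariant `I` and a variant `μ`. -/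
theorem WP.while {b : BExpr} {P : Prog} {Q : State → ℕ → Prop} {s₀ : State} {c₀ : ℕ}
    (I : State → ℕ → Prop) (μ : State → ℕ) (init : I s₀ c₀)
    (step : ∀ s c, Frame P s₀ s → I s c → b.Holds s →
      WP P (fun s' c' => I s' c' ∧ μ s' < μ s) s (c + (b.cost + 1)))
    (exit : ∀ s c, Frame P s₀ s → I s c → ¬ b.Holds s → Q s (c + (b.cost + 1))) :
    WP (.while b P) Q s₀ c₀ := by
  -- The frame relative to the initial state is carried along the iterations; loop invariants can
  -- therefore omit everything that the body never writes.
  have key : ∀ N s c, μ s ≤ N → Frame P s₀ s → I s c → WP (.while b P) Q s c := by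
    intro N
    induction N with
    | zero =>
      intro s c hN hF hI
      by_cases hb : b.Holds s
      · obtain ⟨s', d, hE, hI', hμ⟩ := step s c hF hI hb
        omega
      · exact ⟨_, _, .while_false hb, exit s c hF hI hb⟩
    | succ N ih =>
      intro s c hN hF hI
      by_cases hb : b.Holds s
      · obtain ⟨s', d, hE, hI', hμ⟩ := step s c hF hI hb
        obtain ⟨s'', d', hE', h⟩ := ih s' _ (by omega) (hF.trans hE.frame) hI'
        refine ⟨_, _, .while_true hb hE hE', ?_⟩
        convert h using 1; ring
      · exact ⟨_, _, .while_false hb, exit s c hF hI hb⟩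
  exact key _ s₀ c₀ le_rfl (Frame.refl _ _) init

/-! ### Memory after a single write. -/

section StateLemmas

variable (s : State) (x y a b i v : ℕ) (r : ℝ)

theorem State.setNat_natReg : (s.setNat x v).natReg y = if y = x then v else s.natReg y :=
  Function.update_apply _ _ _ _
theorem State.setNat_realReg : (s.setNat x v).realReg = s.realReg := rfl
theorem State.setNat_natArr : (s.setNat x v).natArr = s.natArr := rfl
theorem State.setNat_realArr : (s.setNat x v).realArr = s.realArr := rfl
theorem State.setReal_natReg : (s.setReal x r).natReg = s.natReg := rfl
theorem State.setReal_realReg : (s.setReal x r).realReg y = if y = x then r else s.realReg y :=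
  Function.update_apply _ _ _ _
theorem State.setReal_natArr : (s.setReal x r).natArr = s.natArr := rfl
theorem State.setReal_realArr : (s.setReal x r).realArr = s.realArr := rfl
theorem State.storeNat_natReg : (s.storeNat a i v).natReg = s.natReg := rfl
theorem State.storeNat_realReg : (s.storeNat a i v).realReg = s.realReg := rfl
theorem State.storeNat_natArr : (s.storeNat a i v).natArr b =
    if b = a then Function.update (s.natArr a) i v else s.natArr b :=
  Function.update_apply _ _ _ _
theorem State.storeNat_realArr : (s.storeNat a i v).realArr = s.realArr := rfl
theorem State.storeReal_natReg : (s.storeReal a i r).natReg = s.natReg := rfl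
theorem State.storeReal_realReg : (s.storeReal a i r).realReg = s.realReg := rfl
theorem State.storeReal_natArr : (s.storeReal a i r).natArr = s.natArr := rfl
theorem State.storeReal_realArr : (s.storeReal a i r).realArr b =
    if b = a then Function.update (s.realArr a) i r else s.realArr b :=
  Function.update_apply _ _ _ _

end StateLemmas

attribute [simp] WP_skip WP_setNat WP_setReal WP_storeNat WP_storeReal WP_seq WP_ite WP_block_nil
  WP_block_cons State.setNat_natReg State.setNat_realReg State.setNat_natArr State.setNat_realArr
  State.setReal_natReg State.setReal_realReg State.setReal_natArr State.setReal_realArr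
  State.storeNat_natReg State.storeNat_realReg State.storeNat_natArr State.storeNat_realArr
  State.storeReal_natReg State.storeReal_realReg State.storeReal_natArr State.storeReal_realArr
  NExpr.eval NExpr.cost RExpr.eval RExpr.cost BExpr.Holds BExpr.cost

end Dilation

namespace Dilation

/-! ### The priority queue: counting -/

section Heap

open Finset Function

/-- The number of vertices of rank at least `i`. -/
def level (n : ℕ) (rank : ℕ → ℕ) (i : ℕ) : ℕ := #{x ∈ range n | i ≤ rank x}

/-- The number of vertices that have a parent. -/
def kids (n : ℕ) (par : ℕ → ℕ) : ℕ := #{y ∈ range n | par y ≠ 0}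

/-- The number of vertices of rank `i` that have a parent. -/
def kidsAt (n : ℕ) (rank par : ℕ → ℕ) (i : ℕ) : ℕ := #{y ∈ range n | par y ≠ 0 ∧ rank y = i}

/-- The number of vertices that are still in the queue. -/
def undone (n : ℕ) (done : ℕ → ℕ) : ℕ := #{x ∈ range n | done x = 0}

/-- The sum of all ranks. -/
def totalRank (n : ℕ) (rank : ℕ → ℕ) : ℕ := ∑ x ∈ range n, rank x

/-- Parent pointers (`0` for none, `x + 1` for `x`) form a heap ordered forest, in which a vertex
has at most one child of each rank below its own; it is recorded in `ch`. -/
def Forest (n : ℕ) (key : ℕ → ℝ) (done rank par ch : ℕ → ℕ) : Prop :=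
  ∀ y x, par y = x + 1 → y < n ∧ x < n ∧ done y = 0 ∧ done x = 0 ∧ rank y < rank x ∧
    key x ≤ key y ∧ ch (rank y * n + x) = y

/-- The lists of the vertices of rank at least `i`, for `1 ≤ i ≤ top`. -/
structure Levels (n top : ℕ) (rank row len lst : ℕ → ℕ) : Prop where
  le_top : ∀ x < n, rank x ≤ top
  row_eq : ∀ i ≤ top, row i = i * n
  len_eq : ∀ i ≤ top, len i = level n rank i
  mem : ∀ i, 1 ≤ i → i ≤ top → ∀ j < len i, lst (i * n + j) < n ∧ i ≤ rank (lst (i * n + j))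
  surj : ∀ i, 1 ≤ i → i ≤ top → ∀ x < n, i ≤ rank x → ∃ j < len i, lst (i * n + j) = x

/-- The roots are distributed among the segment from `lo` to `rl` of the array `R`, the buckets
(which are indexed by ranks), and a single vertex `cur`; here `0` stands for none and `x + 1`
for `x`. -/
structure Pool (n top : ℕ) (done rank par R : ℕ → ℕ) (lo rl : ℕ) (bucket : ℕ → ℕ) (cur : ℕ) :
    Prop where
  arr : ∀ j, lo ≤ j → j < rl → R j < n ∧ done (R j) = 0 ∧ par (R j) = 0 ∧
    bucket (rank (R j)) ≠ R j + 1 ∧ cur ≠ R j + 1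
  inj : ∀ i j, lo ≤ i → i < rl → lo ≤ j → j < rl → R i = R j → i = j
  bkt : ∀ r ≤ top, ∀ x, bucket r = x + 1 → x < n ∧ done x = 0 ∧ par x = 0 ∧ rank x = r ∧ cur ≠ x + 1
  cur_root : ∀ x, cur = x + 1 → x < n ∧ done x = 0 ∧ par x = 0
  surj : ∀ x < n, done x = 0 → par x = 0 →
    (∃ j, lo ≤ j ∧ j < rl ∧ R j = x) ∨ (∃ r ≤ top, bucket r = x + 1) ∨ cur = x + 1

theorem mul_add_inj {n i j x y : ℕ} (hx : x < n) (hy : y < n) (h : i * n + x = j * n + y) :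
    i = j ∧ x = y := by
  have h1 : (i * n + x) / n = i := by
    rw [mul_comm, Nat.mul_add_div (by omega), Nat.div_eq_of_lt hx, add_zero]
  have h2 : (j * n + y) / n = j := by
    rw [mul_comm, Nat.mul_add_div (by omega), Nat.div_eq_of_lt hy, add_zero]
  have : i = j := by rw [← h1, ← h2, h]
  subst this
  exact ⟨rfl, by omega⟩

theorem level_zero (n : ℕ) (rank : ℕ → ℕ) : level n rank 0 = n := by simp [level]

theorem level_anti (n : ℕ) (rank : ℕ → ℕ) : Antitone (level n rank) := fun _ _ hij =>
  card_le_card fun x hx => by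
    simp only [mem_filter] at hx ⊢
    exact ⟨hx.1, hij.trans hx.2⟩

theorem level_le (n : ℕ) (rank : ℕ → ℕ) (i : ℕ) : level n rank i ≤ n :=
  (level_anti n rank (Nat.zero_le i)).trans (level_zero n rank).le

theorem level_pos {n : ℕ} {rank : ℕ → ℕ} {i x : ℕ} (hx : x < n) (h : i ≤ rank x) :
    0 < level n rank i :=
  card_pos.2 ⟨x, by simp [hx, h]⟩

theorem level_eq_zero {n : ℕ} {rank : ℕ → ℕ} {i : ℕ} (h : ∀ x < n, rank x < i) :
    level n rank i = 0 := by
  simp only [level, card_eq_zero, filter_eq_empty_iff, mem_range]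
  intro x hx
  have := h x hx
  omega

/-- Vertices of rank above `i` and children of rank `i` are disjoint parts of level `i`. -/
theorem level_succ_add_kidsAt (n : ℕ) (rank par : ℕ → ℕ) (i : ℕ) :
    level n rank (i + 1) + kidsAt n rank par i ≤ level n rank i := by
  unfold level kidsAt
  rw [← card_union_of_disjoint]
  · refine card_le_card fun x hx => ?_
    simp only [mem_union, mem_filter, mem_range] at hx ⊢
    rcases hx with hx | hx
    · exact ⟨hx.1, by omega⟩
    · exact ⟨hx.1, by omega⟩
  · rw [disjoint_left]
    intro x hx hx'
    simp only [mem_filter] at hx hx'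
    omega

/-- Distinct children of rank at least `q` occupy distinct slots of level at least `q`. -/
theorem Forest.card_kids_le {n : ℕ} {key : ℕ → ℝ} {done rank par ch : ℕ → ℕ}
    (h : Forest n key done rank par ch) (q : ℕ) :
    #{y ∈ range n | par y ≠ 0 ∧ q ≤ rank y} ≤ ∑ x ∈ range n, (rank x - q) := by
  have : ∑ x ∈ range n, (rank x - q) = #((range n).sigma fun x => Ico q (rank x)) := by
    rw [card_sigma]
    simp
  rw [this]
  -- A child is sent to its slot, the pair of its parent and its own rank. The slot determines the
  -- child because `ch` records it.
  refine card_le_card_of_injOn (fun y => ⟨par y - 1, rank y⟩) ?_ ?_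
  · intro y hy
    simp only [coe_filter, mem_range, Set.mem_ofPred_eq] at hy
    obtain ⟨x, hx⟩ := Nat.exists_eq_succ_of_ne_zero hy.2.1
    have := h y x hx
    simp only [mem_coe, mem_sigma, mem_range, mem_Ico]
    rw [hx]
    exact ⟨this.2.1, hy.2.2, this.2.2.2.2.1⟩
  · intro y hy z hz hyz
    simp only [coe_filter, mem_range, Set.mem_ofPred_eq] at hy hz
    obtain ⟨x, hx⟩ := Nat.exists_eq_succ_of_ne_zero hy.2.1
    obtain ⟨x', hx'⟩ := Nat.exists_eq_succ_of_ne_zero hz.2.1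
    simp only [Sigma.mk.injEq, heq_eq_eq] at hyz
    have e : x = x' := by omega
    subst e
    rw [← (h y x hx).2.2.2.2.2.2, ← (h z x hx').2.2.2.2.2.2, hyz.2]

theorem Forest.kids_le {n : ℕ} {key : ℕ → ℝ} {done rank par ch : ℕ → ℕ}
    (h : Forest n key done rank par ch) : kids n par ≤ totalRank n rank := by
  simpa [kids, totalRank] using h.card_kids_le 0

theorem Forest.kids_le_undone {n : ℕ} {key : ℕ → ℝ} {done rank par ch : ℕ → ℕ}
    (h : Forest n key done rank par ch) : kids n par ≤ undone n done := by
  refine card_le_card fun y hy => ?_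
  simp only [mem_filter] at hy ⊢
  obtain ⟨x, hx⟩ := Nat.exists_eq_succ_of_ne_zero hy.2
  exact ⟨hy.1, (h y x hx).2.2.1⟩

/-- Every vertex in the queue lies below a root. -/
theorem Forest.exists_root {n : ℕ} {key : ℕ → ℝ} {done rank par ch : ℕ → ℕ} {top : ℕ}
    (h : Forest n key done rank par ch) (ht : ∀ x < n, rank x ≤ top) {y : ℕ} (hy : y < n)
    (hd : done y = 0) : ∃ x < n, done x = 0 ∧ par x = 0 ∧ key x ≤ key y := by
  -- Ranks increase strictly towards the parent and are bounded by `top`, so following parent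
  -- pointers ends at a root; heap order gives the inequality of keys.
  induction hk : top - rank y using Nat.strong_induction_on generalizing y with
  | _ k ih =>
    by_cases h0 : par y = 0
    · exact ⟨y, hy, hd, h0, le_rfl⟩
    · obtain ⟨x, hx⟩ := Nat.exists_eq_succ_of_ne_zero h0
      obtain ⟨-, hxn, -, hxd, hr, hkey, -⟩ := h y x hx
      have := ht x hxn
      obtain ⟨z, hz, hzd, hzp, hzk⟩ := ih (top - rank x) (by omega) hxn hxd rfl
      exact ⟨z, hz, hzd, hzp, hzk.trans hkey⟩

theorem card_filter_range_eq_add_one {n a : ℕ} {p q : ℕ → Prop} [DecidablePred p]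
    [DecidablePred q] (ha : a < n) (hp : ¬ p a) (hq : q a) (h : ∀ x < n, x ≠ a → (q x ↔ p x)) :
    #{x ∈ range n | q x} = #{x ∈ range n | p x} + 1 := by
  have : {x ∈ range n | q x} = insert a {x ∈ range n | p x} := by
    ext x
    simp only [mem_filter, mem_insert, mem_range]
    by_cases hx : x = a
    · subst hx; simp [ha, hq]
    · simp only [hx, false_or]
      exact and_congr_right fun hxn => h x hxn hx
  rw [this, card_insert_of_notMem (by simp [hp])]

theorem kids_set {n : ℕ} {par : ℕ → ℕ} {y v : ℕ} (hy : y < n) (h : par y = 0) :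
    kids n (update par y (v + 1)) = kids n par + 1 :=
  card_filter_range_eq_add_one hy (by simpa using h) (by simp)
    fun x _ hx => by simp [hx]

theorem kids_clear {n : ℕ} {par : ℕ → ℕ} {y : ℕ} (hy : y < n) (h : par y ≠ 0) :
    kids n (update par y 0) + 1 = kids n par :=
  (card_filter_range_eq_add_one hy (by simp) h
    fun x _ hx => by simp [hx]).symm

theorem undone_set {n : ℕ} {done : ℕ → ℕ} {x : ℕ} (hx : x < n) (h : done x = 0) :
    undone n (update done x 1) + 1 = undone n done :=
  (card_filter_range_eq_add_one hx (by simp) h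
    fun y _ hy => by simp [hy]).symm

theorem totalRank_set {n : ℕ} {rank : ℕ → ℕ} {x : ℕ} (hx : x < n) :
    totalRank n (update rank x (rank x + 1)) = totalRank n rank + 1 := by
  unfold totalRank
  rw [sum_update_of_mem (mem_range.2 hx), ← add_sum_erase _ _ (mem_range.2 hx), sdiff_singleton_eq_erase]
  omega

theorem level_set {n : ℕ} {rank : ℕ → ℕ} {x : ℕ} (hx : x < n) (i : ℕ) :
    level n (update rank x (rank x + 1)) i =
      level n rank i + if i = rank x + 1 then 1 else 0 := by
  split_ifs with h
  · refine card_filter_range_eq_add_one hx (by omega) (by simp [h]) fun y _ hy => by simp [hy]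
  · refine congrArg card (filter_congr fun y _ => ?_)
    by_cases hy : y = x
    · subst hy; simp; omega
    · simp [hy]

/-- The winner `w` changes its rank, but as a root it is counted in no `kidsAt`; only the loser `l`
is new. -/
theorem kidsAt_link {n : ℕ} {rank par : ℕ → ℕ} {w l : ℕ} (hl : l < n) (hlw : l ≠ w)
    (hpl : par l = 0) (hpw : par w = 0) (i : ℕ) :
    kidsAt n (update rank w (rank w + 1)) (update par l (w + 1)) i =
      kidsAt n rank par i + if i = rank l then 1 else 0 := by
  split_ifs with h
  · refine card_filter_range_eq_add_one hl (by simp [hpl]) (by simp [hlw, h]) fun y _ hy => ?_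
    by_cases hyw : y = w
    · subst hyw; simp [hy, hpw]
    · simp [hy, hyw]
  · refine congrArg card (filter_congr fun y _ => ?_)
    by_cases hy : y = l
    · subst hy; simp [hlw, hpl]; omega
    · by_cases hyw : y = w
      · subst hyw; simp [hy, hpw]
      · simp [hy, hyw]

/-- The number of roots. -/
theorem Pool.rl_add_kids {n top : ℕ} {key : ℕ → ℝ} {done rank par ch R bucket : ℕ → ℕ} {rl : ℕ}
    (hF : Forest n key done rank par ch) (h : Pool n top done rank par R 0 rl bucket 0)
    (hb : ∀ r ≤ top, bucket r = 0) : rl + kids n par = undone n done := by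
  have h1 : #{x ∈ range n | done x = 0 ∧ par x = 0} = rl := by
    rw [← card_range rl]
    symm
    refine card_bij (fun j _ => R j) ?_ ?_ ?_
    · intro j hj
      have := h.arr j (Nat.zero_le _) (mem_range.1 hj)
      simp [this]
    · intro i hi j hj hij
      exact h.inj i j (Nat.zero_le _) (mem_range.1 hi) (Nat.zero_le _) (mem_range.1 hj) hij
    · intro x hx
      simp only [mem_filter, mem_range] at hx
      rcases h.surj x hx.1 hx.2.1 hx.2.2 with ⟨j, -, hj, rfl⟩ | ⟨r, hr, hbr⟩ | hc
      · exact ⟨j, mem_range.2 hj, rfl⟩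
      · rw [hb r hr] at hbr; omega
      · omega
  rw [← h1, kids, undone, ← card_union_of_disjoint]
  · congr 1
    ext y
    simp only [mem_union, mem_filter, mem_range]
    constructor
    · rintro (⟨h1, h2, -⟩ | ⟨h1, h2⟩)
      · exact ⟨h1, h2⟩
      · obtain ⟨x, hx⟩ := Nat.exists_eq_succ_of_ne_zero h2
        exact ⟨h1, (hF y x hx).2.2.1⟩
    · tauto
  · rw [disjoint_left]
    intro x hx hx'
    simp only [mem_filter] at hx hx'
    tauto

/-- The number of roots is bounded by the number of ranks if every root is in a bucket. -/
theorem Pool.undone_le {n top : ℕ} {done rank par R bucket : ℕ → ℕ} {rl : ℕ}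
    (h : Pool n top done rank par R rl rl bucket 0) :
    undone n done ≤ kids n par + (top + 1) := by
  have h1 : #{x ∈ range n | done x = 0 ∧ par x = 0} ≤ top + 1 := by
    rw [← card_range (top + 1)]
    refine card_le_card_of_injOn rank ?_ ?_
    · intro x hx
      simp only [coe_filter, mem_range, Set.mem_ofPred_eq] at hx
      rcases h.surj x hx.1 hx.2.1 hx.2.2 with ⟨j, hj, hj', rfl⟩ | ⟨r, hr, hbr⟩ | hc
      · omega
      · have := (h.bkt r hr x hbr).2.2.2.1
        simp [this]; omega
      · omega
    · intro x hx y hy hxy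
      simp only [coe_filter, mem_range, Set.mem_ofPred_eq] at hx hy
      rcases h.surj x hx.1 hx.2.1 hx.2.2 with ⟨j, hj, hj', rfl⟩ | ⟨r, hr, hbr⟩ | hc
      · omega
      · rcases h.surj y hy.1 hy.2.1 hy.2.2 with ⟨j, hj, hj', rfl⟩ | ⟨r', hr', hbr'⟩ | hc
        · omega
        · have e1 := (h.bkt r hr x hbr).2.2.2.1
          have e2 := (h.bkt r' hr' y hbr').2.2.2.1
          have : r = r' := by omega
          subst this
          omega
        · omega
      · omega
  have h2 : undone n done ≤ #{x ∈ range n | done x = 0 ∧ par x = 0} + kids n par := by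
    rw [kids, undone]
    refine (card_le_card fun y hy => ?_).trans (card_union_le _ _)
    simp only [mem_union, mem_filter, mem_range] at hy ⊢
    tauto
  omega

/-! ### The rank bound -/

/-- Since (3/4)³ < 1/2, every three levels at least halve the size, which starts at `n`. -/
theorem level_geometric {n : ℕ} {rank : ℕ → ℕ}
    (h : ∀ i, 4 * level n rank (i + 1) ≤ 3 * level n rank i) :
    level n rank (3 * (Nat.log 2 n + 1)) = 0 := by
  have h3 : ∀ q, level n rank (3 * q) * 2 ^ q ≤ n := by
    intro q
    induction q with
    | zero => simp [level_zero]
    | succ q ih =>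
      have h1 := h (3 * q)
      have h2 := h (3 * q + 1)
      have h3 : 4 * level n rank (3 * q + 1 + 1 + 1) ≤ 3 * level n rank (3 * q + 1 + 1) := h _
      have h4 : level n rank (3 * (q + 1)) * 2 ≤ level n rank (3 * q) := by
        rw [show 3 * (q + 1) = 3 * q + 1 + 1 + 1 by ring]
        omega
      calc level n rank (3 * (q + 1)) * 2 ^ (q + 1)
          = (level n rank (3 * (q + 1)) * 2) * 2 ^ q := by ring
        _ ≤ level n rank (3 * q) * 2 ^ q := Nat.mul_le_mul_right _ h4
        _ ≤ n := ih
  by_contra hne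
  have h1 := h3 (Nat.log 2 n + 1)
  have h2 := Nat.lt_pow_succ_log_self (b := 2) (by norm_num) n
  have h5 := Nat.mul_le_mul_right (2 ^ (Nat.log 2 n + 1)) (Nat.one_le_iff_ne_zero.2 hne)
  omega

/-- During consolidation the 3/4 rule may fail. Above `K`, however, the levels were empty at the
start, and every link that enlarges level `i + 1` also creates a child of rank `i`. Equality of the
two counts makes level `i + 1` at most half of level `i`, so only log₂ `n` further ranks can arise.
-/
theorem level_halving {n K top : ℕ} {rank par : ℕ → ℕ}
    (h : ∀ i, K ≤ i → level n rank (i + 1) = kidsAt n rank par i) (ht : 0 < level n rank top) :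
    top ≤ K + Nat.log 2 n := by
  have h2 : ∀ q, level n rank (K + q) * 2 ^ q ≤ n := by
    intro q
    induction q with
    | zero => simpa using level_le n rank K
    | succ q ih =>
      have h1 := h (K + q) (by omega)
      have h2 := level_succ_add_kidsAt n rank par (K + q)
      calc level n rank (K + (q + 1)) * 2 ^ (q + 1)
          = (level n rank (K + q + 1) * 2) * 2 ^ q := by rw [← add_assoc]; ring
        _ ≤ level n rank (K + q) * 2 ^ q := Nat.mul_le_mul_right _ (by omega)
        _ ≤ n := ih
  by_contra hlt
  have h3 := h2 (Nat.log 2 n + 1)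
  have h4 := Nat.lt_pow_succ_log_self (b := 2) (by norm_num) n
  have h5 := level_anti n rank (show K + (Nat.log 2 n + 1) ≤ top by omega)
  have h6 := Nat.mul_le_mul_right (2 ^ (Nat.log 2 n + 1)) (ht.trans_le h5)
  omega

end Heap

end Dilation

namespace Dilation

section Heap

open Finset Function

/-! ### The priority queue: elementary operations -/

theorem Forest.link {n : ℕ} {key : ℕ → ℝ} {done rank par ch : ℕ → ℕ} {w l : ℕ}
    (h : Forest n key done rank par ch) (hw : w < n) (hl : l < n) (hdw : done w = 0)
    (hdl : done l = 0) (hpw : par w = 0) (hr : rank l = rank w) (hk : key w ≤ key l)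
    (hwl : l ≠ w) :
    Forest n key done (update rank w (rank w + 1)) (update par l (w + 1))
      (update ch (rank w * n + w) l) := by
  intro y x hyx
  by_cases hy : y = l
  · subst hy
    rw [update_self] at hyx
    obtain rfl : w = x := by omega
    refine ⟨hl, hw, hdl, hdw, ?_, hk, ?_⟩
    · simp [hwl, hr]
    · simp [hwl, hr]
  · rw [update_of_ne hy] at hyx
    obtain ⟨h1, h2, h3, h4, h5, h6, h7⟩ := h y x hyx
    have hyw : y ≠ w := by rintro rfl; omega
    refine ⟨h1, h2, h3, h4, ?_, h6, ?_⟩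
    · rw [update_of_ne hyw]
      by_cases hx : x = w
      · subst hx; simp; omega
      · simpa [hx] using h5
    -- The overwritten slot of `w` belongs to the old rank of `w`, and all earlier children of `w`
    -- have smaller ranks.
    · rw [update_of_ne hyw, update_of_ne, h7]
      intro he
      obtain ⟨e1, rfl⟩ := mul_add_inj h2 hw he
      omega

theorem Levels.grow {n top : ℕ} {rank row len lst : ℕ → ℕ} (h : Levels n top rank row len lst) :
    Levels n (top + 1) rank (update row (top + 1) (row top + n)) (update len (top + 1) 0) lst where
  le_top x hx := (h.le_top x hx).trans (Nat.le_succ _)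
  row_eq i hi := by
    rcases Nat.lt_or_eq_of_le hi with hi | rfl
    · rw [update_of_ne (by omega), h.row_eq i (by omega)]
    · rw [update_self, h.row_eq _ le_rfl]; ring
  len_eq i hi := by
    rcases Nat.lt_or_eq_of_le hi with hi | rfl
    · rw [update_of_ne (by omega), h.len_eq i (by omega)]
    · rw [update_self, level_eq_zero fun x hx => Nat.lt_succ_of_le (h.le_top x hx)]
  mem i h1 hi j hj := by
    rcases Nat.lt_or_eq_of_le hi with hi | rfl
    · rw [update_of_ne (by omega)] at hj
      exact h.mem i h1 (by omega) j hj
    · rw [update_self] at hj; omega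
  surj i h1 hi x hx hr := by
    rcases Nat.lt_or_eq_of_le hi with hi | rfl
    · rw [update_of_ne (by omega)]
      exact h.surj i h1 (by omega) x hx hr
    · have := h.le_top x hx; omega

theorem Levels.link {n top : ℕ} {rank row len lst : ℕ → ℕ} {w : ℕ}
    (h : Levels n top rank row len lst) (hw : w < n) (hr : rank w < top) :
    Levels n top (update rank w (rank w + 1)) row
      (update len (rank w + 1) (len (rank w + 1) + 1))
      (update lst ((rank w + 1) * n + len (rank w + 1)) w) := by
  have hlt : ∀ i ≤ top, i ≠ rank w + 1 → len i ≤ n := fun i hi _ => by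
    rw [h.len_eq i hi]; exact level_le n rank i
  -- `w` itself is not yet in this list, so the new entry still fits into a row of width `n` and
  -- does not spill into the next list.
  have hlen : len (rank w + 1) < n := by
    rw [h.len_eq (rank w + 1) hr]
    have h1 := level_set (rank := rank) hw (rank w + 1)
    have h2 := level_le n (update rank w (rank w + 1)) (rank w + 1)
    simp only [if_true] at h1
    omega
  constructor
  · intro x hx
    by_cases hxw : x = w
    · subst hxw; simpa using hr
    · simpa [hxw] using h.le_top x hx
  · exact h.row_eq
  · intro i hi
    rw [level_set hw]
    by_cases hir : i = rank w + 1
    · subst hir; simp [h.len_eq _ hi]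
    · simp [hir, h.len_eq _ hi]
  · intro i h1 hi j hj
    by_cases hir : i = rank w + 1
    · subst hir
      rw [update_self] at hj
      by_cases hjl : j = len (rank w + 1)
      · subst hjl
        simp [hw]
      · rw [update_of_ne (a := (rank w + 1) * n + j) (by omega)]
        obtain ⟨h2, h3⟩ := h.mem _ h1 hi j (by omega)
        refine ⟨h2, ?_⟩
        rw [update_of_ne]
        · exact h3
        · intro e; rw [e] at h3; omega
    · rw [update_of_ne hir] at hj
      have hjn : j < n := hj.trans_le (hlt i hi hir)
      rw [update_of_ne (a := i * n + j)]
      · obtain ⟨h2, h3⟩ := h.mem _ h1 hi j hj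
        refine ⟨h2, ?_⟩
        by_cases hxw : lst (i * n + j) = w
        · rw [hxw] at h3 ⊢; simp; omega
        · rwa [update_of_ne hxw]
      · intro e
        exact hir (mul_add_inj hjn hlen e).1
  · intro i h1 hi x hx hxr
    by_cases hir : i = rank w + 1
    · subst hir
      by_cases hxw : x = w
      · exact ⟨len (rank w + 1), by simp, by simp [hxw]⟩
      · rw [update_of_ne hxw] at hxr
        obtain ⟨j, hj, hjx⟩ := h.surj _ h1 hi x hx hxr
        exact ⟨j, by simp; omega, by rw [update_of_ne (by omega), hjx]⟩
    · have hxr' : i ≤ rank x := by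
        by_cases hxw : x = w
        · subst hxw; simp at hxr; omega
        · rwa [update_of_ne hxw] at hxr
      obtain ⟨j, hj, hjx⟩ := h.surj _ h1 hi x hx hxr'
      refine ⟨j, by rwa [update_of_ne hir], ?_⟩
      rw [update_of_ne, hjx]
      intro e
      exact hir (mul_add_inj (hj.trans_le (hlt i hi hir)) hlen e).1

theorem Pool.pop {n top : ℕ} {done rank par R bucket : ℕ → ℕ} {lo rl : ℕ}
    (h : Pool n top done rank par R lo rl bucket 0) (hlo : lo < rl) :
    Pool n top done rank par R (lo + 1) rl bucket (R lo + 1) where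
  arr j h1 h2 := by
    obtain ⟨a, b, c, d, -⟩ := h.arr j (by omega) h2
    refine ⟨a, b, c, d, fun e => ?_⟩
    have := h.inj lo j le_rfl hlo (by omega) h2 (by omega)
    omega
  inj i j h1 h2 h3 h4 := h.inj i j (by omega) h2 (by omega) h4
  bkt r hr x hx := by
    obtain ⟨a, b, c, d, -⟩ := h.bkt r hr x hx
    refine ⟨a, b, c, d, fun e => ?_⟩
    have := (h.arr lo le_rfl hlo).2.2.2.1
    obtain rfl : R lo = x := by omega
    exact this (d ▸ hx)
  cur_root x hx := by
    obtain ⟨a, b, c, -⟩ := h.arr lo le_rfl hlo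
    obtain rfl : R lo = x := by omega
    exact ⟨a, b, c⟩
  surj x hx hd hp := by
    rcases h.surj x hx hd hp with ⟨j, h1, h2, rfl⟩ | h1 | h1
    · by_cases hj : j = lo
      · subst hj; exact Or.inr (Or.inr rfl)
      · exact Or.inl ⟨j, by omega, h2, rfl⟩
    · exact Or.inr (Or.inl h1)
    · omega

theorem Pool.grow {n top : ℕ} {done rank par R bucket : ℕ → ℕ} {lo rl cur : ℕ}
    (h : Pool n top done rank par R lo rl bucket cur) :
    Pool n (top + 1) done rank par R lo rl (update bucket (top + 1) 0) cur where
  arr j h1 h2 := by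
    obtain ⟨a, b, c, d, e⟩ := h.arr j h1 h2
    refine ⟨a, b, c, ?_, e⟩
    by_cases hr : rank (R j) = top + 1
    · rw [hr]; simp
    · rwa [update_of_ne hr]
  inj := h.inj
  bkt r hr x hx := by
    rcases Nat.lt_or_eq_of_le hr with hr | rfl
    · rw [update_of_ne (by omega)] at hx
      exact h.bkt r (by omega) x hx
    · rw [update_self] at hx; omega
  cur_root := h.cur_root
  surj x hx hd hp := by
    rcases h.surj x hx hd hp with h1 | ⟨r, h1, h2⟩ | h1
    · exact Or.inl h1
    · exact Or.inr (Or.inl ⟨r, by omega, by rwa [update_of_ne (by omega)]⟩)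
    · exact Or.inr (Or.inr h1)

theorem Pool.link {n top : ℕ} {done rank par R bucket : ℕ → ℕ} {lo rl x y w l : ℕ}
    (h : Pool n top done rank par R lo rl bucket (x + 1)) (hr : rank x ≤ top)
    (hb : bucket (rank x) = y + 1) (hwl : (w = x ∧ l = y) ∨ (w = y ∧ l = x)) :
    Pool n top done (update rank w (rank x + 1)) (update par l (w + 1)) R lo rl
      (update bucket (rank x) 0) (w + 1) := by
  obtain ⟨y1, y2, y3, y4, y5⟩ := h.bkt _ hr y hb
  obtain ⟨x1, x2, x3⟩ := h.cur_root x rfl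
  constructor
  · intro j h1 h2
    obtain ⟨a, b, c, d, e⟩ := h.arr j h1 h2
    have hx : R j ≠ x := by omega
    have hy : R j ≠ y := by rintro rfl; rw [y4] at d; exact d hb
    have hl : R j ≠ l := by rcases hwl with ⟨-, rfl⟩ | ⟨-, rfl⟩ <;> assumption
    have hw : R j ≠ w := by rcases hwl with ⟨rfl, -⟩ | ⟨rfl, -⟩ <;> assumption
    refine ⟨a, b, by rwa [update_of_ne hl], ?_, by omega⟩
    rw [update_of_ne hw]
    by_cases hrr : rank (R j) = rank x
    · rw [hrr]; simp
    · rwa [update_of_ne hrr]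
  · exact h.inj
  · intro r hr' z hz
    by_cases hrr : r = rank x
    · subst hrr; rw [update_self] at hz; omega
    · rw [update_of_ne hrr] at hz
      obtain ⟨a, b, c, d, e⟩ := h.bkt r hr' z hz
      have hzx : z ≠ x := by omega
      have hzy : z ≠ y := by rintro rfl; omega
      have hl : z ≠ l := by rcases hwl with ⟨-, rfl⟩ | ⟨-, rfl⟩ <;> assumption
      have hw : z ≠ w := by rcases hwl with ⟨rfl, -⟩ | ⟨rfl, -⟩ <;> assumption
      exact ⟨a, b, by rwa [update_of_ne hl], by rwa [update_of_ne hw], by omega⟩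
  · intro z hz
    obtain rfl : w = z := by omega
    rcases hwl with ⟨rfl, rfl⟩ | ⟨rfl, rfl⟩
    · exact ⟨x1, x2, by rwa [update_of_ne (by omega)]⟩
    · exact ⟨y1, y2, by rwa [update_of_ne (by omega)]⟩
  · intro z hz hd hp
    have hzl : z ≠ l := by rintro rfl; simp at hp
    rw [update_of_ne hzl] at hp
    by_cases hzw : z = w
    · exact Or.inr (Or.inr (by rw [hzw]))
    · rcases h.surj z hz hd hp with h1 | ⟨r, h1, h2⟩ | h1
      · exact Or.inl h1
      · refine Or.inr (Or.inl ⟨r, h1, ?_⟩)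
        rw [update_of_ne]
        · exact h2
        · rintro rfl
          have : z = y := by omega
          rcases hwl with ⟨rfl, rfl⟩ | ⟨rfl, rfl⟩ <;> omega
      · rcases hwl with ⟨rfl, rfl⟩ | ⟨rfl, rfl⟩ <;> omega

theorem Pool.park {n top : ℕ} {done rank par R bucket : ℕ → ℕ} {lo rl x : ℕ}
    (h : Pool n top done rank par R lo rl bucket (x + 1)) (hr : rank x ≤ top)
    (hb : bucket (rank x) = 0) :
    Pool n top done rank par R lo rl (update bucket (rank x) (x + 1)) 0 := by
  obtain ⟨x1, x2, x3⟩ := h.cur_root x rfl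
  constructor
  · intro j h1 h2
    obtain ⟨a, b, c, d, e⟩ := h.arr j h1 h2
    refine ⟨a, b, c, ?_, by omega⟩
    by_cases hrr : rank (R j) = rank x
    · rw [hrr]; simp; omega
    · rwa [update_of_ne hrr]
  · exact h.inj
  · intro r hr' z hz
    by_cases hrr : r = rank x
    · subst hrr
      rw [update_self] at hz
      obtain rfl : x = z := by omega
      exact ⟨x1, x2, x3, rfl, by omega⟩
    · rw [update_of_ne hrr] at hz
      obtain ⟨a, b, c, d, e⟩ := h.bkt r hr' z hz
      exact ⟨a, b, c, d, by omega⟩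
  · intro z hz; omega
  · intro z hz hd hp
    rcases h.surj z hz hd hp with h1 | ⟨r, h1, h2⟩ | h1
    · exact Or.inl h1
    · refine Or.inr (Or.inl ⟨r, h1, ?_⟩)
      rw [update_of_ne]
      · exact h2
      · rintro rfl; omega
    · exact Or.inr (Or.inl ⟨rank x, hr, by simp; omega⟩)

end Heap

end Dilation

namespace Dilation

section Heap

open Finset Function

/-! ### The priority queue: the program

Memory layout.
Natural number registers: `0` answer, `1` `n`, `2` `m`, `3` `k`, `4` largest rank, `5` number of
roots, `6` source, `7` number of extracted vertices, `8` to `16` local variables.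
Natural number arrays: `0`, `1` edges, `2` multiples of `n`, `3` first arcs, `4` next arcs,
`5` heads of arcs, `6` extracted vertices, `7` ranks, `8` parents, `9` children, `10` numbers of
vertices of rank at least `i`, `11` lists of these vertices, `12` roots, `13` buckets.
Real arrays: `0` distances in `M`, `1` keys, `2` distances in the graph. -/

/-- The forest in memory. -/
abbrev State.Forest (s : State) (n : ℕ) : Prop :=
  Dilation.Forest n (s.realArr 1) (s.natArr 6) (s.natArr 7) (s.natArr 8) (s.natArr 9)

/-- The lists of vertices of given rank in memory. -/
abbrev State.Levels (s : State) (n : ℕ) : Prop :=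
  Dilation.Levels n (s.natReg 4) (s.natArr 7) (s.natArr 2) (s.natArr 10) (s.natArr 11)

/-- The roots in memory. -/
abbrev State.Pool (s : State) (n lo cur : ℕ) : Prop :=
  Dilation.Pool n (s.natReg 4) (s.natArr 6) (s.natArr 7) (s.natArr 8) (s.natArr 12) lo
    (s.natReg 5) (s.natArr 13) cur

attribute [simp] State.Forest State.Levels State.Pool

/-- If the rank in register `11` is the largest one, make room for the next rank. -/
def growStep : Prog :=
  .ite (.natEq (.reg 11) (.reg 4))
    (.block [
      .storeNat 2 (.add (.reg 4) (.lit 1)) (.add (.arr 2 (.reg 4)) (.reg 1)),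
      .storeNat 10 (.add (.reg 4) (.lit 1)) (.lit 0),
      .storeNat 13 (.add (.reg 4) (.lit 1)) (.lit 0),
      .setNat 4 (.add (.reg 4) (.lit 1))]) .skip

/-- Link the tree of register `9` with the tree in the bucket of its rank, which is in
register `11`. -/
def linkStep : Prog := .block [
  .setNat 10 (.sub (.arr 13 (.reg 11)) (.lit 1)),
  .storeNat 13 (.reg 11) (.lit 0),
  .ite (.realLT (.arr 1 (.reg 10)) (.arr 1 (.reg 9)))
    (.block [.setNat 12 (.reg 9), .setNat 9 (.reg 10), .setNat 10 (.reg 12)]) .skip,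
  .storeNat 8 (.reg 10) (.add (.reg 9) (.lit 1)),
  .storeNat 9 (.add (.arr 2 (.reg 11)) (.reg 9)) (.reg 10),
  .setNat 11 (.add (.reg 11) (.lit 1)),
  .storeNat 7 (.reg 9) (.reg 11),
  .storeNat 11 (.add (.arr 2 (.reg 11)) (.arr 10 (.reg 11))) (.reg 9),
  .storeNat 10 (.reg 11) (.add (.arr 10 (.reg 11)) (.lit 1))]

/-- Invariant of the consolidation of the roots. -/
structure State.Consolidating (s : State) (n K lo cur : ℕ) : Prop where
  n_eq : s.natReg 1 = n
  forest : s.Forest n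
  levels : s.Levels n
  pool : s.Pool n lo cur
  full : ∀ i, K ≤ i → level n (s.natArr 7) (i + 1) = kidsAt n (s.natArr 7) (s.natArr 8) i
  row_eq : ∀ i ≤ n, s.natArr 2 i = i * n

/-- A newly opened top level is empty until the link that follows puts the winner there; hence the
disjunction about the top level. -/
theorem growStep_spec {s : State} {c n K lo x : ℕ} (h : s.Consolidating n K lo (x + 1))
    (h11 : s.natReg 11 = s.natArr 7 x) (ht : 0 < level n (s.natArr 7) (s.natReg 4)) :
    WP growStep (fun s' c' => c' ≤ c + 40 ∧ s'.Consolidating n K lo (x + 1) ∧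
      s'.natReg 11 < s'.natReg 4 ∧
      (s'.natReg 4 = s'.natReg 11 + 1 ∨ 0 < level n (s'.natArr 7) (s'.natReg 4)) ∧
      s'.natArr 13 (s'.natReg 11) = s.natArr 13 (s'.natReg 11)) s c := by
  have hle := h.levels.le_top x (h.pool.cur_root x rfl).1
  simp only [growStep, WP_ite, WP_block_cons, WP_block_nil, WP_storeNat, WP_setNat, WP_skip]
  refine ⟨fun hb => ?_, fun hb => ?_⟩
  · simp only [BExpr.Holds, NExpr.eval] at hb
    refine ⟨by simp, ⟨?_, ?_, ?_, ?_, ?_, ?_⟩, ?_, ?_, ?_⟩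
    · simpa using h.n_eq
    · simpa using h.forest
    · simpa [h.n_eq] using h.levels.grow
    · simpa using h.pool.grow
    · simpa using h.full
    · intro i hi
      have e := h.levels.row_eq _ le_rfl
      simp only [State.storeNat_natArr, State.setNat_natArr, NExpr.eval]
      -- The table of multiples may already contain the entry for the new rank; then the value
      -- written is the one that was there.
      by_cases hi' : i = s.natReg 4 + 1
      · subst hi'
        simp [e, h.n_eq]; ring
      · simp [hi', h.row_eq i hi]
    · simp [hb]
    · simp [hb]
    · simp [hb]
  · simp only [BExpr.Holds, NExpr.eval] at hb
    exact ⟨by simp, h, by omega, Or.inr ht, trivial⟩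

theorem linkStep_spec {s : State} {c n K lo x y : ℕ} (h : s.Consolidating n K lo (x + 1))
    (h9 : s.natReg 9 = x) (h11 : s.natReg 11 = s.natArr 7 x)
    (hb : s.natArr 13 (s.natArr 7 x) = y + 1) (hlt : s.natReg 11 < s.natReg 4)
    (ht : s.natReg 4 = s.natReg 11 + 1 ∨ 0 < level n (s.natArr 7) (s.natReg 4)) :
    WP linkStep (fun s' c' => c' ≤ c + 80 ∧
      s'.Consolidating n K lo (s'.natReg 9 + 1) ∧ s'.natReg 11 = s'.natArr 7 (s'.natReg 9) ∧
      0 < level n (s'.natArr 7) (s'.natReg 4) ∧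
      kids n (s'.natArr 8) = kids n (s.natArr 8) + 1 ∧
      totalRank n (s'.natArr 7) = totalRank n (s.natArr 7) + 1) s c := by
  obtain ⟨x1, x2, x3⟩ := h.pool.cur_root x rfl
  obtain ⟨y1, y2, y3, y4, y5⟩ := h.pool.bkt _ (by omega) y hb
  have hrow := h.levels.row_eq (s.natArr 7 x) (by omega)
  have hrow' := h.levels.row_eq (s.natArr 7 x + 1) (by omega)
  -- All assertions are proved once for an abstract winner `w` and loser `l`; the two outcomes of
  -- the comparison of keys instantiate them.
  have hpost : ∀ w l, ((w = x ∧ l = y) ∨ (w = y ∧ l = x)) → s.realArr 1 w ≤ s.realArr 1 l → 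
      ∀ s' : State, s'.natReg 1 = s.natReg 1 → s'.natReg 4 = s.natReg 4 →
        s'.natReg 5 = s.natReg 5 → s'.natReg 9 = w → s'.natReg 11 = s.natArr 7 x + 1 →
        s'.realArr 1 = s.realArr 1 → s'.natArr 2 = s.natArr 2 → s'.natArr 6 = s.natArr 6 →
        s'.natArr 7 = update (s.natArr 7) w (s.natArr 7 x + 1) →
        s'.natArr 8 = update (s.natArr 8) l (w + 1) →
        s'.natArr 9 = update (s.natArr 9) (s.natArr 2 (s.natArr 7 x) + w) l →
        s'.natArr 10 = update (s.natArr 10) (s.natArr 7 x + 1)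
          (s.natArr 10 (s.natArr 7 x + 1) + 1) →
        s'.natArr 11 = update (s.natArr 11)
          (s.natArr 2 (s.natArr 7 x + 1) + s.natArr 10 (s.natArr 7 x + 1)) w →
        s'.natArr 12 = s.natArr 12 →
        s'.natArr 13 = update (s.natArr 13) (s.natArr 7 x) 0 →
        s'.Consolidating n K lo (s'.natReg 9 + 1) ∧ s'.natReg 11 = s'.natArr 7 (s'.natReg 9) ∧
        0 < level n (s'.natArr 7) (s'.natReg 4) ∧
        kids n (s'.natArr 8) = kids n (s.natArr 8) + 1 ∧
        totalRank n (s'.natArr 7) = totalRank n (s.natArr 7) + 1 := by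
    intro w l hwl hk s' e1 e4 e5 e9 e11 er e2 e6 e7 e8 e9' e10 e11' e12 e13
    have hw : w < n ∧ s.natArr 6 w = 0 ∧ s.natArr 8 w = 0 ∧ s.natArr 7 w = s.natArr 7 x := by
      rcases hwl with ⟨rfl, -⟩ | ⟨rfl, -⟩ <;> simp [*]
    have hl : l < n ∧ s.natArr 6 l = 0 ∧ s.natArr 8 l = 0 ∧ s.natArr 7 l = s.natArr 7 x := by
      rcases hwl with ⟨-, rfl⟩ | ⟨-, rfl⟩ <;> simp [*]
    have hne : l ≠ w := by rcases hwl with ⟨rfl, rfl⟩ | ⟨rfl, rfl⟩ <;> omega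
    obtain ⟨w1, w2, w3, w4⟩ := hw
    obtain ⟨l1, l2, l3, l4⟩ := hl
    have hpl := h.pool.link (by omega) hb hwl
    rw [← w4] at e7 e9' e10 e11' hrow hrow' hpl
    rw [hrow] at e9'
    rw [hrow'] at e11'
    refine ⟨⟨?_, ?_, ?_, ?_, ?_, ?_⟩, ?_, ?_, ?_, ?_⟩
    · rw [e1, h.n_eq]
    · rw [State.Forest, er, e6, e7, e8, e9']
      exact h.forest.link w1 l1 w2 l2 w3 (l4.trans w4.symm) hk hne
    · rw [State.Levels, e4, e7, e2, e10, e11']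
      exact h.levels.link w1 (by omega)
    · rw [State.Pool, e4, e5, e6, e7, e8, e9, e12, e13, ← w4]
      exact hpl
    · intro i hi
      rw [e7, e8, level_set w1, kidsAt_link l1 hne l3 w3, h.full i hi, l4, w4]
      simp
    · rw [e2]; exact h.row_eq
    · rw [e11, e7, e9, update_self, w4]
    · rw [e7, e4]
      rcases ht with ht | ht
      · exact level_pos w1 (by simp; omega)
      · exact ht.trans_le (by rw [level_set w1]; omega)
    · rw [e8, kids_set l1 l3]
    · rw [e7, totalRank_set w1]
  simp only [linkStep, WP_ite, WP_block_cons, WP_block_nil, WP_storeNat, WP_setNat, WP_skip]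
  refine ⟨fun hc => ⟨by simp, ?_⟩, fun hc => ⟨by simp, ?_⟩⟩
  · simp [h9, h11, hb] at hc
    apply hpost y x (by simp) hc.le <;> simp [h9, h11, hb]
  · simp [h9, h11, hb] at hc
    apply hpost x y (by simp) hc <;> simp [h9, h11, hb]

end Heap

end Dilation

namespace Dilation

/-! ### Consolidation: linking roots until their ranks are distinct. -/

section Heap

open Finset Function

/-- Link the tree of register `9` until the bucket of its rank is empty. -/
def linkLoop : Prog :=
  .while (.not (.natEq (.arr 13 (.reg 11)) (.lit 0))) (.block [growStep, linkStep])

/-- Each iteration creates one child, which pays its 130 steps, and raises one rank, so the number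
of empty slots stays constant. Only queued vertices can be children, which bounds the number of
iterations. -/
theorem linkLoop_spec {s : State} {c n K lo : ℕ} (h : s.Consolidating n K lo (s.natReg 9 + 1))
    (h11 : s.natReg 11 = s.natArr 7 (s.natReg 9))
    (ht : 0 < level n (s.natArr 7) (s.natReg 4)) :
    WP linkLoop (fun s' c' => s'.Consolidating n K lo (s'.natReg 9 + 1) ∧
      s'.natReg 11 = s'.natArr 7 (s'.natReg 9) ∧ 0 < level n (s'.natArr 7) (s'.natReg 4) ∧
      totalRank n (s'.natArr 7) + kids n (s.natArr 8) =
        totalRank n (s.natArr 7) + kids n (s'.natArr 8) ∧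
      c' + 130 * kids n (s.natArr 8) ≤ c + 130 * kids n (s'.natArr 8) + 6 ∧
      s'.natArr 13 (s'.natReg 11) = 0) s c := by
  refine WP.while (fun s' c' => s'.Consolidating n K lo (s'.natReg 9 + 1) ∧
      s'.natReg 11 = s'.natArr 7 (s'.natReg 9) ∧ 0 < level n (s'.natArr 7) (s'.natReg 4) ∧
      totalRank n (s'.natArr 7) + kids n (s.natArr 8) =
        totalRank n (s.natArr 7) + kids n (s'.natArr 8) ∧
      c' + 130 * kids n (s.natArr 8) ≤ c + 130 * kids n (s'.natArr 8))
    (fun s' => undone n (s.natArr 6) - kids n (s'.natArr 8)) ⟨h, h11, ht, rfl, le_rfl⟩ ?_ ?_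
  · rintro s₁ c₁ fr ⟨h, h11, ht, hR, hc⟩ hb
    simp only [BExpr.Holds, NExpr.eval] at hb
    rw [WP_block_cons]
    refine (growStep_spec h h11 ht).conseq ?_
    rintro s₂ c₂ fr₂ ⟨hc₂, h₂, hlt, ht₂, hb₂⟩
    rw [WP_block_cons]
    have e9 := fr₂.natReg 9 rfl
    have e11 := fr₂.natReg 11 rfl
    have e7 := fr₂.natArr 7 rfl
    have e8 := fr₂.natArr 8 rfl
    obtain ⟨y, hy⟩ := Nat.exists_eq_succ_of_ne_zero hb
    rw [← e11, ← hb₂, e11, h11, ← e7] at hy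
    refine (linkStep_spec h₂ e9 (by rw [e11, h11, e7]) hy hlt ht₂).conseq ?_
    rintro s₃ c₃ fr₃ ⟨hc₃, h₃, h11₃, ht₃, hk₃, hR₃⟩
    rw [WP_block_nil]
    have e6 : s₃.natArr 6 = s.natArr 6 := by
      rw [fr₃.natArr 6 rfl, fr₂.natArr 6 rfl, fr.natArr 6 rfl]
    have hle := h₃.forest.kids_le_undone
    rw [e6] at hle
    rw [e8] at hk₃
    rw [e7] at hR₃
    simp only [BExpr.cost, NExpr.cost] at hc₂
    exact ⟨⟨h₃, h11₃, ht₃, by omega, by omega⟩, by omega⟩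
  · rintro s₁ c₁ - ⟨h, h11, ht, hR, hc⟩ hb
    simp only [BExpr.Holds, NExpr.eval, not_not] at hb
    exact ⟨h, h11, ht, hR, by simp; omega, hb⟩

/-- Link roots of equal rank, until there is at most one root of each rank, in the bucket of its
rank. -/
def consolidate : Prog := .block [
  .setNat 8 (.lit 0),
  .while (.natLT (.reg 8) (.reg 5)) (.block [
    .setNat 9 (.arr 12 (.reg 8)),
    .setNat 8 (.add (.reg 8) (.lit 1)),
    .setNat 11 (.arr 7 (.reg 9)),
    linkLoop,
    .storeNat 13 (.reg 11) (.add (.reg 9) (.lit 1))])]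

/-- In total 130 steps per link and 50 per old root; as a link removes a root, 180 per old root
suffice. This is the weight of roots in the potential. -/
theorem consolidate_spec {s : State} {c n K : ℕ} (h : s.Consolidating n K 0 0)
    (ht : 0 < level n (s.natArr 7) (s.natReg 4)) :
    WP consolidate (fun s' c' => s'.Consolidating n K (s'.natReg 5) 0 ∧
      0 < level n (s'.natArr 7) (s'.natReg 4) ∧
      totalRank n (s'.natArr 7) + kids n (s.natArr 8) =
        totalRank n (s.natArr 7) + kids n (s'.natArr 8) ∧
      c' + 130 * kids n (s.natArr 8) ≤
        c + 130 * kids n (s'.natArr 8) + 50 * s.natReg 5 + 20) s c := by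
  rw [consolidate, WP_block_cons, WP_setNat, WP_block_cons]
  refine WP.while (fun s' c' => s'.Consolidating n K (s'.natReg 8) 0 ∧
      s'.natReg 8 ≤ s.natReg 5 ∧ s'.natReg 5 = s.natReg 5 ∧
      0 < level n (s'.natArr 7) (s'.natReg 4) ∧
      totalRank n (s'.natArr 7) + kids n (s.natArr 8) =
        totalRank n (s.natArr 7) + kids n (s'.natArr 8) ∧
      c' + 130 * kids n (s.natArr 8) ≤
        c + 130 * kids n (s'.natArr 8) + 50 * s'.natReg 8 + 5)
    (fun s' => s.natReg 5 - s'.natReg 8) ?_ ?_ ?_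
  · refine ⟨⟨?_, ?_, ?_, ?_, ?_, ?_⟩, ?_⟩
    · simpa using h.n_eq
    · simpa using h.forest
    · simpa using h.levels
    · simpa using h.pool
    · simpa using h.full
    · simpa using h.row_eq
    · simp [ht]; omega
  · rintro s₁ c₁ fr ⟨h, h8, h5, ht, hR, hc⟩ hb
    simp only [BExpr.Holds, NExpr.eval] at hb
    simp only [WP_block_cons, WP_setNat]
    refine (linkLoop_spec (n := n) (K := K) (lo := s₁.natReg 8 + 1) ⟨?_, ?_, ?_, ?_, ?_, ?_⟩
      ?_ ?_).conseq ?_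
    · simpa using h.n_eq
    · simpa using h.forest
    · simpa using h.levels
    · simpa using h.pool.pop hb
    · simpa using h.full
    · simpa using h.row_eq
    · simp
    · simpa using ht
    rintro s₂ c₂ fr₂ ⟨h₂, h11₂, ht₂, hR₂, hc₂, hb₂⟩
    have e5 := fr₂.natReg 5 rfl
    have e8 := fr₂.natReg 8 rfl
    simp at e5 e8 hc₂ hR₂
    rw [WP_block_cons, WP_storeNat, WP_block_nil]
    have hx := (h₂.pool.cur_root _ rfl).1
    have hle := h₂.levels.le_top _ hx
    refine ⟨⟨⟨?_, ?_, ?_, ?_, ?_, ?_⟩, ?_, ?_, ?_, ?_, ?_⟩, ?_⟩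
    · simpa using h₂.n_eq
    · simpa using h₂.forest
    · simpa using h₂.levels
    · simpa [h11₂, e8] using h₂.pool.park hle (by rw [← h11₂, hb₂])
    · simpa using h₂.full
    · simpa using h₂.row_eq
    · simp [e8]; omega
    · simp [e5, h5]
    · simpa using ht₂
    · simp; omega
    · simp [e8]; omega
    · simp [e8]; omega
  · rintro s₁ c₁ fr ⟨h, h8, h5, ht, hR, hc⟩ hb
    simp only [BExpr.Holds, NExpr.eval] at hb
    rw [WP_block_nil]
    have : s₁.natReg 8 = s₁.natReg 5 := by omega
    rw [this] at h hc
    refine ⟨h, ht, hR, ?_⟩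
    simp; omega

end Heap

end Dilation

namespace Dilation

/-! ### Changes of the set of roots, and the search for the smallest root. -/

section Heap

open Finset Function

theorem Pool.unpark {n top : ℕ} {done rank par R bucket : ℕ → ℕ} {rl x r : ℕ}
    (h : Pool n top done rank par R rl rl bucket 0) (hr : r ≤ top) (hb : bucket r = x + 1) :
    Pool n top done rank par R 0 0 (update bucket r 0) (x + 1) := by
  obtain ⟨x1, x2, x3, x4, -⟩ := h.bkt r hr x hb
  constructor
  · intro j _ h2; omega
  · intro i j _ h2; omega
  · intro r' hr' z hz
    by_cases hrr : r' = r
    · subst hrr; rw [update_self] at hz; omega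
    · rw [update_of_ne hrr] at hz
      obtain ⟨a, b, c, d, e⟩ := h.bkt r' hr' z hz
      exact ⟨a, b, c, d, fun e => hrr (by rw [← d, ← x4]; congr 1; omega)⟩
  · intro z hz
    obtain rfl : x = z := by omega
    exact ⟨x1, x2, x3⟩
  · intro z hz hd hp
    rcases h.surj z hz hd hp with ⟨j, h1, h2, -⟩ | ⟨r', h1, h2⟩ | h1
    · omega
    · by_cases hrr : r' = r
      · subst hrr; exact Or.inr (Or.inr (by omega))
      · exact Or.inr (Or.inl ⟨r', h1, by rwa [update_of_ne hrr]⟩)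
    · omega

theorem Pool.push {n top : ℕ} {done rank par R bucket : ℕ → ℕ} {rl x r cur : ℕ}
    (h : Pool n top done rank par R 0 rl bucket cur) (hr : r ≤ top) (hb : bucket r = x + 1) :
    Pool n top done rank par (update R rl x) 0 (rl + 1) (update bucket r 0) cur := by
  obtain ⟨x1, x2, x3, x4, x5⟩ := h.bkt r hr x hb
  have hne : ∀ j < rl, R j ≠ x := by
    rintro j hj rfl
    exact (h.arr j (Nat.zero_le _) hj).2.2.2.1 (by rw [x4, hb])
  constructor
  · intro j _ h2
    by_cases hj : j = rl
    · subst hj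
      simp only [update_self]
      exact ⟨x1, x2, x3, by simp [x4], x5⟩
    · rw [update_of_ne hj]
      obtain ⟨a, b, c, d, e⟩ := h.arr j (Nat.zero_le _) (by omega)
      refine ⟨a, b, c, ?_, e⟩
      by_cases hrr : rank (R j) = r
      · rw [hrr]; simp
      · rwa [update_of_ne hrr]
  · intro i j _ h2 _ h4 hij
    by_cases hi : i = rl
    · by_cases hj : j = rl
      · omega
      · rw [hi, update_self, update_of_ne hj] at hij
        exact absurd hij.symm (hne j (by omega))
    · by_cases hj : j = rl
      · rw [hj, update_self, update_of_ne hi] at hij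
        exact absurd hij (hne i (by omega))
      · rw [update_of_ne hi, update_of_ne hj] at hij
        exact h.inj i j (Nat.zero_le _) (by omega) (Nat.zero_le _) (by omega) hij
  · intro r' hr' z hz
    by_cases hrr : r' = r
    · subst hrr; rw [update_self] at hz; omega
    · rw [update_of_ne hrr] at hz
      exact h.bkt r' hr' z hz
  · exact h.cur_root
  · intro z hz hd hp
    rcases h.surj z hz hd hp with ⟨j, h1, h2, h3⟩ | ⟨r', h1, h2⟩ | h1
    · exact Or.inl ⟨j, h1, by omega, by rwa [update_of_ne (by omega)]⟩
    · by_cases hrr : r' = r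
      · subst hrr; exact Or.inl ⟨rl, Nat.zero_le _, by omega, by rw [update_self]; omega⟩
      · exact Or.inr (Or.inl ⟨r', h1, by rwa [update_of_ne hrr]⟩)
    · exact Or.inr (Or.inr h1)

theorem Pool.cut {n top : ℕ} {done rank par R bucket : ℕ → ℕ} {rl y cur : ℕ}
    (h : Pool n top done rank par R 0 rl bucket cur) (hb : ∀ r ≤ top, bucket r = 0)
    (ht : rank y ≤ top) (hy : y < n) (hd : done y = 0) (hp : par y ≠ 0) :
    Pool n top done rank (update par y 0) (update R rl y) 0 (rl + 1) bucket cur := by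
  have hne : ∀ j < rl, R j ≠ y := by
    rintro j hj rfl
    exact hp (h.arr j (Nat.zero_le _) hj).2.2.1
  have hcur : ∀ z, cur = z + 1 → z ≠ y := by
    rintro z hz rfl
    exact hp (h.cur_root z hz).2.2
  constructor
  · intro j _ h2
    by_cases hj : j = rl
    · subst hj
      simp only [update_self]
      exact ⟨hy, hd, trivial, by rw [hb _ ht]; omega, fun e => hcur _ e rfl⟩
    · rw [update_of_ne hj]
      obtain ⟨a, b, c, d, e⟩ := h.arr j (Nat.zero_le _) (by omega)
      exact ⟨a, b, by rwa [update_of_ne (hne j (by omega))], d, e⟩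
  · intro i j _ h2 _ h4 hij
    by_cases hi : i = rl
    · by_cases hj : j = rl
      · omega
      · rw [hi, update_self, update_of_ne hj] at hij
        exact absurd hij.symm (hne j (by omega))
    · by_cases hj : j = rl
      · rw [hj, update_self, update_of_ne hi] at hij
        exact absurd hij (hne i (by omega))
      · rw [update_of_ne hi, update_of_ne hj] at hij
        exact h.inj i j (Nat.zero_le _) (by omega) (Nat.zero_le _) (by omega) hij
  · intro r hr z hz
    rw [hb r hr] at hz; omega
  · intro z hz
    obtain ⟨a, b, c⟩ := h.cur_root z hz
    exact ⟨a, b, by rwa [update_of_ne (hcur z hz)]⟩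
  · intro z hz hd' hp'
    by_cases hzy : z = y
    · exact Or.inl ⟨rl, Nat.zero_le _, by omega, by rw [update_self, hzy]⟩
    · rw [update_of_ne hzy] at hp'
      rcases h.surj z hz hd' hp' with ⟨j, h1, h2, h3⟩ | h1
      · exact Or.inl ⟨j, h1, by omega, by rwa [update_of_ne (by omega)]⟩
      · exact Or.inr h1

theorem Pool.finish {n top : ℕ} {done rank par R bucket : ℕ → ℕ} {rl x : ℕ}
    (h : Pool n top done rank par R 0 rl bucket (x + 1)) (hb : ∀ r ≤ top, bucket r = 0) :
    Pool n top (update done x 1) rank par R 0 rl bucket 0 where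
  arr j h1 h2 := by
    obtain ⟨a, b, c, d, e⟩ := h.arr j h1 h2
    exact ⟨a, by rwa [update_of_ne (by omega)], c, d, by omega⟩
  inj := h.inj
  bkt r hr z hz := by rw [hb r hr] at hz; omega
  cur_root z hz := by omega
  surj z hz hd hp := by
    have hzx : z ≠ x := by rintro rfl; simp at hd
    rw [update_of_ne hzx] at hd
    rcases h.surj z hz hd hp with h1 | h1 | h1
    · exact Or.inl h1
    · exact Or.inr (Or.inl h1)
    · omega

/-- The entry of `ch` that points to the cut vertex becomes stale. This is harmless, because the
forest condition speaks only of actual children, and the programs compare parent and rank before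
they trust an entry. -/
theorem Forest.cut {n : ℕ} {key : ℕ → ℝ} {done rank par ch : ℕ → ℕ} {v : ℕ}
    (h : Forest n key done rank par ch) : Forest n key done rank (update par v 0) ch := by
  intro y x hyx
  by_cases hy : y = v
  · subst hy; simp at hyx
  · rw [update_of_ne hy] at hyx
    exact h y x hyx

theorem Forest.finish {n : ℕ} {key : ℕ → ℝ} {done rank par ch : ℕ → ℕ} {v : ℕ}
    (h : Forest n key done rank par ch) (hv : par v = 0) (hc : ∀ y, par y ≠ v + 1) :
    Forest n key (update done v 1) rank par ch := by
  intro y x hyx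
  obtain ⟨h1, h2, h3, h4, h5⟩ := h y x hyx
  refine ⟨h1, h2, ?_, ?_, h5⟩
  · rwa [update_of_ne (by rintro rfl; omega)]
  · rwa [update_of_ne (by rintro rfl; exact hc y hyx)]

/-- Find a root of smallest key among those in the buckets; register `12` is set to its
successor. -/
def findBest : Prog := .block [
  .setNat 12 (.lit 0),
  .setNat 11 (.lit 0),
  .while (.natLT (.reg 11) (.add (.reg 4) (.lit 1))) (.block [
    .ite (.natEq (.arr 13 (.reg 11)) (.lit 0)) .skip
      (.ite (.or (.natEq (.reg 12) (.lit 0))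
          (.realLT (.arr 1 (.sub (.arr 13 (.reg 11)) (.lit 1))) (.arr 1 (.sub (.reg 12) (.lit 1)))))
        (.setNat 12 (.arr 13 (.reg 11))) .skip),
    .setNat 11 (.add (.reg 11) (.lit 1))])]

theorem findBest_spec {s : State} {c : ℕ} :
    WP findBest (fun s' c' => c' ≤ c + 50 * s.natReg 4 + 100 ∧
      (s'.natReg 12 = 0 → ∀ r ≤ s.natReg 4, s.natArr 13 r = 0) ∧
      ∀ x, s'.natReg 12 = x + 1 → (∃ r ≤ s.natReg 4, s.natArr 13 r = x + 1) ∧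
        ∀ r ≤ s.natReg 4, ∀ y, s.natArr 13 r = y + 1 → s.realArr 1 x ≤ s.realArr 1 y) s c := by
  rw [findBest, WP_block_cons, WP_setNat, WP_block_cons, WP_setNat, WP_block_cons]
  refine WP.while (fun s' c' => s'.natReg 11 ≤ s.natReg 4 + 1 ∧ c' ≤ c + 10 + 50 * s'.natReg 11 ∧
      (s'.natReg 12 = 0 → ∀ r < s'.natReg 11, s.natArr 13 r = 0) ∧
      ∀ x, s'.natReg 12 = x + 1 → (∃ r ≤ s.natReg 4, s.natArr 13 r = x + 1) ∧
        ∀ r < s'.natReg 11, ∀ y, s.natArr 13 r = y + 1 → s.realArr 1 x ≤ s.realArr 1 y)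
    (fun s' => s.natReg 4 + 1 - s'.natReg 11) (by simp) ?_ ?_
  · rintro s₁ c₁ fr ⟨h11, hc, h0, hx⟩ hb
    have e4 := fr.natReg 4 rfl
    have e13 := fr.natArr 13 rfl
    have ek := fr.realArr 1 rfl
    simp at e4 e13 ek hb
    have split : ∀ r, r ≤ s₁.natReg 11 → r < s₁.natReg 11 ∨ r = s₁.natReg 11 := by omega
    simp only [WP_block_cons, WP_block_nil, WP_ite, WP_skip, WP_setNat]
    refine ⟨fun hb1 => ?_, fun hb1 => ⟨fun hb2 => ?_, fun hb2 => ?_⟩⟩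
    · simp [e13] at hb1
      simp
      refine ⟨⟨by omega, by omega, fun h r hr => ?_, fun x h => ⟨(hx x h).1, fun r hr y hy => ?_⟩⟩, by omega⟩
      · rcases split r hr with hr | rfl
        · exact h0 h r hr
        · exact hb1
      · rcases split r hr with hr | rfl
        · exact (hx x h).2 r hr y hy
        · omega
    · simp [e13, ek] at hb1 hb2
      simp [e13]
      obtain ⟨z, hz⟩ := Nat.exists_eq_succ_of_ne_zero hb1
      refine ⟨⟨by omega, by omega, fun h => absurd h hb1,
        fun x h => ⟨⟨_, by omega, h⟩, fun r hr y hy => ?_⟩⟩, by omega⟩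
      rcases split r hr with hr | rfl
      · rcases hb2 with hb2 | hb2
        · have := h0 hb2 r hr; omega
        · obtain ⟨w, hw⟩ : ∃ w, s₁.natReg 12 = w + 1 := by
            refine Nat.exists_eq_succ_of_ne_zero fun h => ?_
            have := h0 h r hr; omega
          rw [h, hw] at hb2
          simp at hb2
          exact hb2.le.trans ((hx w hw).2 r hr y hy)
      · have : x = y := by omega
        rw [this]
    · simp [e13, ek] at hb1 hb2
      simp
      refine ⟨⟨by omega, by omega, fun h => absurd h hb2.1,
        fun x h => ⟨(hx x h).1, fun r hr y hy => ?_⟩⟩, by omega⟩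
      rcases split r hr with hr | rfl
      · exact (hx x h).2 r hr y hy
      · simpa [h, hy] using hb2.2
  · rintro s₁ c₁ fr ⟨h11, hc, h0, hx⟩ hb
    have e4 := fr.natReg 4 rfl
    simp at e4 hb
    have : s₁.natReg 11 = s.natReg 4 + 1 := by omega
    simp
    refine ⟨by omega, fun h r hr => h0 h r (by omega), fun x h =>
      ⟨(hx x h).1, fun r hr => (hx x h).2 r (by omega)⟩⟩

end Heap

end Dilation

namespace Dilation

/-! ### Removal of the smallest root. -/

section Heap

open Finset Function

/-- Move all roots from the buckets to the list of roots, except for the best one, which is kept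
in register `9`. -/
def rebuild : Prog := .block [
  .setNat 9 (.sub (.reg 12) (.lit 1)),
  .storeNat 13 (.arr 7 (.reg 9)) (.lit 0),
  .setNat 5 (.lit 0),
  .setNat 11 (.lit 0),
  .while (.natLT (.reg 11) (.add (.reg 4) (.lit 1))) (.block [
    .ite (.natEq (.arr 13 (.reg 11)) (.lit 0)) .skip (.block [
      .storeNat 12 (.reg 5) (.sub (.arr 13 (.reg 11)) (.lit 1)),
      .setNat 5 (.add (.reg 5) (.lit 1)),
      .storeNat 13 (.reg 11) (.lit 0)]),
    .setNat 11 (.add (.reg 11) (.lit 1))])]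

theorem rebuild_spec {s : State} {c n x r : ℕ} (h : s.Pool n (s.natReg 5) 0)
    (hx : s.natReg 12 = x + 1) (hr : r ≤ s.natReg 4) (hb : s.natArr 13 r = x + 1) :
    WP rebuild (fun s' c' => c' ≤ c + 40 * s.natReg 4 + 100 ∧ s'.natReg 9 = x ∧
      s'.Pool n 0 (x + 1) ∧ ∀ r ≤ s.natReg 4, s'.natArr 13 r = 0) s c := by
  have hrx := (h.bkt r hr x hb).2.2.2.1
  rw [rebuild, WP_block_cons, WP_setNat, WP_block_cons, WP_storeNat, WP_block_cons, WP_setNat,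
    WP_block_cons, WP_setNat, WP_block_cons]
  refine WP.while (fun s' c' => s'.natReg 11 ≤ s.natReg 4 + 1 ∧ c' ≤ c + 20 + 40 * s'.natReg 11 ∧
      s'.Pool n 0 (x + 1) ∧ ∀ r < s'.natReg 11, s'.natArr 13 r = 0)
    (fun s' => s.natReg 4 + 1 - s'.natReg 11) ?_ ?_ ?_
  · simp [hx, hrx]
    exact h.unpark hr hb
  · rintro s₁ c₁ fr ⟨h11, hc, hp, h0⟩ hb
    have e4 := fr.natReg 4 rfl
    simp at e4 hb
    have split : ∀ r, r ≤ s₁.natReg 11 → r < s₁.natReg 11 ∨ r = s₁.natReg 11 := by omega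
    simp only [WP_block_cons, WP_block_nil, WP_ite, WP_skip, WP_setNat, WP_storeNat]
    refine ⟨fun hb1 => ?_, fun hb1 => ?_⟩
    · simp at hb1
      refine ⟨⟨by simp; omega, by simp; omega, by simpa using hp, ?_⟩, by simp; omega⟩
      simp
      intro r hr
      rcases split r hr with hr | rfl
      · exact h0 r hr
      · exact hb1
    · simp at hb1
      obtain ⟨z, hz⟩ := Nat.exists_eq_succ_of_ne_zero hb1
      refine ⟨⟨by simp; omega, by simp; omega, ?_, ?_⟩, by simp; omega⟩
      · simpa [hz] using hp.push (by omega) hz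
      · simp
        intro r hr
        rcases split r hr with hr | rfl
        · rw [update_of_ne (by omega)]; exact h0 r hr
        · simp
  · rintro s₁ c₁ fr ⟨h11, hc, hp, h0⟩ hb
    have e4 := fr.natReg 4 rfl
    have e9 := fr.natReg 9 rfl
    simp [hx] at e4 e9 hb
    rw [WP_block_nil]
    exact ⟨by simp; omega, e9, hp, fun r hr => h0 r (by omega)⟩

/-- The state of the priority queue, without the bound on ranks; the root `cur` is being removed. -/
structure State.Trees (s : State) (n cur : ℕ) : Prop where
  n_eq : s.natReg 1 = n
  forest : s.Forest n
  levels : s.Levels n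
  pool : s.Pool n 0 cur
  empty : ∀ r ≤ s.natReg 4, s.natArr 13 r = 0
  row_eq : ∀ i ≤ n, s.natArr 2 i = i * n

/-- Make the vertex in register `10` a root. -/
def cutStep : Prog := .block [
  .storeNat 8 (.reg 10) (.lit 0),
  .storeNat 12 (.reg 5) (.reg 10),
  .setNat 5 (.add (.reg 5) (.lit 1))]

theorem cutStep_spec {s : State} {c n cur : ℕ} (h : s.Trees n cur)
    (hp : s.natArr 8 (s.natReg 10) ≠ 0) :
    WP cutStep (fun s' c' => c' ≤ c + 20 ∧ s'.Trees n cur ∧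
      s'.natArr 8 = update (s.natArr 8) (s.natReg 10) 0 ∧
      kids n (s'.natArr 8) + 1 = kids n (s.natArr 8)) s c := by
  obtain ⟨x, hx⟩ := Nat.exists_eq_succ_of_ne_zero hp
  obtain ⟨h1, -, h2, -⟩ := h.forest _ x hx
  simp only [cutStep, WP_block_cons, WP_block_nil, WP_setNat, WP_storeNat]
  refine ⟨by simp, ⟨?_, ?_, ?_, ?_, ?_, ?_⟩, by simp, ?_⟩
  · simpa using h.n_eq
  · simpa using h.forest.cut
  · simpa using h.levels
  · simpa using h.pool.cut h.empty (h.levels.le_top _ h1) h1 h2 hp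
  · simpa using h.empty
  · simpa using h.row_eq
  · simpa using kids_clear h1 hp

/-- Make the children of the vertex in register `9` roots, and remove that vertex. -/
def cutChildren : Prog := .block [
  .setNat 8 (.lit 0),
  .while (.natLT (.reg 8) (.arr 7 (.reg 9))) (.block [
    .setNat 10 (.arr 9 (.add (.arr 2 (.reg 8)) (.reg 9))),
    .ite (.and (.natEq (.arr 8 (.reg 10)) (.add (.reg 9) (.lit 1)))
        (.natEq (.arr 7 (.reg 10)) (.reg 8))) cutStep .skip,
    .setNat 8 (.add (.reg 8) (.lit 1))]),
  .storeNat 6 (.reg 9) (.lit 1)]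

theorem State.Trees.congr {s s' : State} {n cur : ℕ} (h : s.Trees n cur)
    (e1 : s'.natReg 1 = s.natReg 1) (e4 : s'.natReg 4 = s.natReg 4)
    (e5 : s'.natReg 5 = s.natReg 5) (ea : s'.natArr = s.natArr) (er : s'.realArr = s.realArr) :
    s'.Trees n cur := by
  refine ⟨?_, ?_, ?_, ?_, ?_, ?_⟩
  · rw [e1, h.n_eq]
  · rw [State.Forest, ea, er]; exact h.forest
  · rw [State.Levels, e4, ea]; exact h.levels
  · rw [State.Pool, e4, e5, ea]; exact h.pool
  · rw [e4, ea]; exact h.empty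
  · rw [ea]; exact h.row_eq

theorem cutChildren_spec {s : State} {c n x : ℕ} (h : s.Trees n (x + 1)) (hx : s.natReg 9 = x) :
    WP cutChildren (fun s' c' => c' ≤ c + 50 * s.natReg 4 + 20 ∧ s'.Trees n 0 ∧
      s'.natArr 6 = update (s.natArr 6) x 1 ∧
      kids n (s.natArr 8) ≤ kids n (s'.natArr 8) + s.natReg 4) s c := by
  have hxn := (h.pool.cur_root x rfl).1
  have hxt := h.levels.le_top x hxn
  rw [cutChildren, WP_block_cons, WP_setNat, WP_block_cons]
  -- The last clause says that all slots of `x` below the counter have been emptied: remaining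
  -- children have rank at least the counter. When it reaches the rank of `x`, no child is left.
  refine WP.while (fun s' c' => s'.natReg 8 ≤ s.natArr 7 x ∧ c' ≤ c + 2 + 50 * s'.natReg 8 ∧
      s'.Trees n (x + 1) ∧ kids n (s.natArr 8) ≤ kids n (s'.natArr 8) + s'.natReg 8 ∧
      ∀ y, s'.natArr 8 y = x + 1 → s'.natReg 8 ≤ s.natArr 7 y)
    (fun s' => s.natArr 7 x - s'.natReg 8) ?_ ?_ ?_
  · refine ⟨by simp, by simp, h.congr ?_ ?_ ?_ ?_ ?_, by simp, by simp⟩ <;> simp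
  · rintro s₁ c₁ fr ⟨h8, hc, hT, hk, hch⟩ hb
    have e9 := fr.natReg 9 rfl
    have e7 := fr.natArr 7 rfl
    simp [hx] at e9 e7
    simp [e9, e7] at hb
    have hrow : s₁.natArr 2 (s₁.natReg 8) = s₁.natReg 8 * n := by
      refine hT.levels.row_eq _ ?_
      have := hT.levels.le_top x hxn
      rw [e7] at this
      omega
    simp only [WP_block_cons, WP_block_nil, WP_ite, WP_skip, WP_setNat]
    refine ⟨fun hb1 => ?_, fun hb1 => ?_⟩
    · simp [e9, hrow, e7] at hb1
      refine (cutStep_spec (n := n) (cur := x + 1) (hT.congr ?_ ?_ ?_ ?_ ?_) ?_).conseq ?_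
      · simp
      · simp
      · simp
      · simp
      · simp
      · simp [e9, hrow, hb1]
      rintro s₂ c₂ fr₂ ⟨hc₂, hT₂, hp₂, hk₂⟩
      have e8 := fr₂.natReg 8 rfl
      simp [e9, hrow] at e8 hp₂ hk₂ hc₂
      rw [WP_block_cons, WP_setNat, WP_block_nil]
      refine ⟨⟨by simp; omega, by simp; omega, hT₂.congr ?_ ?_ ?_ ?_ ?_, by simp; omega, ?_⟩,
        by simp; omega⟩
      · simp
      · simp
      · simp
      · simp
      · simp
      · simp only [State.setNat_natArr, State.setNat_natReg, NExpr.eval, if_true]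
        intro y hy
        rw [hp₂] at hy
        have hne : y ≠ s₁.natArr 9 (s₁.natReg 8 * n + x) := by
          rintro rfl; simp at hy
        rw [update_of_ne hne] at hy
        have h1 := hch y hy
        have h2 := (hT.forest y x hy).2.2.2.2.2.2
        rw [e7] at h2
        rcases Nat.lt_or_eq_of_le h1 with h1 | h1
        · omega
        · rw [← h1] at h2; exact absurd h2.symm hne
    · simp [e9, hrow, e7] at hb1
      refine ⟨⟨by simp; omega, by simp; omega, hT.congr ?_ ?_ ?_ ?_ ?_, by simp; omega, ?_⟩,
        by simp; omega⟩
      · simp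
      · simp
      · simp
      · simp
      · simp
      · simp
        intro y hy
        have h1 := hch y hy
        have h2 := (hT.forest y x hy).2.2.2.2.2.2
        rw [e7] at h2
        rcases Nat.lt_or_eq_of_le h1 with h1 | h1
        · omega
        · rw [← h1] at h2
          rw [h2] at hb1
          exact absurd h1.symm (hb1 hy)
  · rintro s₁ c₁ fr ⟨h8, hc, hT, hk, hch⟩ hb
    have e9 := fr.natReg 9 rfl
    have e7 := fr.natArr 7 rfl
    have e6 := fr.natArr 6 rfl
    simp [hx] at e9 e7 e6
    simp [e9, e7] at hb
    simp only [WP_block_cons, WP_block_nil, WP_storeNat]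
    have hcur := hT.pool.cur_root x rfl
    refine ⟨by simp; omega, ⟨?_, ?_, ?_, ?_, ?_, ?_⟩, by simp [e6, e9], by simp; omega⟩
    · simpa using hT.n_eq
    · have : ∀ y, s₁.natArr 8 y ≠ x + 1 := fun y hy => by
        have h1 := hch y hy
        have h2 := (hT.forest y x hy).2.2.2.2.1
        rw [e7] at h2
        omega
      simpa [e9] using hT.forest.finish hcur.2.2 this
    · simpa using hT.levels
    · simpa [e9] using hT.pool.finish hT.empty
    · simpa using hT.empty
    · simpa using hT.row_eq

end Heap

end Dilation

namespace Dilation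

section Heap

open Finset Function

/-! ### Restoring the bound on ranks -/

/-- The vertices in `A` have been cut, together with their children of rank `i`, and their ranks
have been lowered to `i`. -/
structure Quaking (i : ℕ) (A : ℕ → Prop) (rank₀ par₀ rank par : ℕ → ℕ) : Prop where
  par_or : ∀ c, par c = 0 ∨ par c = par₀ c
  cut_of_mem : ∀ y, A y → par y = 0 ∧ rank y = i ∧ ∀ c, par₀ c = y + 1 → rank₀ c = i → par c = 0
  rank_eq : ∀ y, ¬ A y → rank y = rank₀ y
  le_rank : ∀ c, par₀ c ≠ 0 → par c = 0 → i ≤ rank₀ c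

/-- The only possible child of `y` of rank `i` is the entry `z` of its slot, so one test per vertex
suffices. Vertices lowered before also have rank `i`, but they have no parent and thus cannot be
mistaken for such a child. -/
theorem Quaking.step {n i y z : ℕ} {A : ℕ → Prop} {key : ℕ → ℝ}
    {done rank₀ par₀ ch rank par par' : ℕ → ℕ}
    (hF : Forest n key done rank₀ par₀ ch) (h : Quaking i A rank₀ par₀ rank par)
    (hy : i + 1 ≤ rank₀ y) (hz : z = ch (i * n + y))
    (hpar : (update par y 0 z = y + 1 ∧ rank z = i ∧ par' = update (update par y 0) z 0) ∨
      (¬ (update par y 0 z = y + 1 ∧ rank z = i) ∧ par' = update par y 0)) :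
    Quaking i (fun v => A v ∨ v = y) rank₀ par₀ (update rank y i) par' := by
  have hpar₁ : ∀ c, par' c = 0 ∨ par' c = par c := by
    intro c
    by_cases hcy : c = y
    · subst hcy
      rcases hpar with ⟨-, -, rfl⟩ | ⟨-, rfl⟩ <;> simp [update_apply]
    · by_cases hcz : c = z
      · subst hcz
        rcases hpar with ⟨-, -, rfl⟩ | ⟨-, rfl⟩ <;> simp [hcy]
      · rcases hpar with ⟨-, -, rfl⟩ | ⟨-, rfl⟩ <;> simp [hcy, hcz]
  have hzero : ∀ c, par c = 0 → par' c = 0 := fun c hc => by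
    rcases hpar₁ c with h1 | h1
    · exact h1
    · rw [h1, hc]
  have hy0 : par' y = 0 := by
    rcases hpar with ⟨-, -, rfl⟩ | ⟨-, rfl⟩ <;> simp [update_apply]
  constructor
  · intro c
    rcases hpar₁ c with h1 | h1
    · exact Or.inl h1
    · rw [h1]; exact h.par_or c
  · rintro v hv
    by_cases hvy : v = y
    · subst hvy
      refine ⟨hy0, by simp, fun c hc hr => ?_⟩
      have hcz : c = z := by rw [hz, ← hr]; exact (hF c v hc).2.2.2.2.2.2.symm
      rcases h.par_or c with h1 | h1
      · exact hzero c h1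
      · have hcA : ¬ A c := fun hA => by have := (h.cut_of_mem c hA).1; omega
        have hcr := h.rank_eq c hcA
        have hcv : c ≠ v := by rintro rfl; omega
        rcases hpar with ⟨-, -, rfl⟩ | ⟨hn, -⟩
        · simp [hcz]
        · refine absurd ⟨?_, ?_⟩ hn
          · rw [← hcz, update_of_ne hcv, h1, hc]
          · rw [← hcz, hcr, hr]
    · obtain ⟨h1, h2, h3⟩ := h.cut_of_mem v (hv.resolve_right hvy)
      exact ⟨hzero v h1, by rwa [update_of_ne hvy], fun c hc hr => hzero c (h3 c hc hr)⟩
  · intro v hv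
    rw [update_of_ne fun e => hv (Or.inr e)]
    exact h.rank_eq v fun e => hv (Or.inl e)
  · intro c hc hc'
    by_cases h0 : par c = 0
    · exact h.le_rank c hc h0
    by_cases hcy : c = y
    · subst hcy; omega
    rcases hpar with ⟨h1, h2, rfl⟩ | ⟨-, rfl⟩
    · by_cases hcz : c = z
      · rw [← hcz, update_of_ne hcy] at h1
        have hcA : ¬ A c := fun hA => by have := (h.cut_of_mem c hA).1; omega
        have hcr := h.rank_eq c hcA
        rw [← hcz] at h2
        omega
      · rw [update_of_ne hcz, update_of_ne hcy] at hc'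
        exact absurd hc' h0
    · rw [update_of_ne hcy] at hc'
      exact absurd hc' h0

section QuakeDone

variable {n i : ℕ} {A : ℕ → Prop} {key : ℕ → ℝ} {done rank₀ par₀ ch rank par : ℕ → ℕ}

theorem Quaking.rank_eq_min (h : Quaking i A rank₀ par₀ rank par)
    (hA : ∀ v < n, (A v ↔ i + 1 ≤ rank₀ v)) {v : ℕ} (hv : v < n) : rank v = min (rank₀ v) i := by
  by_cases hv' : A v
  · rw [(h.cut_of_mem v hv').2.1]
    have := (hA v hv).1 hv'
    omega
  · rw [h.rank_eq v hv']
    have := mt (hA v hv).2 hv'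
    omega

/-- A surviving child has rank at most `i`, since higher vertices were all cut. If its rank is `i`,
its parent had larger rank and it was cut as that parent's child of rank `i`. So its rank is below
`i`, hence still below the lowered rank of its parent. -/
theorem Quaking.forest (hF : Forest n key done rank₀ par₀ ch)
    (h : Quaking i A rank₀ par₀ rank par) (hA : ∀ v < n, (A v ↔ i + 1 ≤ rank₀ v)) :
    Forest n key done rank par ch := by
  intro y x hyx
  have hy0 : par₀ y = x + 1 := by rcases h.par_or y with h1 | h1 <;> omega
  obtain ⟨h1, h2, h3, h4, h5, h6, h7⟩ := hF y x hy0
  have hyA : ¬ A y := fun hy => by have := (h.cut_of_mem y hy).1; omega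
  have hyr := h.rank_eq y hyA
  have hyi := mt (hA y h1).2 hyA
  refine ⟨h1, h2, h3, h4, ?_, h6, by rwa [hyr]⟩
  rw [hyr, h.rank_eq_min hA h2]
  have : rank₀ x ≤ i ∨ rank₀ y ≠ i := by
    by_contra hcon
    push Not at hcon
    have := (h.cut_of_mem x ((hA x h2).2 hcon.1)).2.2 y hy0 hcon.2
    omega
  omega

theorem Quaking.level_eq (h : Quaking i A rank₀ par₀ rank par)
    (hA : ∀ v < n, (A v ↔ i + 1 ≤ rank₀ v)) {j : ℕ} (hj : j ≤ i) :
    level n rank j = level n rank₀ j := by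
  refine congrArg card (filter_congr fun x hx => ?_)
  rw [h.rank_eq_min hA (mem_range.1 hx)]
  omega

theorem Quaking.levels {top : ℕ} {row len lst : ℕ → ℕ} (h : Quaking i A rank₀ par₀ rank par)
    (hA : ∀ v < n, (A v ↔ i + 1 ≤ rank₀ v)) (hL : Levels n top rank₀ row len lst) (hi : i ≤ top) :
    Levels n i rank row len lst where
  le_top x hx := by rw [h.rank_eq_min hA hx]; omega
  row_eq j hj := hL.row_eq j (by omega)
  len_eq j hj := by rw [h.level_eq hA hj]; exact hL.len_eq j (by omega)
  mem j h1 hj l hl := by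
    obtain ⟨h2, h3⟩ := hL.mem j h1 (by omega) l hl
    refine ⟨h2, ?_⟩
    rw [h.rank_eq_min hA h2]
    omega
  surj j h1 hj x hx hr := by
    rw [h.rank_eq_min hA hx] at hr
    exact hL.surj j h1 (by omega) x hx (by omega)

/-- Let L be the size of level `i + 1`. The rank sum drops by L plus the number Σ of slots belonging
to ranks `i + 1` and more. Lost children of rank above `i` number at most Σ, and also at most L;
those of rank `i` number less than L/3, because with L they fit into level `i`, of size less than
4L/3. So at least 2L/3 empty slots disappear, and fewer than 2L children are lost. -/
theorem Quaking.kids_le (hF : Forest n key done rank₀ par₀ ch)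
    (h : Quaking i A rank₀ par₀ rank par) (hA : ∀ v < n, (A v ↔ i + 1 ≤ rank₀ v))
    (hlt : 3 * level n rank₀ i < 4 * level n rank₀ (i + 1)) :
    kids n par₀ ≤ kids n par + 2 * level n rank₀ (i + 1) ∧
      3 * (totalRank n rank + kids n par₀) + 2 * level n rank₀ (i + 1) ≤
        3 * (totalRank n rank₀ + kids n par) := by
  have h1 : kids n par₀ ≤ kids n par + #{y ∈ range n | par₀ y ≠ 0 ∧ i ≤ rank₀ y} := by
    refine (card_le_card fun y hy => ?_).trans (card_union_le _ _)
    simp only [mem_union, mem_filter, mem_range] at hy ⊢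
    by_cases h0 : par y = 0
    · exact Or.inr ⟨hy.1, hy.2, h.le_rank y hy.2 h0⟩
    · exact Or.inl ⟨hy.1, h0⟩
  have h2 : #{y ∈ range n | par₀ y ≠ 0 ∧ i ≤ rank₀ y} ≤
      kidsAt n rank₀ par₀ i + #{y ∈ range n | par₀ y ≠ 0 ∧ i + 1 ≤ rank₀ y} := by
    refine (card_le_card fun y hy => ?_).trans (card_union_le _ _)
    simp only [mem_union, mem_filter, mem_range] at hy ⊢
    by_cases h0 : rank₀ y = i
    · exact Or.inl ⟨hy.1, hy.2.1, h0⟩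
    · exact Or.inr ⟨hy.1, hy.2.1, by omega⟩
  have h3 := hF.card_kids_le (i + 1)
  have h4 : #{y ∈ range n | par₀ y ≠ 0 ∧ i + 1 ≤ rank₀ y} ≤ level n rank₀ (i + 1) := by
    refine card_le_card fun y hy => ?_
    simp only [mem_filter] at hy ⊢
    exact ⟨hy.1, hy.2.2⟩
  have h5 := level_succ_add_kidsAt n rank₀ par₀ i
  have h6 : totalRank n rank₀ = totalRank n rank +
      (level n rank₀ (i + 1) + ∑ x ∈ range n, (rank₀ x - (i + 1))) := by
    rw [totalRank, totalRank, level, card_filter, ← sum_add_distrib, ← sum_add_distrib]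
    refine sum_congr rfl fun x hx => ?_
    rw [h.rank_eq_min hA (mem_range.1 hx)]
    split_ifs <;> omega
  omega

end QuakeDone

/-- Find the smallest `i` for which there are too many vertices of rank above `i`. -/
def findLevel : Prog := .block [
  .setNat 8 (.lit 0),
  .while (.and (.natLT (.reg 8) (.reg 4))
      (.not (.natLT (.add (.add (.arr 10 (.reg 8)) (.arr 10 (.reg 8))) (.arr 10 (.reg 8)))
        (.add (.add (.arr 10 (.add (.reg 8) (.lit 1))) (.arr 10 (.add (.reg 8) (.lit 1))))
          (.add (.arr 10 (.add (.reg 8) (.lit 1))) (.arr 10 (.add (.reg 8) (.lit 1))))))))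
    (.setNat 8 (.add (.reg 8) (.lit 1)))]

theorem findLevel_spec {s : State} {c n : ℕ} (h : s.Levels n) :
    WP findLevel (fun s' c' => c' ≤ c + 50 * s.natReg 4 + 60 ∧ s'.natReg 8 ≤ s.natReg 4 ∧
      (∀ j < s'.natReg 8, 4 * level n (s.natArr 7) (j + 1) ≤ 3 * level n (s.natArr 7) j) ∧
      (s'.natReg 8 < s.natReg 4 → 3 * level n (s.natArr 7) (s'.natReg 8) <
        4 * level n (s.natArr 7) (s'.natReg 8 + 1))) s c := by
  rw [findLevel, WP_block_cons, WP_setNat, WP_block_cons]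
  refine WP.while (fun s' c' => c' ≤ c + 50 * s'.natReg 8 + 5 ∧ s'.natReg 8 ≤ s.natReg 4 ∧
      (∀ j < s'.natReg 8, 4 * level n (s.natArr 7) (j + 1) ≤ 3 * level n (s.natArr 7) j))
    (fun s' => s.natReg 4 - s'.natReg 8) (by simp) ?_ ?_
  · rintro s₁ c₁ fr ⟨hc, h8, hj⟩ hb
    have e4 := fr.natReg 4 rfl
    have e10 := fr.natArr 10 rfl
    simp at e4 e10
    simp [e4, e10] at hb
    rw [h.len_eq _ (by omega), h.len_eq _ (by omega)] at hb
    simp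
    refine ⟨⟨by omega, by omega, fun j hj' => ?_⟩, by omega⟩
    rcases Nat.lt_or_eq_of_le hj' with hj' | rfl
    · exact hj j (by omega)
    · omega
  · rintro s₁ c₁ fr ⟨hc, h8, hj⟩ hb
    have e4 := fr.natReg 4 rfl
    have e10 := fr.natArr 10 rfl
    simp at e4 e10
    simp [e4, e10] at hb
    rw [WP_block_nil]
    refine ⟨by simp; omega, h8, hj, fun hlt => ?_⟩
    have := hb hlt
    rw [h.len_eq _ (by omega), h.len_eq _ (by omega)] at this
    omega

end Heap

end Dilation

namespace Dilation

/-! ### The program that lowers the ranks. -/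

section Heap

open Finset Function

/-- Ranks enter the description of the roots only through the buckets, and these are empty. -/
theorem Pool.change_rank {n top top' : ℕ} {done rank rank' par R bucket : ℕ → ℕ} {rl : ℕ}
    (h : Pool n top done rank par R 0 rl bucket 0) (hb : ∀ r ≤ top, bucket r = 0)
    (ht : top' ≤ top) (hr : ∀ x < n, rank' x ≤ top) :
    Pool n top' done rank' par R 0 rl bucket 0 where
  arr j h1 h2 := by
    obtain ⟨a, b, c, -, e⟩ := h.arr j h1 h2
    exact ⟨a, b, c, by rw [hb _ (hr _ a)]; omega, e⟩
  inj := h.inj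
  bkt r hr' x hx := by rw [hb r (by omega)] at hx; omega
  cur_root := h.cur_root
  surj x hx hd hp := by
    rcases h.surj x hx hd hp with h1 | ⟨r, h1, h2⟩ | h1
    · exact Or.inl h1
    · rw [hb r h1] at h2; omega
    · omega

/-- Make the vertex in register `10` a root, if a test succeeds. -/
def cutIf (b : BExpr) : Prog := .ite b cutStep .skip

theorem cutIf_spec {s : State} {c n : ℕ} {b : BExpr} (h : s.Pool n 0 0)
    (he : ∀ r ≤ s.natReg 4, s.natArr 13 r = 0) (hr : ∀ x < n, s.natArr 7 x ≤ s.natReg 4)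
    (hb : b.Holds s → s.natReg 10 < n ∧ s.natArr 6 (s.natReg 10) = 0 ∧
      s.natArr 8 (s.natReg 10) ≠ 0) :
    WP (cutIf b) (fun s' c' => c' ≤ c + b.cost + 20 ∧ s'.Pool n 0 0 ∧
      ((b.Holds s ∧ s'.natArr 8 = update (s.natArr 8) (s.natReg 10) 0) ∨
        (¬ b.Holds s ∧ s'.natArr 8 = s.natArr 8))) s c := by
  rw [cutIf, WP_ite]
  refine ⟨fun hh => ?_, fun hh => ?_⟩
  · obtain ⟨h1, h2, h3⟩ := hb hh
    simp only [cutStep, WP_block_cons, WP_block_nil, WP_setNat, WP_storeNat]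
    refine ⟨by simp; omega, ?_, Or.inl ⟨hh, by simp⟩⟩
    simpa using h.cut he (hr _ h1) h1 h2 h3
  · rw [WP_skip]
    exact ⟨by omega, h, Or.inr ⟨hh, rfl⟩⟩

/-- Treat the vertex in position `13` of the list of the vertices of rank above `i`, where `i` is
in register `8`. -/
def quakeStep : Prog := .block [
  .setNat 10 (.arr 11 (.add (.arr 2 (.add (.reg 8) (.lit 1))) (.reg 13))),
  .setNat 14 (.reg 10),
  cutIf (.not (.natEq (.arr 8 (.reg 10)) (.lit 0))),
  .setNat 10 (.arr 9 (.add (.arr 2 (.reg 8)) (.reg 14))),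
  cutIf (.and (.natEq (.arr 8 (.reg 10)) (.add (.reg 14) (.lit 1)))
    (.natEq (.arr 7 (.reg 10)) (.reg 8))),
  .storeNat 7 (.reg 14) (.reg 8),
  .setNat 13 (.add (.reg 13) (.lit 1))]

/-- Lower all ranks to at most `i`, which is in register `8`. -/
def quake : Prog := .block [
  .setNat 13 (.lit 0),
  .while (.natLT (.reg 13) (.arr 10 (.add (.reg 8) (.lit 1)))) quakeStep,
  .setNat 4 (.reg 8)]

theorem quake_spec {s : State} {c n i : ℕ} (h : s.Trees n 0) (h8 : s.natReg 8 = i)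
    (hi : i < s.natReg 4)
    (hlt : 3 * level n (s.natArr 7) i < 4 * level n (s.natArr 7) (i + 1)) :
    WP quake (fun s' c' => c' ≤ c + 120 * level n (s.natArr 7) (i + 1) + 40 ∧ s'.Trees n 0 ∧
      s'.natReg 4 = i ∧ (∀ j ≤ i, level n (s'.natArr 7) j = level n (s.natArr 7) j) ∧
      kids n (s.natArr 8) ≤ kids n (s'.natArr 8) + 2 * level n (s.natArr 7) (i + 1) ∧
      3 * (totalRank n (s'.natArr 7) + kids n (s.natArr 8)) + 2 * level n (s.natArr 7) (i + 1) ≤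
        3 * (totalRank n (s.natArr 7) + kids n (s'.natArr 8))) s c := by
  have hlen := h.levels.len_eq (i + 1) hi
  have hrow := h.levels.row_eq i hi.le
  have hrow' := h.levels.row_eq (i + 1) hi
  rw [quake, WP_block_cons, WP_setNat, WP_block_cons]
  -- The set of treated vertices is the processed prefix of the stored list for level `i + 1`. This
  -- list is what makes the cost proportional to the size of the level rather than to `n`.
  refine WP.while (fun s' c' => c' ≤ c + 120 * s'.natReg 13 + 2 ∧
      s'.natReg 13 ≤ s.natArr 10 (i + 1) ∧ s'.Pool n 0 0 ∧
      (∀ x < n, s'.natArr 7 x ≤ s.natReg 4) ∧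
      Quaking i (fun v => ∃ j < s'.natReg 13, s.natArr 11 ((i + 1) * n + j) = v)
        (s.natArr 7) (s.natArr 8) (s'.natArr 7) (s'.natArr 8))
    (fun s' => s.natArr 10 (i + 1) - s'.natReg 13) ?_ ?_ ?_
  · refine ⟨by simp, by simp, by simpa using h.pool, by simpa using h.levels.le_top, ?_⟩
    constructor
    · intro c; simp
    · simp
    · simp
    · intro c hc hc'; simp at hc'; omega
  · rintro s₁ c₁ fr ⟨hc, h13, hP, hr, hQ⟩ hb
    have e4 := fr.natReg 4 rfl
    have e8 := fr.natReg 8 rfl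
    have a2 := fr.natArr 2 rfl
    have a6 := fr.natArr 6 rfl
    have a9 := fr.natArr 9 rfl
    have a10 := fr.natArr 10 rfl
    have a11 := fr.natArr 11 rfl
    have a13 := fr.natArr 13 rfl
    simp [h8] at e4 e8 a2 a6 a9 a10 a11 a13
    simp [e8, a10] at hb
    set y := s.natArr 11 ((i + 1) * n + s₁.natReg 13) with hy
    obtain ⟨hyn, hyr⟩ := h.levels.mem (i + 1) (by omega) hi _ hb
    rw [← hy] at hyn hyr
    have hparlt : ∀ v, s₁.natArr 8 v ≠ 0 → v < n ∧ s.natArr 6 v = 0 := by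
      intro v hv
      have hv0 : s₁.natArr 8 v = s.natArr 8 v := (hQ.par_or v).resolve_left hv
      obtain ⟨w, hw⟩ := Nat.exists_eq_succ_of_ne_zero (hv0 ▸ hv)
      obtain ⟨h1, -, h2, -⟩ := h.forest v w hw
      exact ⟨h1, h2⟩
    simp only [quakeStep, WP_block_cons, WP_setNat]
    refine (cutIf_spec (n := n) (by simpa using hP) (by simpa [e4, a13] using h.empty)
      (by simpa [e4] using hr) ?_).conseq ?_
    · simp [e8, a2, hrow', a11, a6, ← hy]
      exact fun h0 => ⟨hyn, (hparlt y h0).2, h0⟩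
    rintro s₂ c₂ fr₂ ⟨hc₂, hP₂, hpar₂⟩
    have e4₂ := fr₂.natReg 4 rfl
    have e8₂ := fr₂.natReg 8 rfl
    have e13₂ := fr₂.natReg 13 rfl
    have e14₂ := fr₂.natReg 14 rfl
    have a2₂ := fr₂.natArr 2 rfl
    have a6₂ := fr₂.natArr 6 rfl
    have a7₂ := fr₂.natArr 7 rfl
    have a9₂ := fr₂.natArr 9 rfl
    have a13₂ := fr₂.natArr 13 rfl
    simp [e4, e8, a2, a6, a9, a11, a13, hrow', ← hy] at e4₂ e8₂ e13₂ e14₂ a2₂ a6₂ a7₂ a9₂ a13₂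
    have hpar₂' : s₂.natArr 8 = update (s₁.natArr 8) y 0 := by
      simp [e8, a2, a11, hrow', ← hy] at hpar₂
      rcases hpar₂ with ⟨-, h1⟩ | ⟨h0, h1⟩
      · exact h1
      · rw [h1, ← h0, update_eq_self]
    clear hpar₂
    simp only [WP_block_cons, WP_setNat]
    set z := s.natArr 9 (i * n + y) with hz
    refine (cutIf_spec (n := n) (by simpa using hP₂) (by simpa [e4₂, a13₂] using h.empty)
      (by simpa [e4₂, a7₂] using hr) ?_).conseq ?_
    · simp [e8₂, a2₂, a9₂, hrow, a6₂, e14₂, hpar₂', ← hz]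
      intro h0 _
      have hzy : z ≠ y := by intro e; rw [e] at h0; simp at h0
      rw [update_of_ne hzy] at h0
      have := hparlt z (by omega)
      exact ⟨this.1, this.2, by rw [update_of_ne hzy]; omega⟩
    rintro s₃ c₃ fr₃ ⟨hc₃, hP₃, hpar₃⟩
    have e4₃ := fr₃.natReg 4 rfl
    have e8₃ := fr₃.natReg 8 rfl
    have e13₃ := fr₃.natReg 13 rfl
    have e14₃ := fr₃.natReg 14 rfl
    have a7₃ := fr₃.natArr 7 rfl
    have a13₃ := fr₃.natArr 13 rfl
    simp [e4₂, e8₂, e13₂, e14₂, a7₂, a13₂] at e4₃ e8₃ e13₃ e14₃ a7₃ a13₃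
    simp [e8₂, a2₂, a9₂, hrow, e14₂, hpar₂', a7₂, ← hz] at hpar₃
    simp only [WP_block_cons, WP_block_nil, WP_setNat, WP_storeNat]
    have hr' : ∀ x < n, update (s₁.natArr 7) y i x ≤ s.natReg 4 := fun x hx => by
      by_cases hxy : x = y
      · subst hxy; simp; omega
      · rw [update_of_ne hxy]; exact hr x hx
    refine ⟨⟨?_, ?_, ?_, ?_, ?_⟩, ?_⟩
    · simp at hc₂ hc₃; simp [e13₃]; omega
    · simp [e13₃]; omega
    · have := hP₃.change_rank (rank' := update (s₁.natArr 7) y i)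
        (by simpa [e4₃, a13₃] using h.empty) le_rfl (by simpa [e4₃] using hr')
      simpa [e14₃, e8₃, a7₃] using this
    · simpa [e14₃, e8₃, a7₃] using hr'
    · have := hQ.step (par' := s₃.natArr 8) h.forest hyr hz ?_
      · simp [e14₃, e8₃, a7₃, e13₃]
        convert this using 2 with v
        constructor
        · rintro ⟨j, hj, rfl⟩
          rcases Nat.lt_or_eq_of_le hj with hj | rfl
          · exact Or.inl ⟨j, by omega, rfl⟩
          · exact Or.inr hy.symm
        · rintro (⟨j, hj, rfl⟩ | rfl)
          · exact ⟨j, by omega, rfl⟩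
          · exact ⟨_, le_rfl, hy.symm⟩
      · rcases hpar₃ with h1 | h1
        · exact Or.inl ⟨h1.1.1, h1.1.2, h1.2⟩
        · exact Or.inr ⟨fun hh => h1.1 hh.1 hh.2, h1.2⟩
    · simp [e13₃]; omega
  · rintro s₁ c₁ fr ⟨hc, h13, hP, hr, hQ⟩ hb
    have e1 := fr.natReg 1 rfl
    have e4 := fr.natReg 4 rfl
    have e8 := fr.natReg 8 rfl
    have a2 := fr.natArr 2 rfl
    have a6 := fr.natArr 6 rfl
    have a9 := fr.natArr 9 rfl
    have a10 := fr.natArr 10 rfl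
    have a11 := fr.natArr 11 rfl
    have a13 := fr.natArr 13 rfl
    have k1 := fr.realArr 1 rfl
    simp [h8] at e1 e4 e8 a2 a6 a9 a10 a11 a13 k1
    simp [e8, a10] at hb
    have h13' : s₁.natReg 13 = s.natArr 10 (i + 1) := by omega
    have hA : ∀ v < n, ((∃ j < s₁.natReg 13, s.natArr 11 ((i + 1) * n + j) = v) ↔
        i + 1 ≤ s.natArr 7 v) := by
      intro v hv
      rw [h13']
      constructor
      · rintro ⟨j, hj, rfl⟩
        exact (h.levels.mem (i + 1) (by omega) hi j hj).2
      · intro hr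
        exact h.levels.surj (i + 1) (by omega) hi v hv hr
    have hk := hQ.kids_le h.forest hA hlt
    have hL := hQ.levels hA h.levels hi.le
    rw [WP_block_cons, WP_setNat, WP_block_nil]
    refine ⟨by simp; omega, ⟨?_, ?_, ?_, ?_, ?_, ?_⟩, by simp [e8], ?_, ?_, ?_⟩
    · simpa [e1] using h.n_eq
    · simpa [a6, a9, k1] using hQ.forest h.forest hA
    · simpa [e8, a2, a10, a11] using hL
    · simpa [e8] using hP.change_rank (by simpa [e4, a13] using h.empty) (by omega)
        (by simpa [e4] using hr)
    · simp [e8, a13]; exact fun r hr => h.empty r (by omega)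
    · simpa [a2] using h.row_eq
    · intro j hj; simpa using hQ.level_eq hA hj
    · simpa using hk.1
    · simpa using hk.2

end Heap

end Dilation

namespace Dilation

/-! ### The amortised cost of an extraction. -/

section Heap

open Finset Function

/-- The state of the priority queue between two operations. -/
structure State.Queue (s : State) (n : ℕ) : Prop where
  trees : s.Trees n 0
  top_pos : 0 < n → 0 < level n (s.natArr 7) (s.natReg 4)
  decay : ∀ i, 4 * level n (s.natArr 7) (i + 1) ≤ 3 * level n (s.natArr 7) i

/-- The potential of the priority queue. -/
def State.potential (s : State) (n : ℕ) : ℕ :=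
  180 * s.natReg 5 + 900 * (totalRank n (s.natArr 7) - kids n (s.natArr 8))

/-- Extract a vertex of smallest key; it is returned in register `9`. -/
def extract : Prog := .block [
  consolidate, findBest, rebuild, cutChildren, findLevel,
  .ite (.natLT (.reg 8) (.reg 4)) quake .skip]

/-- Consolidation is paid by the old roots. Afterwards there are at most as many roots as ranks, and
the removed vertex has at most `top` children, so all other costs and increases of the potential are
O(log n), apart from the lowering of ranks. -/
theorem extract_spec {s : State} {c n v : ℕ} (h : s.Queue n) (hv : v < n)
    (hvd : s.natArr 6 v = 0) :
    WP extract (fun s' c' => s'.Queue n ∧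
      c' + s'.potential n ≤ c + s.potential n + 10000 * (Nat.log 2 n + 1) ∧
      s'.natReg 9 < n ∧ s.natArr 6 (s'.natReg 9) = 0 ∧
      s'.natArr 6 = update (s.natArr 6) (s'.natReg 9) 1 ∧
      ∀ y < n, s.natArr 6 y = 0 → s.realArr 1 (s'.natReg 9) ≤ s.realArr 1 y) s c := by
  have hT := h.trees
  -- From `K` on the levels are empty before consolidation, so the balance required for
  -- `level_halving` holds trivially there.
  set K := 3 * (Nat.log 2 n + 1) with hK
  have hK0 : level n (s.natArr 7) K = 0 := level_geometric h.decay
  have hfull : ∀ i, K ≤ i →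
      level n (s.natArr 7) (i + 1) = kidsAt n (s.natArr 7) (s.natArr 8) i := by
    intro i hi
    have h1 := level_anti n (s.natArr 7) hi
    have h2 := level_succ_add_kidsAt n (s.natArr 7) (s.natArr 8) i
    omega
  have hrl := hT.pool.rl_add_kids hT.forest hT.empty
  have hkS := hT.forest.kids_le
  rw [extract, WP_block_cons]
  refine (consolidate_spec (K := K) ⟨hT.n_eq, hT.forest, hT.levels, hT.pool, hfull, hT.row_eq⟩
    (h.top_pos (by omega))).conseq ?_
  rintro s₁ c₁ fr₁ ⟨h₁, ht₁, hS₁, hc₁⟩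
  have d₁ := fr₁.natArr 6 rfl
  have k₁ := fr₁.realArr 1 rfl
  have htop : s₁.natReg 4 ≤ K + Nat.log 2 n := level_halving h₁.full ht₁
  have hU₁ := h₁.pool.undone_le
  rw [d₁] at hU₁
  have hroot : ∀ y < n, s.natArr 6 y = 0 → ∃ r ≤ s₁.natReg 4, ∃ x, s₁.natArr 13 r = x + 1 ∧
      s.realArr 1 x ≤ s.realArr 1 y := by
    intro y hy hd
    obtain ⟨x, hx, hxd, hxp, hxk⟩ := h₁.forest.exists_root h₁.levels.le_top hy (by rwa [d₁])
    rcases h₁.pool.surj x hx hxd hxp with ⟨j, h1, h2, -⟩ | ⟨r, hr, hb⟩ | h1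
    · omega
    · exact ⟨r, hr, x, hb, by rwa [k₁] at hxk⟩
    · omega
  rw [WP_block_cons]
  refine findBest_spec.conseq ?_
  rintro s₂ c₂ fr₂ ⟨hc₂, hzero, hbest⟩
  have hne : s₂.natReg 12 ≠ 0 := by
    intro h0
    obtain ⟨r, hr, x, hx, -⟩ := hroot v hv hvd
    have := hzero h0 r hr
    omega
  obtain ⟨x, hx⟩ := Nat.exists_eq_succ_of_ne_zero hne
  obtain ⟨⟨r, hr, hbr⟩, hmin⟩ := hbest x hx
  have r1₂ := fr₂.natReg 1 rfl
  have r4₂ := fr₂.natReg 4 rfl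
  have r5₂ := fr₂.natReg 5 rfl
  have a2₂ := fr₂.natArr 2 rfl
  have a6₂ := fr₂.natArr 6 rfl
  have a7₂ := fr₂.natArr 7 rfl
  have a8₂ := fr₂.natArr 8 rfl
  have a9₂ := fr₂.natArr 9 rfl
  have a10₂ := fr₂.natArr 10 rfl
  have a11₂ := fr₂.natArr 11 rfl
  have a12₂ := fr₂.natArr 12 rfl
  have a13₂ := fr₂.natArr 13 rfl
  have k₂ := fr₂.realArr 1 rfl
  rw [WP_block_cons]
  refine (rebuild_spec (n := n) (x := x) (r := r) ?_ hx (by rwa [r4₂]) (by rwa [a13₂])).conseq ?_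
  · simpa [r4₂, r5₂, a6₂, a7₂, a8₂, a12₂, a13₂] using h₁.pool
  rintro s₃ c₃ fr₃ ⟨hc₃, h9₃, hP₃, hE₃⟩
  have r1₃ := fr₃.natReg 1 rfl
  have r4₃ := fr₃.natReg 4 rfl
  have a2₃ := fr₃.natArr 2 rfl
  have a6₃ := fr₃.natArr 6 rfl
  have a7₃ := fr₃.natArr 7 rfl
  have a8₃ := fr₃.natArr 8 rfl
  have a9₃ := fr₃.natArr 9 rfl
  have a10₃ := fr₃.natArr 10 rfl
  have a11₃ := fr₃.natArr 11 rfl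
  have k₃ := fr₃.realArr 1 rfl
  rw [r1₂] at r1₃
  rw [r4₂] at r4₃ hE₃ hc₃
  rw [a2₂] at a2₃
  rw [a6₂] at a6₃
  rw [a7₂] at a7₃
  rw [a8₂] at a8₃
  rw [a9₂] at a9₃
  rw [a10₂] at a10₃
  rw [a11₂] at a11₃
  rw [k₂] at k₃
  have hT₃ : s₃.Trees n (x + 1) := by
    refine ⟨by rw [r1₃, h₁.n_eq], ?_, ?_, hP₃, by rwa [r4₃], by rw [a2₃]; exact h₁.row_eq⟩
    · simpa [k₃, a6₃, a7₃, a8₃, a9₃] using h₁.forest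
    · simpa [r4₃, a7₃, a2₃, a10₃, a11₃] using h₁.levels
  have hxn := hT₃.pool.cur_root x rfl
  rw [WP_block_cons]
  refine (cutChildren_spec hT₃ h9₃).conseq ?_
  rintro s₄ c₄ fr₄ ⟨hc₄, hT₄, hd₄, hk₄⟩
  have r4₄ := fr₄.natReg 4 rfl
  have r9₄ := fr₄.natReg 9 rfl
  have a7₄ := fr₄.natArr 7 rfl
  rw [r4₃] at r4₄ hk₄ hc₄
  rw [h9₃] at r9₄
  rw [a7₃] at a7₄
  rw [a8₃] at hk₄
  rw [a6₃, d₁] at hd₄ hxn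
  have hUd := undone_set hxn.1 hxn.2.1
  rw [← hd₄] at hUd
  rw [WP_block_cons]
  refine (findLevel_spec hT₄.levels).conseq ?_
  rintro s₅ c₅ fr₅ ⟨hc₅, h8₅, hdec, hviol⟩
  have r4₅ := fr₅.natReg 4 rfl
  have r9₅ := fr₅.natReg 9 rfl
  have na₅ : s₅.natArr = s₄.natArr := funext fun a => fr₅.natArr a rfl
  have ra₅ : s₅.realArr = s₄.realArr := funext fun a => fr₅.realArr a rfl
  have hT₅ : s₅.Trees n 0 :=
    hT₄.congr (fr₅.natReg 1 rfl) r4₅ (fr₅.natReg 5 rfl) na₅ ra₅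
  rw [r4₄] at r4₅ h8₅ hviol hc₅
  rw [r9₄] at r9₅
  rw [a7₄] at hdec hviol
  have a7₅ : s₅.natArr 7 = s₁.natArr 7 := by rw [na₅, a7₄]
  have hkey : ∀ y < n, s.natArr 6 y = 0 → s.realArr 1 x ≤ s.realArr 1 y := by
    intro y hy hd
    obtain ⟨r', hr', z, hz, hzk⟩ := hroot y hy hd
    have := hmin r' hr' z hz
    rw [k₁] at this
    exact this.trans hzk
  rw [WP_block_cons, WP_ite]
  refine ⟨fun hb => ?_, fun hb => ?_⟩
  · simp only [BExpr.Holds, NExpr.eval, r4₅] at hb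
    refine (quake_spec hT₅ rfl (by rwa [r4₅]) (by rw [a7₅]; exact hviol hb)).conseq ?_
    rintro s₆ c₆ fr₆ ⟨hc₆, hT₆, h4₆, hlev₆, hk₆, hS₆⟩
    rw [WP_block_nil]
    have r9₆ := fr₆.natReg 9 rfl
    have a6₆ := fr₆.natArr 6 rfl
    rw [r9₅] at r9₆
    rw [na₅, hd₄] at a6₆
    rw [a7₅] at hlev₆ hS₆ hk₆ hc₆
    rw [na₅] at hk₆ hS₆
    have hrl₆ := hT₆.pool.rl_add_kids hT₆.forest hT₆.empty
    have hkS₆ := hT₆.forest.kids_le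
    rw [a6₆, ← hd₄] at hrl₆
    have hv' := hviol hb
    refine ⟨⟨hT₆, fun _ => ?_, fun j => ?_⟩, ?_, ?_, ?_, ?_, ?_⟩
    · rw [h4₆, hlev₆ _ le_rfl]
      have := level_anti n (s₁.natArr 7) (Nat.le_succ (s₅.natReg 8))
      simp only [Nat.succ_eq_add_one] at this
      omega
    -- Below the chosen level the 3/4 rule holds by minimality, and these levels are unchanged;
    -- above it the levels are now empty.
    · rcases Nat.lt_or_ge j (s₅.natReg 8) with hj | hj
      · rw [hlev₆ _ hj.le, hlev₆ _ hj]
        exact hdec j hj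
      · rw [level_eq_zero]
        · omega
        · intro y hy
          have := hT₆.levels.le_top y hy
          omega
    -- For a level of size L, the lost empty slots release 900 · 2L/3 = 600L, while the new roots
    -- require at most 180 · 2L and the time is 120L plus a constant.
    · simp only [State.potential]
      simp at hc₆
      omega
    · rw [r9₆]; exact hxn.1
    · rw [r9₆]; exact hxn.2.1
    · rw [r9₆, a6₆]
    · rw [r9₆]; exact hkey
  · simp only [BExpr.Holds, NExpr.eval, r4₅] at hb
    rw [WP_skip, WP_block_nil]
    have hrl₅ := hT₅.pool.rl_add_kids hT₅.forest hT₅.empty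
    have hkS₅ := hT₅.forest.kids_le
    rw [na₅] at hrl₅ hkS₅
    rw [a7₄] at hkS₅
    refine ⟨⟨hT₅, fun _ => ?_, fun j => ?_⟩, ?_, ?_, ?_, ?_, ?_⟩
    · rwa [r4₅, a7₅]
    · rw [a7₅]
      rcases Nat.lt_or_ge j (s₅.natReg 8) with hj | hj
      · exact hdec j hj
      · rw [level_eq_zero]
        · omega
        · intro y hy
          have := h₁.levels.le_top y hy
          omega
    · simp only [State.potential, na₅, a7₄]
      simp
      omega
    · rw [r9₅]; exact hxn.1
    · rw [r9₅]; exact hxn.2.1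
    · rw [r9₅, na₅, hd₄]
    · rw [r9₅]; exact hkey

end Heap

end Dilation

namespace Dilation

section Dijkstra

open Finset Function

/-! ### Shortest paths from one source: invariants -/

/-- A lower bound for the truncated distances from the source. -/
structure SubDist (n : ℕ) (adj : ℕ → List ℕ) (W : ℕ → ℕ → ℝ) (src : ℕ) (B : ℝ) (δ : ℕ → ℝ) :
    Prop where
  src_le : δ src ≤ 0
  le_B : ∀ v < n, δ v ≤ B
  step : ∀ u < n, ∀ v ∈ adj u, δ v ≤ δ u + W u v

/-- The invariant between two extractions. -/
structure Settled (n : ℕ) (adj : ℕ → List ℕ) (W : ℕ → ℕ → ℝ) (src : ℕ) (B : ℝ)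
    (done : ℕ → ℕ) (key : ℕ → ℝ) : Prop where
  le_B : ∀ v < n, key v ≤ B
  src_le : key src ≤ 0
  lower : ∀ δ, SubDist n adj W src B δ → ∀ v < n, δ v ≤ key v
  relaxed : ∀ u < n, done u ≠ 0 → ∀ v ∈ adj u, key v ≤ key u + W u v
  done_le : ∀ u < n, ∀ v < n, done u ≠ 0 → done v = 0 → key u ≤ key v

/-- The invariant while the arcs from `x` to the vertices in `l` have yet to be relaxed. -/
structure Settling (n : ℕ) (adj : ℕ → List ℕ) (W : ℕ → ℕ → ℝ) (src : ℕ) (B : ℝ) (x : ℕ)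
    (l : List ℕ) (done : ℕ → ℕ) (key : ℕ → ℝ) : Prop where
  le_B : ∀ v < n, key v ≤ B
  src_le : key src ≤ 0
  lower : ∀ δ, SubDist n adj W src B δ → ∀ v < n, δ v ≤ key v
  relaxed : ∀ u < n, done u ≠ 0 → ∀ v ∈ adj u, (u = x ∧ v ∈ l) ∨ key v ≤ key u + W u v
  done_le : ∀ u < n, done u ≠ 0 → key u ≤ key x
  le_undone : ∀ v < n, done v = 0 → key x ≤ key v

variable {n : ℕ} {adj : ℕ → List ℕ} {W : ℕ → ℕ → ℝ} {src : ℕ} {B : ℝ} {x v : ℕ}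
  {l : List ℕ} {done : ℕ → ℕ} {key : ℕ → ℝ}

theorem Settled.extract (h : Settled n adj W src B done key) (hx : x < n)
    (hxd : done x = 0) (hmin : ∀ y < n, done y = 0 → key x ≤ key y) :
    Settling n adj W src B x (adj x) (update done x 1) key where
  le_B := h.le_B
  src_le := h.src_le
  lower := h.lower
  relaxed u hu hd v hv := by
    by_cases hux : u = x
    · subst hux; exact Or.inl ⟨rfl, hv⟩
    · rw [update_of_ne hux] at hd
      exact Or.inr (h.relaxed u hu hd v hv)
  done_le u hu hd := by
    by_cases hux : u = x
    · rw [hux]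
    · rw [update_of_ne hux] at hd
      exact h.done_le u hu x hx hd hxd
  le_undone v hv hd := by
    by_cases hvx : v = x
    · rw [hvx]
    · rw [update_of_ne hvx] at hd
      exact hmin v hv hd

theorem Settling.settled (h : Settling n adj W src B x [] done key) :
    Settled n adj W src B done key where
  le_B := h.le_B
  src_le := h.src_le
  lower := h.lower
  relaxed u hu hd v hv := (h.relaxed u hu hd v hv).resolve_left (by simp)
  done_le u hu v hv hd hd' := (h.done_le u hu hd).trans (h.le_undone v hv hd')

theorem Settling.skip (h : Settling n adj W src B x (v :: l) done key)
    (hk : key v ≤ key x + W x v) : Settling n adj W src B x l done key where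
  le_B := h.le_B
  src_le := h.src_le
  lower := h.lower
  relaxed u hu hd w hw := by
    rcases h.relaxed u hu hd w hw with ⟨rfl, hw'⟩ | h1
    · rcases List.mem_cons.1 hw' with rfl | hw'
      · exact Or.inr hk
      · exact Or.inl ⟨rfl, hw'⟩
    · exact Or.inr h1
  done_le := h.done_le
  le_undone := h.le_undone

/-- Extracted vertices have keys at most that of `x`, so with nonnegative weights an arc from `x`
can improve only a vertex that is still in the queue. -/
theorem Settling.undone (h : Settling n adj W src B x (v :: l) done key) (hv : v < n)
    (hW : 0 ≤ W x v) (hk : key x + W x v < key v) : done v = 0 := by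
  by_contra hd
  have := h.done_le v hv hd
  linarith

/-- Relaxation preserves every lower bound, since a `SubDist` satisfies the same inequality along
the arc. The keys of extracted vertices do not change, so neither do their relaxed arcs. -/
theorem Settling.improve (h : Settling n adj W src B x (v :: l) done key) (hx : x < n)
    (hxd : done x ≠ 0) (hv : v < n) (hva : v ∈ adj x) (hW : 0 ≤ W x v)
    (hk : key x + W x v < key v) :
    Settling n adj W src B x l done (update key v (key x + W x v)) := by
  have hvd : done v = 0 := h.undone hv hW hk
  have hxv : x ≠ v := by rintro rfl; exact hxd hvd
  have hle : ∀ w, update key v (key x + W x v) w ≤ key w := by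
    intro w
    by_cases hw : w = v
    · subst hw; simpa using hk.le
    · rw [update_of_ne hw]
  have hne : ∀ u, done u ≠ 0 → update key v (key x + W x v) u = key u := by
    intro u hu
    rw [update_of_ne]
    rintro rfl
    exact hu hvd
  constructor
  · exact fun w hw => (hle w).trans (h.le_B w hw)
  · exact (hle src).trans h.src_le
  · intro δ hδ w hw
    by_cases hwv : w = v
    · subst hwv
      rw [update_self]
      exact (hδ.step x hx w hva).trans (by have := h.lower δ hδ x hx; linarith)
    · rw [update_of_ne hwv]
      exact h.lower δ hδ w hw
  · intro u hu hd w hw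
    rw [hne u hd]
    rcases h.relaxed u hu hd w hw with ⟨rfl, hw'⟩ | h1
    · rcases List.mem_cons.1 hw' with rfl | hw'
      · exact Or.inr (by simp)
      · exact Or.inl ⟨rfl, hw'⟩
    · exact Or.inr ((hle w).trans h1)
  · intro u hu hd
    rw [hne u hd, hne x hxd]
    exact h.done_le u hu hd
  · intro w hw hd
    rw [hne x hxd]
    by_cases hwv : w = v
    · subst hwv; rw [update_self]; linarith
    · rw [update_of_ne hwv]
      exact h.le_undone w hw hd

/-! ### Shortest paths from one source: the program -/

theorem WP.while_true {b : BExpr} {P : Prog} {Q : State → ℕ → Prop} {s : State} {c : ℕ}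
    (hb : b.Holds s) (h : WP P (WP (.while b P) Q) s (c + (b.cost + 1))) :
    WP (.while b P) Q s c := by
  obtain ⟨s', d, hE, s'', d', hE', h⟩ := h
  refine ⟨_, _, .while_true hb hE hE', ?_⟩
  convert h using 1; ring

theorem WP.while_false {b : BExpr} {P : Prog} {Q : State → ℕ → Prop} {s : State} {c : ℕ}
    (hb : ¬ b.Holds s) (h : Q s (c + (b.cost + 1))) : WP (.while b P) Q s c :=
  ⟨_, _, .while_false hb, h⟩

/-- The linked list that starts with the arc `h` contains arcs to the vertices of the list; the
arc `0` is no arc. -/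
def ArcList (nxt tgt : ℕ → ℕ) : ℕ → List ℕ → Prop
  | h, [] => h = 0
  | h, v :: l => h ≠ 0 ∧ tgt h = v ∧ ArcList nxt tgt (nxt h) l

/-- Heap order restricts the key of a root only from above. -/
theorem Forest.decrease {ch rank par : ℕ → ℕ} {a : ℝ} (h : Forest n key done rank par ch)
    (hp : par v = 0) (ha : a ≤ key v) : Forest n (update key v a) done rank par ch := by
  intro y x hyx
  obtain ⟨h1, h2, h3, h4, h5, h6, h7⟩ := h y x hyx
  have hy : y ≠ v := by rintro rfl; omega
  refine ⟨h1, h2, h3, h4, h5, ?_, h7⟩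
  rw [update_of_ne hy]
  by_cases hx : x = v
  · subst hx; rw [update_self]; exact ha.trans h6
  · rwa [update_of_ne hx]

/-- Decrease the key of the vertex in register `10`, which is the head of an arc from the vertex
in register `9`. -/
def decrease : Prog := .block [
  .ite (.natEq (.arr 8 (.reg 10)) (.lit 0)) .skip cutStep,
  .storeReal 1 (.reg 10) (.add (.arr 1 (.reg 9)) (.arr 0 (.add (.arr 2 (.reg 9)) (.reg 10))))]

/-- A cut adds one root and one empty slot, 180 + 900 to the potential; the rest of 1200 covers the
steps. Ranks stay as they are, so the rule on levels needs no repair. -/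
theorem decrease_spec {s : State} {c : ℕ} (h : s.Queue n) (h9 : s.natReg 9 = x)
    (h10 : s.natReg 10 = v) (hx : x < n)
    (hk : s.realArr 1 x + s.realArr 0 (x * n + v) ≤ s.realArr 1 v) :
    WP decrease (fun s' c' => s'.Queue n ∧ c' + s'.potential n ≤ c + s.potential n + 1200 ∧
      s'.realArr 1 = update (s.realArr 1) v (s.realArr 1 x + s.realArr 0 (x * n + v))) s c := by
  have hrow := h.trees.row_eq x hx.le
  have hpost : ∀ (s' : State) (d : ℕ), s'.Trees n 0 → s'.natArr 8 v = 0 →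
      s'.natReg 4 = s.natReg 4 → s'.natReg 9 = x → s'.natReg 10 = v →
      s'.natArr 7 = s.natArr 7 → s'.natArr 2 = s.natArr 2 → s'.realArr = s.realArr →
      d + 180 * s'.natReg 5 + 900 * (totalRank n (s'.natArr 7) - kids n (s'.natArr 8)) ≤
        c + s.potential n + 1150 →
      WP (.block [.storeReal 1 (.reg 10)
          (.add (.arr 1 (.reg 9)) (.arr 0 (.add (.arr 2 (.reg 9)) (.reg 10))))])
        (fun s' c' => s'.Queue n ∧ c' + s'.potential n ≤ c + s.potential n + 1200 ∧
          s'.realArr 1 = update (s.realArr 1) v (s.realArr 1 x + s.realArr 0 (x * n + v)))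
        s' d := by
    intro s' d hT hp e4 e9 e10 e7 e2 er hc
    rw [WP_block_cons, WP_storeReal, WP_block_nil]
    refine ⟨⟨⟨?_, ?_, ?_, ?_, ?_, ?_⟩, ?_, ?_⟩, ?_, ?_⟩
    · simpa using hT.n_eq
    · have := hT.forest.decrease (v := v) hp (a := s.realArr 1 x + s.realArr 0 (x * n + v))
        (by rw [er]; exact hk)
      simpa [er, e9, e10, e2, hrow] using this
    · simpa using hT.levels
    · simpa using hT.pool
    · simpa using hT.empty
    · simpa using hT.row_eq
    · simpa [e7, e4] using h.top_pos
    · simpa [e7] using h.decay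
    · simp only [State.potential] at hc ⊢
      simp
      omega
    · simp [er, e9, e10, e2, hrow]
  rw [decrease, WP_block_cons, WP_ite]
  refine ⟨fun hb => ?_, fun hb => ?_⟩
  · simp [h10] at hb
    rw [WP_skip]
    refine hpost _ _ h.trees hb rfl h9 h10 rfl rfl rfl ?_
    simp only [State.potential]
    simp
    omega
  · simp only [BExpr.Holds, NExpr.eval] at hb
    refine (cutStep_spec h.trees hb).conseq ?_
    rintro s' c' fr ⟨hc, hT, hp, hk'⟩
    have e5 := hT.pool.rl_add_kids hT.forest hT.empty
    have e5' := h.trees.pool.rl_add_kids h.trees.forest h.trees.empty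
    have e6 := fr.natArr 6 rfl
    have e7 := fr.natArr 7 rfl
    rw [e6] at e5
    have l1 := h.trees.forest.kids_le
    refine hpost _ _ hT (by rw [hp, h10, update_self]) (fr.natReg 4 rfl)
      ((fr.natReg 9 rfl).trans h9) ((fr.natReg 10 rfl).trans h10) e7 (fr.natArr 2 rfl)
      (funext fun a => fr.realArr a rfl) ?_
    rw [e7]
    simp only [State.potential]
    simp at hc
    omega

/-- Relax the arcs of the list that starts in register `15`; they go out from the vertex in
register `9`. -/
def relaxLoop : Prog :=
  .while (.not (.natEq (.reg 15) (.lit 0))) (.block [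
    .setNat 10 (.arr 5 (.reg 15)),
    .ite (.realLT (.add (.arr 1 (.reg 9)) (.arr 0 (.add (.arr 2 (.reg 9)) (.reg 10))))
      (.arr 1 (.reg 10))) decrease .skip,
    .setNat 15 (.arr 4 (.reg 15))])

theorem State.Queue.congr {s s' : State} (h : s.Queue n)
    (e1 : s'.natReg 1 = s.natReg 1) (e4 : s'.natReg 4 = s.natReg 4)
    (e5 : s'.natReg 5 = s.natReg 5) (ea : s'.natArr = s.natArr) (er : s'.realArr = s.realArr) :
    s'.Queue n :=
  ⟨h.trees.congr e1 e4 e5 ea er, by rw [ea, e4]; exact h.top_pos, by rw [ea]; exact h.decay⟩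

/-- Induction on the arcs still to be relaxed follows the linked list in memory. Each arc is charged
1200 for a possible decrease plus the overhead of the loop. -/
theorem relaxLoop_spec {s : State} {c : ℕ} (h : s.Queue n) (h9 : s.natReg 9 = x) (hx : x < n)
    (hxd : s.natArr 6 x ≠ 0) (hl : ∀ v ∈ l, v < n ∧ v ∈ adj x)
    (hW : ∀ u v, u < n → v < n → s.realArr 0 (u * n + v) = W u v ∧ 0 ≤ W u v)
    (harc : ArcList (s.natArr 4) (s.natArr 5) (s.natReg 15) l)
    (hS : Settling n adj W src B x l (s.natArr 6) (s.realArr 1)) :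
    WP relaxLoop (fun s' c' => s'.Queue n ∧
      c' + s'.potential n ≤ c + s.potential n + 1300 * l.length + 5 ∧
      Settled n adj W src B (s'.natArr 6) (s'.realArr 1)) s c := by
  induction l generalizing s c with
  | nil =>
    simp only [ArcList] at harc
    refine WP.while_false (by simp [harc]) ⟨h, ?_, hS.settled⟩
    simp; omega
  | cons v l ih =>
    obtain ⟨ha0, hav, harc⟩ := harc
    obtain ⟨hvn, hva⟩ := hl v (by simp)
    obtain ⟨hWe, hWn⟩ := hW x v hx hvn
    have hrow := h.trees.row_eq x hx.le
    refine WP.while_true (by simpa using ha0) ?_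
    rw [WP_block_cons, WP_setNat, WP_block_cons, WP_ite]
    refine ⟨fun hb => ?_, fun hb => ?_⟩
    · simp [h9, hav, hrow, hWe] at hb
      refine (decrease_spec (n := n) (x := x) (v := v)
        (h.congr (by simp) (by simp) (by simp) (by simp) (by simp)) (by simpa using h9)
        (by simpa using hav) hx (by simpa [hWe] using hb.le)).conseq ?_
      rintro s₁ c₁ fr ⟨hQ, hc, hk⟩
      have r9 := fr.natReg 9 rfl
      have r15 := fr.natReg 15 rfl
      have a4 := fr.natArr 4 rfl
      have a5 := fr.natArr 5 rfl
      have a6 := fr.natArr 6 rfl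
      have k0 := fr.realArr 0 rfl
      simp [h9, hWe] at r9 r15 a4 a5 a6 k0 hk
      rw [WP_block_cons, WP_setNat, WP_block_nil]
      refine (ih ?_ ?_ ?_ ?_ ?_ ?_ ?_).conseq ?_
      · exact hQ.congr (by simp) (by simp) (by simp) (by simp) (by simp)
      · simpa using r9
      · simpa [a6] using hxd
      · exact fun w hw => hl w (by simp [hw])
      · simpa [k0] using hW
      · simpa [a4, a5, r15] using harc
      · simpa [a6, hk] using hS.improve hx hxd hvn hva hWn hb
      · rintro s' c' - ⟨h1, h2, h3⟩
        refine ⟨h1, ?_, h3⟩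
        simp [State.potential] at h2 hc ⊢
        omega
    · simp [h9, hav, hrow, hWe] at hb
      rw [WP_skip, WP_block_cons, WP_setNat, WP_block_nil]
      refine (ih ?_ ?_ ?_ ?_ ?_ ?_ ?_).conseq ?_
      · exact h.congr (by simp) (by simp) (by simp) (by simp) (by simp)
      · simpa using h9
      · simpa using hxd
      · exact fun w hw => hl w (by simp [hw])
      · simpa using hW
      · simpa using harc
      · simpa using hS.skip hb
      · rintro s' c' - ⟨h1, h2, h3⟩
        refine ⟨h1, ?_, h3⟩
        simp [State.potential] at h2 ⊢
        omega

end Dijkstra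

end Dilation

namespace Dilation

/-! ### Dijkstra's algorithm from one source and from all sources. -/

section Dijkstra

open Finset Function

variable {n : ℕ} {adj : ℕ → List ℕ} {W : ℕ → ℕ → ℝ} {src : ℕ} {B : ℝ}

/-- The part of the memory that is read, but not changed, by the computation of shortest paths,
except that the table of multiples of `n` may be extended. -/
structure State.Network (s : State) (n : ℕ) (adj : ℕ → List ℕ) (W : ℕ → ℕ → ℝ) (B : ℝ) : Prop where
  n_eq : s.natReg 1 = n
  B_eq : s.realReg 1 = B
  B_nonneg : 0 ≤ B
  row_eq : ∀ i ≤ n, s.natArr 2 i = i * n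
  arcs : ∀ u < n, ArcList (s.natArr 4) (s.natArr 5) (s.natArr 3 u) (adj u)
  adj_lt : ∀ u < n, ∀ v ∈ adj u, v < n
  weight : ∀ u v, u < n → v < n → s.realArr 0 (u * n + v) = W u v ∧ 0 ≤ W u v

/-- Initialise the priority queue, with the source in register `6`. -/
def initQueue : Prog := .block [
  .setNat 8 (.lit 0),
  .while (.natLT (.reg 8) (.reg 1)) (.block [
    .storeNat 6 (.reg 8) (.lit 0),
    .storeNat 7 (.reg 8) (.lit 0),
    .storeNat 8 (.reg 8) (.lit 0),
    .storeReal 1 (.reg 8) (.reg 1),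
    .storeNat 12 (.reg 8) (.reg 8),
    .setNat 8 (.add (.reg 8) (.lit 1))]),
  .storeReal 1 (.reg 6) (.lit 0),
  .setNat 5 (.reg 1),
  .setNat 4 (.lit 0),
  .storeNat 10 (.lit 0) (.reg 1),
  .storeNat 13 (.lit 0) (.lit 0)]

/-- All keys except that of the source start at the cut-off `B`, which replaces ∞. The hypothesis on
parents of numbers from `n` on is needed because the forest condition ranges over all numbers,
whereas the loop clears only those below `n`. -/
theorem initQueue_spec {s : State} {c : ℕ} (h : s.Network n adj W B) (hsrc : s.natReg 6 = src)
    (hpar : ∀ y, n ≤ y → s.natArr 8 y = 0) :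
    WP initQueue (fun s' c' => s'.Queue n ∧ c' + s'.potential n ≤ c + 220 * n + 50 ∧
      Settled n adj W src B (s'.natArr 6) (s'.realArr 1) ∧ ∀ v < n, s'.natArr 6 v = 0) s c := by
  rw [initQueue, WP_block_cons, WP_setNat, WP_block_cons]
  refine WP.while (fun s' c' => s'.natReg 8 ≤ n ∧ c' ≤ c + 40 * s'.natReg 8 + 2 ∧
      (∀ y, n ≤ y → s'.natArr 8 y = 0) ∧ ∀ v < s'.natReg 8, s'.natArr 6 v = 0 ∧ s'.natArr 7 v = 0 ∧
        s'.natArr 8 v = 0 ∧ s'.realArr 1 v = B ∧ s'.natArr 12 v = v)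
    (fun s' => n - s'.natReg 8) (by simpa using hpar) ?_ ?_
  · rintro s₁ c₁ fr ⟨h8, hc, hp, hv⟩ hb
    have e1 := fr.natReg 1 rfl
    have eB := fr.realReg 1 rfl
    simp [h.n_eq, h.B_eq] at e1 eB
    simp [e1] at hb
    simp [eB]
    refine ⟨⟨by omega, by omega, fun y hy => ?_, fun v hv' => ?_⟩, by omega⟩
    · rw [update_of_ne (by omega)]; exact hp y hy
    · by_cases hvv : v = s₁.natReg 8
      · subst hvv; simp
      · simpa [hvv] using hv v (by omega)
  · rintro s₁ c₁ fr ⟨h8, hc, hp, hv⟩ hb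
    have e1 := fr.natReg 1 rfl
    have e6 := fr.natReg 6 rfl
    have e2 := fr.natArr 2 rfl
    simp [h.n_eq, hsrc] at e1 e6 e2
    simp [e1] at hb
    have h8' : s₁.natReg 8 = n := by omega
    rw [h8'] at hv hc
    simp only [WP_block_cons, WP_block_nil, WP_setNat, WP_storeNat, WP_storeReal]
    have hpar0 : ∀ y, s₁.natArr 8 y = 0 := fun y => by
      rcases Nat.lt_or_ge y n with hy | hy
      · exact (hv y hy).2.2.1
      · exact hp y hy
    have hlev : ∀ i, level n (s₁.natArr 7) (i + 1) = 0 := fun i =>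
      level_eq_zero fun y hy => by rw [(hv y hy).2.1]; omega
    refine ⟨⟨⟨?_, ?_, ?_, ?_, ?_, ?_⟩, ?_, ?_⟩, ?_, ⟨?_, ?_, ?_, ?_, ?_⟩, ?_⟩
    · simpa using e1
    · intro y x hyx
      simp [hpar0] at hyx
    · refine ⟨?_, ?_, ?_, ?_, ?_⟩
      · intro x hx; simp [(hv x hx).2.1]
      · simp [e2, h.row_eq 0 (by omega)]
      · simp [e1, level_zero]
      · intro i h1 hi; simp at hi; omega
      · intro i h1 hi; simp at hi; omega
    · refine ⟨?_, ?_, ?_, ?_, ?_⟩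
      · intro j _ hj
        simp [e1] at hj
        simp [hv j hj, hj]
      · intro i j _ hi _ hj
        simp [e1] at hi hj
        simp [hv i hi, hv j hj]
      · intro r hr x hx
        simp at hr
        subst hr
        simp at hx
      · intro x hx; omega
      · intro x hx _ _
        exact Or.inl ⟨x, Nat.zero_le _, by simpa [e1] using hx, by simp [hv x hx]⟩
    · simp
    · simpa [e2] using h.row_eq
    · simp [level_zero]
    · simp [hlev]
    · have h1 : totalRank n (s₁.natArr 7) = 0 :=
        sum_eq_zero fun x hx => (hv x (mem_range.1 hx)).2.1
      simp [State.potential, h1, e1]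
      omega
    · intro v hv'
      simp only [State.storeReal_realArr, State.storeNat_realArr, State.setNat_realArr, if_true]
      by_cases hvs : v = src
      · simp [e6, hvs, h.B_nonneg]
      · simp [e6, hvs, hv v hv']
    · simp [e6]
    · intro δ hδ v hv'
      by_cases hvs : v = src
      · simpa [e6, hvs] using hδ.src_le
      · simpa [e6, hvs, hv v hv'] using hδ.le_B v hv'
    · intro u hu hd
      simp [hv u hu] at hd
    · intro u hu v _ hd
      simp [hv u hu] at hd
    · intro v hv'
      simp [hv v hv']

/-- The number of arcs that go out from vertices in the queue. -/
def arcsLeft (n : ℕ) (adj : ℕ → List ℕ) (done : ℕ → ℕ) : ℕ :=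
  ∑ u ∈ range n, if done u = 0 then (adj u).length else 0

theorem arcsLeft_set {done : ℕ → ℕ} {x : ℕ} (hx : x < n) (hd : done x = 0) :
    arcsLeft n adj (update done x 1) + (adj x).length = arcsLeft n adj done := by
  unfold arcsLeft
  rw [← add_sum_erase _ _ (mem_range.2 hx),
    ← add_sum_erase _ (fun u => if done u = 0 then (adj u).length else 0) (mem_range.2 hx)]
  have : ∑ u ∈ (range n).erase x, (if update done x 1 u = 0 then (adj u).length else 0) =
      ∑ u ∈ (range n).erase x, if done u = 0 then (adj u).length else 0 :=
    sum_congr rfl fun u hu => by rw [update_of_ne (ne_of_mem_erase hu)]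
  rw [this]
  simp [hd]
  omega

/-- Compute the shortest paths from the source in register `6`. -/
def settleAll : Prog := .block [
  .setNat 7 (.lit 0),
  .while (.natLT (.reg 7) (.reg 1)) (.block [
    extract,
    .setNat 15 (.arr 3 (.reg 9)),
    relaxLoop,
    .setNat 7 (.add (.reg 7) (.lit 1))])]

theorem settleAll_spec {s : State} {c : ℕ} (h : s.Network n adj W B) (hQ : s.Queue n)
    (hS : Settled n adj W src B (s.natArr 6) (s.realArr 1)) (hd : ∀ v < n, s.natArr 6 v = 0) :
    WP settleAll (fun s' c' => s'.Queue n ∧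
      c' ≤ c + s.potential n + 10100 * ((Nat.log 2 n + 1) * n) +
        1300 * ∑ u ∈ range n, (adj u).length + 50 ∧
      Settled n adj W src B (fun _ => 1) (s'.realArr 1)) s c := by
  rw [settleAll, WP_block_cons, WP_setNat, WP_block_cons]
  have hU : undone n (s.natArr 6) = n := by
    rw [undone, filter_true_of_mem fun x hx => hd x (mem_range.1 hx), card_range]
  have hA : arcsLeft n adj (s.natArr 6) = ∑ u ∈ range n, (adj u).length :=
    sum_congr rfl fun u hu => by rw [if_pos (hd u (mem_range.1 hu))]
  -- The arcs of vertices not yet extracted serve as credit: 1300 steps per arc are set aside and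
  -- spent when its tail is extracted.
  refine WP.while (fun s' c' => s'.natReg 7 + undone n (s'.natArr 6) = n ∧ s'.Queue n ∧
      c' + s'.potential n + 1300 * arcsLeft n adj (s'.natArr 6) ≤ c + s.potential n +
        10100 * ((Nat.log 2 n + 1) * s'.natReg 7) + 1300 * arcsLeft n adj (s.natArr 6) + 2 ∧
      Settled n adj W src B (s'.natArr 6) (s'.realArr 1))
    (fun s' => n - s'.natReg 7) ?_ ?_ ?_
  · refine ⟨by simpa using hU, hQ.congr (by simp) (by simp) (by simp) (by simp) (by simp), ?_,
      by simpa using hS⟩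
    simp [State.potential]
    omega
  · rintro s₁ c₁ fr ⟨h7, hQ₁, hc₁, hS₁⟩ hb
    have e1 := fr.natReg 1 rfl
    have a3 := fr.natArr 3 rfl
    have a4 := fr.natArr 4 rfl
    have a5 := fr.natArr 5 rfl
    have k0 := fr.realArr 0 rfl
    simp [h.n_eq] at e1 a3 a4 a5 k0
    simp [e1] at hb
    obtain ⟨v, hv⟩ : ∃ v, v ∈ {x ∈ range n | s₁.natArr 6 x = 0} := by
      refine card_pos.1 ?_
      have : 0 < undone n (s₁.natArr 6) := by omega
      exact this
    simp only [mem_filter, mem_range] at hv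
    rw [WP_block_cons]
    refine (extract_spec hQ₁ hv.1 hv.2).conseq ?_
    rintro s₂ c₂ fr₂ ⟨hQ₂, hc₂, hx, hxd, hd₂, hmin⟩
    have r7 := fr₂.natReg 7 rfl
    have a3' := fr₂.natArr 3 rfl
    have a4' := fr₂.natArr 4 rfl
    have a5' := fr₂.natArr 5 rfl
    have k0' := fr₂.realArr 0 rfl
    have k1' := fr₂.realArr 1 rfl
    rw [a3] at a3'
    rw [a4] at a4'
    rw [a5] at a5'
    rw [k0] at k0'
    have hU₂ := undone_set hx hxd
    have hA₂ := arcsLeft_set (adj := adj) hx hxd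
    rw [← hd₂] at hU₂ hA₂
    have hS₂ := hS₁.extract hx hxd hmin
    rw [← hd₂, ← k1'] at hS₂
    rw [WP_block_cons, WP_setNat, WP_block_cons]
    refine (relaxLoop_spec (n := n) (adj := adj) (W := W) (src := src) (B := B)
      (x := s₂.natReg 9) (l := adj (s₂.natReg 9)) ?_ ?_ hx ?_ ?_ ?_ ?_ ?_).conseq ?_
    · exact hQ₂.congr (by simp) (by simp) (by simp) (by simp) (by simp)
    · simp
    · simp [hd₂]
    · exact fun w hw => ⟨h.adj_lt _ hx w hw, hw⟩
    · simpa [k0'] using h.weight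
    · simpa [a3', a4', a5'] using h.arcs _ hx
    · simpa using hS₂
    rintro s₃ c₃ fr₃ ⟨hQ₃, hc₃, hS₃⟩
    have r7₃ := fr₃.natReg 7 rfl
    have a6₃ := fr₃.natArr 6 rfl
    simp [r7] at r7₃ a6₃
    rw [WP_block_cons, WP_setNat, WP_block_nil]
    refine ⟨⟨?_, ?_, ?_, by simpa using hS₃⟩, ?_⟩
    · simp [r7₃, a6₃]; omega
    · exact hQ₃.congr (by simp) (by simp) (by simp) (by simp) (by simp)
    · simp [State.potential, a6₃, r7₃] at hc₁ hc₂ hc₃ ⊢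
      have : (Nat.log 2 n + 1) * (s₁.natReg 7 + 1) = 
        (Nat.log 2 n + 1) * s₁.natReg 7 + (Nat.log 2 n + 1) := by ring
      rw [this]
      omega
    · simp [r7₃]; omega
  · rintro s₁ c₁ fr ⟨h7, hQ₁, hc₁, hS₁⟩ hb
    have e1 := fr.natReg 1 rfl
    simp [h.n_eq] at e1
    simp [e1] at hb
    have h7' : s₁.natReg 7 = n := by omega
    have hU₁ : undone n (s₁.natArr 6) = 0 := by omega
    have hdone : ∀ v < n, s₁.natArr 6 v ≠ 0 := fun v hv h0 => by
      have : v ∈ {x ∈ range n | s₁.natArr 6 x = 0} := by simp [hv, h0]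
      rw [card_eq_zero.1 hU₁] at this
      simp at this
    rw [WP_block_nil]
    refine ⟨hQ₁, ?_, hS₁.le_B, hS₁.src_le, hS₁.lower,
      fun u hu _ v hv => hS₁.relaxed u hu (hdone u hu) v hv, fun u _ v _ _ h1 => by simp at h1⟩
    rw [h7', hA] at hc₁
    simp
    omega

/-- Store the distances from the source. -/
def storeRow : Prog := .block [
  .setNat 8 (.lit 0),
  .while (.natLT (.reg 8) (.reg 1)) (.block [
    .storeReal 2 (.add (.arr 2 (.reg 6)) (.reg 8)) (.arr 1 (.reg 8)),
    .setNat 8 (.add (.reg 8) (.lit 1))])]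

theorem storeRow_spec {s : State} {c : ℕ} (hn : s.natReg 1 = n) (hsrc : s.natReg 6 = src)
    (hrow : s.natArr 2 src = src * n) :
    WP storeRow (fun s' c' => c' ≤ c + 20 * n + 10 ∧
      (∀ v < n, s'.realArr 2 (src * n + v) = s.realArr 1 v) ∧
      ∀ i, i < src * n → s'.realArr 2 i = s.realArr 2 i) s c := by
  rw [storeRow, WP_block_cons, WP_setNat, WP_block_cons]
  refine WP.while (fun s' c' => s'.natReg 8 ≤ n ∧ c' ≤ c + 20 * s'.natReg 8 + 2 ∧
      (∀ v < s'.natReg 8, s'.realArr 2 (src * n + v) = s.realArr 1 v) ∧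
      ∀ i, i < src * n → s'.realArr 2 i = s.realArr 2 i)
    (fun s' => n - s'.natReg 8) (by simp) ?_ ?_
  · rintro s₁ c₁ fr ⟨h8, hc, hv, hi⟩ hb
    have e1 := fr.natReg 1 rfl
    have e6 := fr.natReg 6 rfl
    have a2 := fr.natArr 2 rfl
    have k1 := fr.realArr 1 rfl
    simp [hn, hsrc] at e1 e6 a2 k1
    simp [e1] at hb
    simp [e6, a2, hrow, k1]
    refine ⟨⟨by omega, by omega, fun v hv' => ?_, fun i hi' => ?_⟩, by omega⟩
    · by_cases hvv : v = s₁.natReg 8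
      · subst hvv; simp
      · rw [update_of_ne (by omega)]; exact hv v (by omega)
    · rw [update_of_ne (by omega)]; exact hi i hi'
  · rintro s₁ c₁ fr ⟨h8, hc, hv, hi⟩ hb
    have e1 := fr.natReg 1 rfl
    simp [hn] at e1
    simp [e1] at hb
    rw [WP_block_nil]
    exact ⟨by simp; omega, fun v hv' => hv v (by omega), hi⟩

/-- Compute all distances in the graph. -/
def allPairs : Prog := .block [
  .setNat 6 (.lit 0),
  .while (.natLT (.reg 6) (.reg 1)) (.block [
    initQueue, settleAll, storeRow, .setNat 6 (.add (.reg 6) (.lit 1))])]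

theorem allPairs_spec {s : State} {c : ℕ} (h : s.Network n adj W B)
    (hpar : ∀ y, n ≤ y → s.natArr 8 y = 0) :
    WP allPairs (fun s' c' =>
      c' ≤ c + (11000 * ((Nat.log 2 n + 1) * n) + 1300 * ∑ u ∈ range n, (adj u).length) * n +
        10 ∧ (∀ i ≤ n, s'.natArr 2 i = i * n) ∧
      ∀ u < n, Settled n adj W u B (fun _ => 1) fun v => s'.realArr 2 (u * n + v)) s c := by
  set T := 11000 * ((Nat.log 2 n + 1) * n) + 1300 * ∑ u ∈ range n, (adj u).length with hT
  rw [allPairs, WP_block_cons, WP_setNat, WP_block_cons]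
  refine WP.while (fun s' c' => s'.natReg 6 ≤ n ∧ c' ≤ c + T * s'.natReg 6 + 2 ∧
      (∀ y, n ≤ y → s'.natArr 8 y = 0) ∧ (∀ i ≤ n, s'.natArr 2 i = i * n) ∧
      ∀ u < s'.natReg 6, Settled n adj W u B (fun _ => 1) fun v => s'.realArr 2 (u * n + v))
    (fun s' => n - s'.natReg 6) ?_ ?_ ?_
  · simpa using ⟨hpar, h.row_eq⟩
  · rintro s₁ c₁ fr ⟨h6, hc, hp, hrow, hu⟩ hb
    have e1 := fr.natReg 1 rfl
    have eB := fr.realReg 1 rfl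
    have a3 := fr.natArr 3 rfl
    have a4 := fr.natArr 4 rfl
    have a5 := fr.natArr 5 rfl
    have k0 := fr.realArr 0 rfl
    simp [h.n_eq] at e1 eB a3 a4 a5 k0
    simp [e1] at hb
    have hN₁ : s₁.Network n adj W B := ⟨e1, by rw [eB, h.B_eq], h.B_nonneg, hrow,
      by rw [a3, a4, a5]; exact h.arcs, h.adj_lt, by rw [k0]; exact h.weight⟩
    rw [WP_block_cons]
    refine (initQueue_spec hN₁ rfl hp).conseq ?_
    rintro s₂ c₂ fr₂ ⟨hQ₂, hc₂, hS₂, hd₂⟩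
    have hN₂ : s₂.Network n adj W B := ⟨by rw [fr₂.natReg 1 rfl, e1],
      by rw [fr₂.realReg 1 rfl, hN₁.B_eq], h.B_nonneg, hQ₂.trees.row_eq,
      by rw [fr₂.natArr 3 rfl, fr₂.natArr 4 rfl, fr₂.natArr 5 rfl]; exact hN₁.arcs, h.adj_lt,
      by rw [fr₂.realArr 0 rfl]; exact hN₁.weight⟩
    rw [WP_block_cons]
    refine (settleAll_spec hN₂ hQ₂ hS₂ hd₂).conseq ?_
    rintro s₃ c₃ fr₃ ⟨hQ₃, hc₃, hS₃⟩
    have r6₃ : s₃.natReg 6 = s₁.natReg 6 := by rw [fr₃.natReg 6 rfl, fr₂.natReg 6 rfl]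
    have k2₃ : s₃.realArr 2 = s₁.realArr 2 := by rw [fr₃.realArr 2 rfl, fr₂.realArr 2 rfl]
    rw [WP_block_cons]
    refine (storeRow_spec (n := n) (src := s₁.natReg 6) hQ₃.trees.n_eq r6₃
      (hQ₃.trees.row_eq _ hb.le)).conseq ?_
    rintro s₄ c₄ fr₄ ⟨hc₄, hv₄, hi₄⟩
    have r6₄ : s₄.natReg 6 = s₁.natReg 6 := by rw [fr₄.natReg 6 rfl, r6₃]
    have a2₄ := fr₄.natArr 2 rfl
    have a8₄ := fr₄.natArr 8 rfl
    rw [WP_block_cons, WP_setNat, WP_block_nil]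
    refine ⟨⟨?_, ?_, ?_, ?_, ?_⟩, ?_⟩
    · simp [r6₄]; omega
    · have hle : n ≤ (Nat.log 2 n + 1) * n := Nat.le_mul_of_pos_left n (Nat.succ_pos _)
      have : T * (s₁.natReg 6 + 1) = T * s₁.natReg 6 + T := by ring
      simp [r6₄]
      rw [this]
      simp at hc₂ hc₃
      omega
    · simp [a8₄]
      intro y hy
      by_contra h0
      obtain ⟨x, hx⟩ := Nat.exists_eq_succ_of_ne_zero h0
      have := (hQ₃.trees.forest y x hx).1
      omega
    · simpa [a2₄] using hQ₃.trees.row_eq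
    · simp [r6₄]
      intro u hu'
      have hcongr : ∀ (f g : ℕ → ℝ) (w : ℕ), w < n → (∀ v < n, f v = g v) →
          Settled n adj W w B (fun _ => 1) g → Settled n adj W w B (fun _ => 1) f := by
        intro f g w hw hfg hg
        refine ⟨fun v hv => by rw [hfg v hv]; exact hg.le_B v hv, by rw [hfg w hw]; exact hg.src_le,
          fun δ hδ v hv => by rw [hfg v hv]; exact hg.lower δ hδ v hv, fun x hx hd v hv => ?_,
          fun _ _ _ _ _ h1 => by simp at h1⟩
        rw [hfg x hx, hfg v (h.adj_lt x hx v hv)]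
        exact hg.relaxed x hx hd v hv
      rcases Nat.lt_or_eq_of_le hu' with hu' | rfl
      · refine hcongr _ _ u (by omega) (fun v hv => ?_) (hu u hu')
        rw [hi₄, k2₃]
        calc u * n + v < (u + 1) * n := by rw [add_mul]; omega
          _ ≤ s₁.natReg 6 * n := Nat.mul_le_mul_right _ hu'
      · exact hcongr _ _ _ hb hv₄ hS₃
    · simp [r6₄]; omega
  · rintro s₁ c₁ fr ⟨h6, hc, hp, hrow, hu⟩ hb
    have e1 := fr.natReg 1 rfl
    simp [h.n_eq] at e1
    simp [e1] at hb
    have h6' : s₁.natReg 6 = n := by omega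
    rw [h6'] at hc hu
    rw [WP_block_nil]
    exact ⟨by simp; omega, hrow, hu⟩

end Dijkstra

end Dilation

namespace Dilation

section Prepare

open Finset Function

/-! ### Preparations -/

/-- Compute the multiples of `n`. -/
def rowTable : Prog := .block [
  .setNat 8 (.lit 0),
  .storeNat 2 (.lit 0) (.lit 0),
  .while (.natLT (.reg 8) (.reg 1)) (.block [
    .storeNat 2 (.add (.reg 8) (.lit 1)) (.add (.arr 2 (.reg 8)) (.reg 1)),
    .setNat 8 (.add (.reg 8) (.lit 1))])]

theorem rowTable_spec {s : State} {c n : ℕ} (hn : s.natReg 1 = n) :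
    WP rowTable (fun s' c' => c' ≤ c + 20 * n + 20 ∧ ∀ i ≤ n, s'.natArr 2 i = i * n) s c := by
  rw [rowTable, WP_block_cons, WP_setNat, WP_block_cons, WP_storeNat, WP_block_cons]
  refine WP.while (fun s' c' => s'.natReg 8 ≤ n ∧ c' ≤ c + 20 * s'.natReg 8 + 5 ∧
      ∀ i ≤ s'.natReg 8, s'.natArr 2 i = i * n)
    (fun s' => n - s'.natReg 8) (by simp) ?_ ?_
  · rintro s₁ c₁ fr ⟨h8, hc, hi⟩ hb
    have e1 := fr.natReg 1 rfl
    simp [hn] at e1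
    simp [e1] at hb
    simp [e1]
    refine ⟨⟨by omega, by omega, fun i hi' => ?_⟩, by omega⟩
    rcases Nat.lt_or_eq_of_le hi' with hi' | rfl
    · rw [update_of_ne (by omega)]; exact hi i (by omega)
    · rw [update_self, hi _ le_rfl]; ring
  · rintro s₁ c₁ fr ⟨h8, hc, hi⟩ hb
    have e1 := fr.natReg 1 rfl
    simp [hn] at e1
    simp [e1] at hb
    rw [WP_block_nil]
    exact ⟨by simp; omega, fun i hi' => hi i (by omega)⟩

/-- Compute a bound that exceeds `t` times the largest distance. -/
def maxDist : Prog := .block [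
  .setReal 2 (.lit 0),
  .setNat 8 (.lit 0),
  .while (.natLT (.reg 8) (.arr 2 (.reg 1))) (.block [
    .ite (.realLT (.reg 2) (.arr 0 (.reg 8))) (.setReal 2 (.arr 0 (.reg 8))) .skip,
    .setNat 8 (.add (.reg 8) (.lit 1))]),
  .setReal 1 (.add (.mul (.reg 0) (.reg 2)) (.lit 1))]

/-- The added 1 makes the bound strict, so that the cut-off value itself exceeds `t` times every
distance. -/
theorem maxDist_spec {s : State} {c n : ℕ} (hn : s.natReg 1 = n) (hrow : s.natArr 2 n = n * n)
    (ht : 0 ≤ s.realReg 0) :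
    WP maxDist (fun s' c' => c' ≤ c + 20 * (n * n) + 20 ∧ 0 ≤ s'.realReg 1 ∧
      ∀ i < n * n, s.realReg 0 * s.realArr 0 i < s'.realReg 1) s c := by
  rw [maxDist, WP_block_cons, WP_setReal, WP_block_cons, WP_setNat, WP_block_cons]
  refine WP.while (fun s' c' => s'.natReg 8 ≤ n * n ∧ c' ≤ c + 20 * s'.natReg 8 + 4 ∧
      0 ≤ s'.realReg 2 ∧ ∀ i < s'.natReg 8, s.realArr 0 i ≤ s'.realReg 2)
    (fun s' => n * n - s'.natReg 8) (by simp) ?_ ?_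
  · rintro s₁ c₁ fr ⟨h8, hc, h0, hi⟩ hb
    have e1 := fr.natReg 1 rfl
    have a2 := fr.natArr 2 rfl
    have k0 := fr.realArr 0 rfl
    simp [hn] at e1 a2 k0
    simp [e1, a2, hrow] at hb
    rw [WP_block_cons, WP_ite]
    refine ⟨fun hb1 => ?_, fun hb1 => ?_⟩
    · simp [k0] at hb1
      simp [k0]
      refine ⟨⟨by omega, by omega, h0.trans hb1.le, fun i hi' => ?_⟩, by omega⟩
      rcases Nat.lt_or_eq_of_le hi' with hi' | rfl
      · exact (hi i (by omega)).trans hb1.le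
      · exact le_rfl
    · simp [k0] at hb1
      simp
      refine ⟨⟨by omega, by omega, h0, fun i hi' => ?_⟩, by omega⟩
      rcases Nat.lt_or_eq_of_le hi' with hi' | rfl
      · exact hi i (by omega)
      · exact hb1
  · rintro s₁ c₁ fr ⟨h8, hc, h0, hi⟩ hb
    have e1 := fr.natReg 1 rfl
    have a2 := fr.natArr 2 rfl
    have r0 := fr.realReg 0 rfl
    simp [hn] at e1 a2 r0
    simp [e1, a2, hrow] at hb
    simp [r0]
    refine ⟨by omega, by positivity, fun i hi' => ?_⟩
    have := mul_le_mul_of_nonneg_left (hi i (by omega)) ht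
    linarith

/-- All pointers in use are at most `k`, so cell `k + 1` is fresh and writing to it does not disturb
any list. -/
theorem ArcList.update {nxt tgt : ℕ → ℕ} {k a b : ℕ} (hk : ∀ h, nxt h ≤ k) {h : ℕ} {l : List ℕ}
    (hh : h ≤ k) (hl : ArcList nxt tgt h l) :
    ArcList (update nxt (k + 1) a) (update tgt (k + 1) b) h l := by
  induction l generalizing h with
  | nil => exact hl
  | cons v l ih =>
    obtain ⟨h1, h2, h3⟩ := hl
    refine ⟨h1, by rwa [update_of_ne (by omega)], ?_⟩
    rw [update_of_ne (by omega)]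
    exact ih (hk h) h3

/-- The arcs `1`, …, `k` are organised in lists. -/
structure State.Arcs (s : State) (k : ℕ) (adj : ℕ → List ℕ) : Prop where
  num : s.natReg 13 = k
  nxt_le : ∀ h, s.natArr 4 h ≤ k
  head_le : ∀ u, s.natArr 3 u ≤ k
  list : ∀ u, ArcList (s.natArr 4) (s.natArr 5) (s.natArr 3 u) (adj u)

/-- Insert an arc from the vertex in register `a` to the vertex in register `b`. -/
def addArc (a b : ℕ) : Prog := .block [
  .setNat 13 (.add (.reg 13) (.lit 1)),
  .storeNat 5 (.reg 13) (.reg b),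
  .storeNat 4 (.reg 13) (.arr 3 (.reg a)),
  .storeNat 3 (.reg a) (.reg 13)]

theorem addArc_spec {s : State} {c k a b : ℕ} {adj : ℕ → List ℕ} (h : s.Arcs k adj)
    (ha : a ≠ 13) (hb : b ≠ 13) :
    WP (addArc a b) (fun s' c' => c' ≤ c + 20 ∧ s'.Arcs (k + 1)
      (update adj (s.natReg a) (s.natReg b :: adj (s.natReg a)))) s c := by
  simp only [addArc, WP_block_cons, WP_block_nil, WP_setNat, WP_storeNat]
  refine ⟨by simp, ⟨by simp [h.num], fun i => ?_, fun u => ?_, fun u => ?_⟩⟩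
  · by_cases hi : i = k + 1
    · simp [hi, h.num, ha]
      exact (h.head_le _).trans (Nat.le_succ _)
    · simp [hi, h.num]
      exact (h.nxt_le _).trans (Nat.le_succ _)
  · by_cases hu : u = s.natReg a
    · simp [hu, h.num, ha]
    · simp [hu, ha]
      exact (h.head_le _).trans (Nat.le_succ _)
  · by_cases hu : u = s.natReg a
    · subst hu
      simp only [update_self]
      simp [h.num, ha, hb, ArcList]
      exact (h.list _).update h.nxt_le (h.head_le _)
    · simp [hu, h.num, ha, hb]
      exact (h.list _).update h.nxt_le (h.head_le _)

/-- Build the lists of arcs. -/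
def buildArcs : Prog := .block [
  .setNat 13 (.lit 0),
  .setNat 8 (.lit 0),
  .while (.natLT (.reg 8) (.reg 2)) (.block [
    .setNat 9 (.arr 0 (.reg 8)),
    .setNat 10 (.arr 1 (.reg 8)),
    addArc 9 10,
    addArc 10 9,
    .setNat 8 (.add (.reg 8) (.lit 1))])]

theorem sum_length_update {n u : ℕ} {adj : ℕ → List ℕ} (hu : u < n) (v : ℕ) :
    ∑ x ∈ range n, (update adj u (v :: adj u) x).length =
      (∑ x ∈ range n, (adj x).length) + 1 := by
  rw [← add_sum_erase _ _ (mem_range.2 hu),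
    ← add_sum_erase _ (fun x => (adj x).length) (mem_range.2 hu)]
  have : ∑ x ∈ (range n).erase u, (update adj u (v :: adj u) x).length =
      ∑ x ∈ (range n).erase u, (adj x).length :=
    sum_congr rfl fun x hx => by rw [update_of_ne (ne_of_mem_erase hx)]
  rw [this]
  simp
  omega

theorem buildArcs_spec {s : State} {c n : ℕ} {E : List (ℕ × ℕ)} (hm : s.natReg 2 = E.length)
    (hE : ∀ i (hi : i < E.length), s.natArr 0 i = E[i].1 ∧ s.natArr 1 i = E[i].2)
    (hEn : ∀ q ∈ E, q.1 < n ∧ q.2 < n) (h3 : ∀ i, s.natArr 3 i = 0) (h4 : ∀ i, s.natArr 4 i = 0) :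
    WP buildArcs (fun s' c' => c' ≤ c + 70 * E.length + 20 ∧ ∃ adj : ℕ → List ℕ,
      (∀ u, ArcList (s'.natArr 4) (s'.natArr 5) (s'.natArr 3 u) (adj u)) ∧
      (∀ u v, v ∈ adj u ↔ (u, v) ∈ E ∨ (v, u) ∈ E) ∧
      ∑ u ∈ range n, (adj u).length = 2 * E.length) s c := by
  rw [buildArcs, WP_block_cons, WP_setNat, WP_block_cons, WP_setNat, WP_block_cons]
  refine WP.while (fun s' c' => s'.natReg 8 ≤ E.length ∧ c' ≤ c + 70 * s'.natReg 8 + 4 ∧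
      ∃ adj : ℕ → List ℕ, s'.Arcs (2 * s'.natReg 8) adj ∧
      (∀ u v, v ∈ adj u ↔ (u, v) ∈ E.take (s'.natReg 8) ∨ (v, u) ∈ E.take (s'.natReg 8)) ∧
      ∑ u ∈ range n, (adj u).length = 2 * s'.natReg 8)
    (fun s' => E.length - s'.natReg 8) ?_ ?_ ?_
  · refine ⟨by simp, by simp, fun _ => [], ⟨?_, ?_, ?_, ?_⟩, by simp, by simp⟩
    · simp
    · simp [h4]
    · simp [h3]
    · simp [h3, ArcList]
  · rintro s₁ c₁ fr ⟨h8, hc, adj, hA, hmem, hsum⟩ hb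
    have e2 := fr.natReg 2 rfl
    have a0 := fr.natArr 0 rfl
    have a1 := fr.natArr 1 rfl
    simp [hm] at e2 a0 a1
    simp [e2] at hb
    obtain ⟨hu, hv⟩ := hE _ hb
    obtain ⟨hun, hvn⟩ := hEn _ (List.getElem_mem hb)
    set u := (E[s₁.natReg 8]).1 with hu'
    set v := (E[s₁.natReg 8]).2 with hv'
    have huv : E[s₁.natReg 8] = (u, v) := rfl
    simp only [WP_block_cons, WP_setNat]
    refine (addArc_spec (k := 2 * s₁.natReg 8) (adj := adj)
      ⟨?_, ?_, ?_, ?_⟩ (by norm_num) (by norm_num)).conseq ?_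
    · simpa using hA.num
    · simpa using hA.nxt_le
    · simpa using hA.head_le
    · simpa using hA.list
    rintro s₂ c₂ fr₂ ⟨hc₂, hA₂⟩
    have r8 := fr₂.natReg 8 rfl
    have r9 := fr₂.natReg 9 rfl
    have r10 := fr₂.natReg 10 rfl
    simp [a0, a1, hu, hv] at r8 r9 r10 hA₂ hc₂
    rw [WP_block_cons]
    refine (addArc_spec hA₂ (by norm_num) (by norm_num)).conseq ?_
    rintro s₃ c₃ fr₃ ⟨hc₃, hA₃⟩
    have r8₃ := fr₃.natReg 8 rfl
    rw [r8] at r8₃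
    rw [r9, r10] at hA₃
    rw [WP_block_cons, WP_setNat, WP_block_nil]
    refine ⟨⟨by simp [r8₃]; omega, by simp [r8₃]; omega,
      update (update adj u (v :: adj u)) v (u :: update adj u (v :: adj u) v),
      ⟨?_, ?_, ?_, ?_⟩, ?_, ?_⟩, by simp [r8₃]; omega⟩
    · simp [hA₃.num, r8₃]; omega
    · simpa [r8₃, mul_add] using hA₃.nxt_le
    · simpa [r8₃, mul_add] using hA₃.head_le
    · simpa using hA₃.list
    · intro x y
      simp only [State.setNat_natReg, NExpr.eval, if_true, r8₃]
      rw [List.take_succ_eq_append_getElem hb, huv]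
      simp only [List.mem_append, List.mem_singleton, Prod.mk.injEq]
      have h1 := hmem x y
      by_cases hxv : x = v
      · subst hxv
        rw [update_self, List.mem_cons]
        by_cases hvu : v = u
        · rw [hvu] at h1 ⊢
          rw [update_self, List.mem_cons, h1]
          tauto
        · rw [update_of_ne hvu, h1]
          tauto
      · rw [update_of_ne hxv]
        by_cases hxu : x = u
        · subst hxu
          rw [update_self, List.mem_cons, h1]
          tauto
        · rw [update_of_ne hxu, h1]
          tauto
    · simp only [State.setNat_natReg, NExpr.eval, if_true, r8₃]
      rw [sum_length_update hvn, sum_length_update hun, hsum]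
      ring
  · rintro s₁ c₁ fr ⟨h8, hc, adj, hA, hmem, hsum⟩ hb
    have e2 := fr.natReg 2 rfl
    simp [hm] at e2
    simp [e2] at hb
    have h8' : s₁.natReg 8 = E.length := by omega
    rw [h8'] at hmem hsum
    rw [List.take_length] at hmem
    rw [WP_block_nil]
    exact ⟨by simp; omega, adj, hA.list, hmem, hsum⟩

end Prepare

end Dilation

namespace Dilation

section GraphDist

/-! ### Distances in metric graphs -/

variable {n : ℕ} {M : Type*} [MetricSpace M] {G H : SimpleGraph (Fin n)} {p : Fin n → M}
  {u v w x y : Fin n}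

@[simp] theorem walkLength_nil : walkLength p (SimpleGraph.Walk.nil : G.Walk u u) = 0 := by
  simp [walkLength]

@[simp] theorem walkLength_cons (h : G.Adj u v) (q : G.Walk v w) :
    walkLength p (.cons h q) = edist (p u) (p v) + walkLength p q := by
  simp [walkLength]

@[simp] theorem walkLength_append (q : G.Walk u v) (q' : G.Walk v w) :
    walkLength p (q.append q') = walkLength p q + walkLength p q' := by
  simp [walkLength, SimpleGraph.Walk.darts_append]

@[simp] theorem walkLength_reverse (q : G.Walk u v) :
    walkLength p q.reverse = walkLength p q := by
  simp [walkLength, SimpleGraph.Walk.darts_reverse, Function.comp_def, edist_comm]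

theorem walkLength_mapLe (h : G ≤ H) (q : G.Walk u v) :
    walkLength p (q.mapLe h) = walkLength p q := by
  induction q with
  | nil => simp
  | cons hadj q ih => simp [ih]

theorem walkLength_ne_top (q : G.Walk u v) : walkLength p q ≠ ⊤ := by
  induction q with
  | nil => simp
  | cons h q ih => simp [ih, edist_ne_top]

theorem graphDist_le (q : G.Walk u v) : graphDist G p u v ≤ walkLength p q := iInf_le _ q

@[simp] theorem graphDist_self : graphDist G p u u = 0 :=
  le_antisymm ((graphDist_le .nil).trans_eq walkLength_nil) bot_le

theorem graphDist_comm : graphDist G p u v = graphDist G p v u := by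
  refine le_antisymm (le_iInf fun q => ?_) (le_iInf fun q => ?_) <;>
  exact (graphDist_le q.reverse).trans_eq (walkLength_reverse q)

theorem graphDist_triangle : graphDist G p u w ≤ graphDist G p u v + graphDist G p v w := by
  unfold graphDist
  refine ENNReal.le_iInf_add_iInf fun q q' => ?_
  exact (graphDist_le (q.append q')).trans_eq (walkLength_append q q')

theorem graphDist_le_of_adj (h : G.Adj u v) : graphDist G p u v ≤ edist (p u) (p v) :=
  (graphDist_le (.cons h .nil)).trans_eq (by simp)

theorem graphDist_anti (h : G ≤ H) : graphDist H p u v ≤ graphDist G p u v :=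
  le_iInf fun q => (graphDist_le (q.mapLe h)).trans_eq (walkLength_mapLe h q)

/-- A function that grows along each edge by at most its length grows along a walk by at most the
length of the walk. This makes such functions lower bounds for distances. -/
theorem le_add_walkLength {f : Fin n → ℝ}
    (hf : ∀ a b, G.Adj a b → f b ≤ f a + dist (p a) (p b)) (q : G.Walk u v) :
    f v ≤ f u + (walkLength p q).toReal := by
  induction q with
  | nil => simp
  | cons h q ih =>
    rw [walkLength_cons, ENNReal.toReal_add (edist_ne_top _ _) (walkLength_ne_top q), edist_dist,
      ENNReal.toReal_ofReal dist_nonneg]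
    linarith [hf _ _ h]

/-- The distance in `G`, cut off at `B`. -/
noncomputable def truncDist (G : SimpleGraph (Fin n)) (p : Fin n → M) (B : ℝ) (u v : Fin n) : ℝ :=
  (min (ENNReal.ofReal B) (graphDist G p u v)).toReal

variable {B : ℝ}

theorem truncDist_le (hB : 0 ≤ B) : truncDist G p B u v ≤ B :=
  (ENNReal.toReal_mono ENNReal.ofReal_ne_top (min_le_left _ _)).trans_eq (ENNReal.toReal_ofReal hB)

theorem truncDist_nonneg : 0 ≤ truncDist G p B u v := ENNReal.toReal_nonneg

@[simp] theorem truncDist_self : truncDist G p B u u = 0 := by simp [truncDist]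

theorem truncDist_comm : truncDist G p B u v = truncDist G p B v u := by
  rw [truncDist, graphDist_comm, truncDist]

theorem truncDist_triangle : truncDist G p B u w ≤ truncDist G p B u v + truncDist G p B v w := by
  have hne : ∀ a b, min (ENNReal.ofReal B) (graphDist G p a b) ≠ ⊤ := fun a b =>
    ne_top_of_le_ne_top ENNReal.ofReal_ne_top (min_le_left _ _)
  unfold truncDist
  rw [← ENNReal.toReal_add (hne _ _) (hne _ _)]
  refine ENNReal.toReal_mono (ENNReal.add_ne_top.2 ⟨hne _ _, hne _ _⟩) ?_
  rcases le_total (ENNReal.ofReal B) (graphDist G p u v) with h1 | h1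
  · rw [min_eq_left h1]
    exact (min_le_left _ _).trans le_self_add
  rcases le_total (ENNReal.ofReal B) (graphDist G p v w) with h2 | h2
  · rw [min_eq_left h2]
    exact (min_le_left _ _).trans le_add_self
  rw [min_eq_right h1, min_eq_right h2]
  exact (min_le_right _ _).trans graphDist_triangle

theorem truncDist_anti (h : G ≤ H) : truncDist H p B u v ≤ truncDist G p B u v :=
  ENNReal.toReal_mono (ne_top_of_le_ne_top ENNReal.ofReal_ne_top (min_le_left _ _))
    (min_le_min_left _ (graphDist_anti h))

theorem truncDist_le_of_adj (h : G.Adj u v) : truncDist G p B u v ≤ dist (p u) (p v) := by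
  rw [dist_edist]
  exact ENNReal.toReal_mono (edist_ne_top _ _) ((min_le_right _ _).trans (graphDist_le_of_adj h))

/-- The truncated distance is the largest of the functions that satisfy the obvious
inequalities. -/
theorem le_truncDist {f : Fin n → ℝ} (h0 : f u ≤ 0) (hB : ∀ a, f a ≤ B)
    (hf : ∀ a b, G.Adj a b → f b ≤ f a + dist (p a) (p b)) (v : Fin n) :
    f v ≤ truncDist G p B u v := by
  refine (le_max_left _ 0).trans ?_
  rw [← ENNReal.toReal_ofReal']
  refine ENNReal.toReal_mono (ne_top_of_le_ne_top ENNReal.ofReal_ne_top (min_le_left _ _))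
    (le_min (ENNReal.ofReal_le_ofReal (hB v)) (le_iInf fun q => ?_))
  rw [← ENNReal.ofReal_toReal (walkLength_ne_top (p := p) q)]
  exact ENNReal.ofReal_le_ofReal (by linarith [le_add_walkLength hf q])

/-- A violating pair remains visible after the cut-off because `t` times its distance in the metric
space lies strictly below `B`. -/
theorem isViolating_iff {t : ℝ} (ht : 0 ≤ t) {e : Fin n × Fin n}
    (hB : t * dist (p e.1) (p e.2) < B) :
    IsViolating G p t e ↔ t * dist (p e.1) (p e.2) < truncDist G p B e.1 e.2 := by
  have h0 : 0 ≤ t * dist (p e.1) (p e.2) := by positivity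
  rw [IsViolating, truncDist, ← ENNReal.ofReal_lt_iff_lt_toReal h0
    (ne_top_of_le_ne_top ENNReal.ofReal_ne_top (min_le_left _ _)), lt_min_iff,
    ENNReal.ofReal_lt_ofReal_iff_of_nonneg h0, edist_dist, ← ENNReal.ofReal_mul ht]
  exact ⟨fun h => ⟨hB, h⟩, fun h => h.2⟩

theorem le_augment (S : Finset (Fin n × Fin n)) : G ≤ augment G S := le_sup_left

theorem augment_adj {S : Finset (Fin n × Fin n)} :
    (augment G S).Adj u v ↔ G.Adj u v ∨ (u ≠ v ∧ ((u, v) ∈ S ∨ (v, u) ∈ S)) := by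
  simp [augment]

/-- The truncated distances after the insertion of an edge. -/
theorem truncDist_augment (huv : u ≠ v) :
    truncDist (augment G {(u, v)}) p B x y =
      min (truncDist G p B x y) (min
        (truncDist G p B x u + dist (p u) (p v) + truncDist G p B v y)
        (truncDist G p B x v + dist (p u) (p v) + truncDist G p B u y)) := by
  have hle := le_augment (G := G) {(u, v)}
  have hadj : (augment G {(u, v)}).Adj u v := augment_adj.2 (Or.inr ⟨huv, by simp⟩)
  have hd := truncDist_le_of_adj (p := p) (B := B) hadj
  by_cases hB : 0 ≤ B
  swap
  · have : ENNReal.ofReal B = 0 := ENNReal.ofReal_of_nonpos (le_of_not_ge hB)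
    simp [truncDist, this]
  refine le_antisymm (le_min (truncDist_anti hle) (le_min ?_ ?_)) ?_
  · have h1 := truncDist_anti (p := p) (B := B) (u := x) (v := u) hle
    have h2 := truncDist_anti (p := p) (B := B) (u := v) (v := y) hle
    have h3 := truncDist_triangle (G := augment G {(u, v)}) (p := p) (B := B) (u := x) (v := u)
      (w := y)
    have h4 := truncDist_triangle (G := augment G {(u, v)}) (p := p) (B := B) (u := u) (v := v)
      (w := y)
    linarith
  · have h1 := truncDist_anti (p := p) (B := B) (u := x) (v := v) hle
    have h2 := truncDist_anti (p := p) (B := B) (u := u) (v := y) hle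
    have h3 := truncDist_triangle (G := augment G {(u, v)}) (p := p) (B := B) (u := x) (v := v)
      (w := y)
    have h4 := truncDist_triangle (G := augment G {(u, v)}) (p := p) (B := B) (u := v) (v := u)
      (w := y)
    rw [truncDist_comm (u := v) (v := u)] at h4
    linarith
  -- The formula, as a function of its last argument, is bounded by `B`, nonpositive at `x`, and
  -- grows along each old edge and along the new one by at most the length; so it lies below the
  -- distance in the larger graph.
  · refine le_truncDist (G := augment G {(u, v)}) (u := x) (f := fun y =>
      min (truncDist G p B x y) (min
        (truncDist G p B x u + dist (p u) (p v) + truncDist G p B v y)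
        (truncDist G p B x v + dist (p u) (p v) + truncDist G p B u y))) ?_ ?_ ?_ y
    · exact (min_le_left _ _).trans_eq truncDist_self
    · exact fun a => (min_le_left _ _).trans (truncDist_le hB)
    · intro a b hab
      have hw : 0 ≤ dist (p u) (p v) := dist_nonneg
      have huv0 := truncDist_nonneg (G := G) (p := p) (B := B) (u := u) (v := v)
      have hvu0 := truncDist_nonneg (G := G) (p := p) (B := B) (u := v) (v := u)
      rcases augment_adj.1 hab with h | ⟨-, h⟩
      · have hs : ∀ z, truncDist G p B z b ≤ truncDist G p B z a + dist (p a) (p b) := fun z =>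
          (truncDist_triangle (v := a)).trans (by linarith [truncDist_le_of_adj (p := p) (B := B) h])
        simp only [← min_add_add_right]
        exact min_le_min (hs x) (min_le_min (by linarith [hs v]) (by linarith [hs u]))
      · simp only [Finset.mem_singleton, Prod.mk.injEq] at h
        simp only [← min_add_add_right]
        rcases h with ⟨rfl, rfl⟩ | ⟨rfl, rfl⟩
        · refine le_min ?_ (le_min ?_ ?_)
          · exact (min_le_right _ _).trans ((min_le_left _ _).trans (by simp))
          · exact (min_le_right _ _).trans ((min_le_left _ _).trans (by simp; linarith))
          · exact (min_le_left _ _).trans (by simp; linarith)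
        · rw [dist_comm (p a) (p b)]
          refine le_min ?_ (le_min ?_ ?_)
          · exact (min_le_right _ _).trans ((min_le_right _ _).trans (by simp))
          · exact (min_le_left _ _).trans (by simp; linarith)
          · exact (min_le_right _ _).trans ((min_le_right _ _).trans (by simp; linarith))

/-- The computed keys are the truncated distances. -/
theorem Settled.eq_truncDist {adj : ℕ → List ℕ} {W : ℕ → ℕ → ℝ} {src : Fin n} {key : ℕ → ℝ}
    (h : Settled n adj W src B (fun _ => 1) key) (hB : 0 ≤ B)
    (hadj : ∀ a b : Fin n, (b : ℕ) ∈ adj a ↔ G.Adj a b) (hlt : ∀ a < n, ∀ b ∈ adj a, b < n)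
    (hW : ∀ a b : Fin n, W a b = dist (p a) (p b)) (v : Fin n) :
    key v = truncDist G p B src v := by
  refine le_antisymm ?_ ?_
  -- Both functions are the largest solution of the same system of inequalities: the final keys
  -- solve it because all arcs are relaxed, and the cut-off distance is an admissible lower bound
  -- for the keys.
  · refine le_truncDist (f := fun a : Fin n => key a) h.src_le (fun a => h.le_B a a.2) ?_ v
    intro a b hab
    rw [← hW]
    exact h.relaxed a a.2 one_ne_zero b ((hadj a b).2 hab)
  · have := h.lower (fun a => if ha : a < n then truncDist G p B src ⟨a, ha⟩ else 0)
      ⟨by simp, fun a ha => by simpa [ha] using truncDist_le hB, ?_⟩ v v.2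
    · simpa using this
    · intro a ha b hb
      have hb' := hlt a ha b hb
      simp only [ha, hb', dif_pos]
      have h1 := (hadj ⟨a, ha⟩ ⟨b, hb'⟩).1 hb
      have h2 := hW ⟨a, ha⟩ ⟨b, hb'⟩
      simp only at h2
      rw [h2]
      exact truncDist_triangle.trans (by gcongr; exact truncDist_le_of_adj h1)

end GraphDist

end Dilation

namespace Dilation

section Greedy

open Finset Function

/-! ### The greedy construction -/

/-- Run `P` for all pairs of vertices; the pair is found in the registers `8` and `9`, its position
in the matrices in register `10`. -/
def sweep (P : Prog) : Prog := .block [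
  .setNat 8 (.lit 0),
  .setNat 9 (.lit 0),
  .setNat 10 (.lit 0),
  .while (.natLT (.reg 10) (.arr 2 (.reg 1))) (.block [
    P,
    .setNat 10 (.add (.reg 10) (.lit 1)),
    .setNat 9 (.add (.reg 9) (.lit 1)),
    .ite (.natEq (.reg 9) (.reg 1)) (.block [
      .setNat 9 (.lit 0),
      .setNat 8 (.add (.reg 8) (.lit 1))]) .skip])]

theorem mul_add_lt {n x y : ℕ} (hx : x < n) (hy : y < n) : x * n + y < n * n :=
  calc x * n + y < x * n + n := by omega
    _ = (x + 1) * n := by ring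
    _ ≤ n * n := Nat.mul_le_mul_right _ hx

/-- `J i` is meant to describe the state after the first `i` positions. It must not depend on
registers 8 to 10, which the sweep changes between two runs of `P`. -/
theorem sweep_spec {P : Prog} {s : State} {c n K : ℕ} (hn : s.natReg 1 = n)
    (hrow : s.natArr 2 n = n * n) (h1 : P.writesNatReg 1 = false) (h8 : P.writesNatReg 8 = false)
    (h9 : P.writesNatReg 9 = false) (h10 : P.writesNatReg 10 = false)
    (h2 : P.writesNatArr 2 = false) (J : ℕ → State → Prop)
    (hJ : ∀ i s x v, J i s → 8 ≤ x → x ≤ 10 → J i (s.setNat x v)) (h0 : J 0 s)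
    (step : ∀ s₁ c₁ u v, u < n → v < n → s₁.natReg 8 = u → s₁.natReg 9 = v →
      s₁.natReg 10 = u * n + v → s₁.natArr 2 = s.natArr 2 → J (u * n + v) s₁ →
      WP P (fun s' c' => c' ≤ c₁ + K ∧ J (u * n + v + 1) s') s₁ c₁) :
    WP (sweep P) (fun s' c' => c' ≤ c + (K + 30) * (n * n) + 20 ∧ J (n * n) s') s c := by
  simp only [sweep, WP_block_cons, WP_setNat]
  refine WP.while (fun s' c' => s'.natReg 1 = n ∧ s'.natArr 2 = s.natArr 2 ∧
      s'.natReg 10 ≤ n * n ∧ s'.natReg 10 = s'.natReg 8 * n + s'.natReg 9 ∧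
      (0 < n → s'.natReg 9 < n) ∧
      c' ≤ c + (K + 30) * s'.natReg 10 + 6 ∧ J (s'.natReg 10) s')
    (fun s' => n * n - s'.natReg 10) ?_ ?_ ?_
  · refine ⟨by simpa using hn, by simp, by simp, by simp, by simp, by simp, ?_⟩
    simp only [State.setNat_natReg, if_true, NExpr.eval]
    exact hJ _ _ _ _ (hJ _ _ _ _ (hJ _ _ _ _ h0 (by simp) (by simp)) (by simp) (by simp))
      (by simp) (by simp)
  · rintro s₁ c₁ - ⟨e1, a2, hle, heq, h9n, hc, hJ₁⟩ hb
    simp only [BExpr.Holds, NExpr.eval, e1, a2, hrow] at hb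
    have hn0 : 0 < n := Nat.pos_of_ne_zero fun h => by subst h; simp at hb
    have h9' := h9n hn0
    have h8' : s₁.natReg 8 < n := by
      by_contra hge
      have := Nat.mul_le_mul_right n (le_of_not_gt hge)
      omega
    rw [WP_block_cons]
    rw [heq] at hJ₁
    refine (step s₁ _ _ _ h8' h9' rfl rfl heq a2 hJ₁).conseq ?_
    rintro s₂ c₂ fr ⟨hc₂, hJ₂⟩
    have r1 := fr.natReg 1 h1
    have r8 := fr.natReg 8 h8
    have r9 := fr.natReg 9 h9
    have r10 := fr.natReg 10 h10
    have r2 := fr.natArr 2 h2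
    rw [← heq] at hJ₂
    have hmul : (K + 30) * (s₁.natReg 10 + 1) = (K + 30) * s₁.natReg 10 + (K + 30) := by ring
    simp only [BExpr.cost, NExpr.cost] at hc₂
    simp only [WP_block_cons, WP_setNat, WP_ite, WP_skip, WP_block_nil]
    refine ⟨fun hb1 => ?_, fun hb1 => ?_⟩
    · simp [r1, r9, e1] at hb1
      have hJ₃ := fun a b x y => hJ _ _ 8 b (hJ _ _ 9 a (hJ _ _ 9 x (hJ _ _ 10 y hJ₂ (by simp)
        (by simp)) (by simp) (by simp)) (by simp) (by simp)) (by simp) (by simp)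
      refine ⟨⟨by simp [r1, e1], by simp [r2, a2], by simp [r10]; omega, ?_, by simp, ?_, ?_⟩, ?_⟩
      · simp [r10, r8, heq]
        rw [add_mul]; omega
      · simp [r10, hmul]; omega
      · convert hJ₃ _ _ _ _ using 1
        simp [r10]
      · simp [r10]; omega
    · simp [r1, r9, e1] at hb1
      have hJ₃ := fun x y => hJ _ _ 9 x (hJ _ _ 10 y hJ₂ (by simp) (by simp)) (by simp) (by simp)
      refine ⟨⟨by simp [r1, e1], by simp [r2, a2], by simp [r10]; omega, ?_, ?_, ?_, ?_⟩, ?_⟩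
      · simp [r10, r8, r9, heq]; omega
      · simp [r9]; omega
      · simp [r10, hmul]; omega
      · convert hJ₃ _ _ using 1
        simp [r10]
      · simp [r10]; omega
  · rintro s₁ c₁ - ⟨e1, a2, hle, heq, h9n, hc, hJ₁⟩ hb
    simp only [BExpr.Holds, NExpr.eval, e1, a2, hrow] at hb
    have h10' : s₁.natReg 10 = n * n := by omega
    rw [h10'] at hJ₁ hc
    rw [WP_block_nil]
    exact ⟨by simp; omega, hJ₁⟩

/-- Compare the pair at hand with the shortest violating pair found so far. -/
def inspect : Prog :=
  .ite (.and (.realLT (.mul (.reg 0) (.arr 0 (.reg 10))) (.arr 2 (.reg 10)))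
      (.or (.natEq (.reg 13) (.lit 0)) (.realLT (.arr 0 (.reg 10)) (.reg 2))))
    (.block [
      .setNat 13 (.lit 1),
      .setNat 11 (.reg 8),
      .setNat 12 (.reg 9),
      .setReal 2 (.arr 0 (.reg 10))]) .skip

/-- Find a shortest violating pair. -/
def scan : Prog := .block [.setNat 13 (.lit 0), sweep inspect]

theorem scan_spec {s : State} {c n : ℕ} (hn : s.natReg 1 = n) (hrow : s.natArr 2 n = n * n) :
    WP scan (fun s' c' => c' ≤ c + 70 * (n * n) + 30 ∧
      ((s'.natReg 13 = 0 ∧ ∀ j < n * n, s.realArr 2 j ≤ s.realReg 0 * s.realArr 0 j) ∨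
      (s'.natReg 13 ≠ 0 ∧ ∃ u < n, ∃ v < n, s'.natReg 11 = u ∧ s'.natReg 12 = v ∧
        s'.realReg 2 = s.realArr 0 (u * n + v) ∧
        s.realReg 0 * s.realArr 0 (u * n + v) < s.realArr 2 (u * n + v) ∧
        ∀ j < n * n, s.realReg 0 * s.realArr 0 j < s.realArr 2 j →
          s.realArr 0 (u * n + v) ≤ s.realArr 0 j))) s c := by
  rw [scan, WP_block_cons, WP_setNat, WP_block_cons]
  refine (sweep_spec (K := 40) (n := n) (by simpa using hn) (by simpa using hrow) rfl rfl rfl rfl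
    rfl (fun i s' => s'.realReg 0 = s.realReg 0 ∧ s'.realArr 0 = s.realArr 0 ∧
      s'.realArr 2 = s.realArr 2 ∧
      ((s'.natReg 13 = 0 ∧ ∀ j < i, s.realArr 2 j ≤ s.realReg 0 * s.realArr 0 j) ∨
      (s'.natReg 13 ≠ 0 ∧ ∃ u < n, ∃ v < n, s'.natReg 11 = u ∧ s'.natReg 12 = v ∧
        s'.realReg 2 = s.realArr 0 (u * n + v) ∧
        s.realReg 0 * s.realArr 0 (u * n + v) < s.realArr 2 (u * n + v) ∧
        ∀ j < i, s.realReg 0 * s.realArr 0 j < s.realArr 2 j →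
          s.realArr 0 (u * n + v) ≤ s.realArr 0 j))) ?_ ?_ ?_).conseq ?_
  · intro i s₁ x v h hx hx'
    have e11 : 11 ≠ x := by omega
    have e12 : 12 ≠ x := by omega
    have e13 : 13 ≠ x := by omega
    simpa [e11, e12, e13] using h
  · simp
  · rintro s₁ c₁ u v hu hv r8 r9 r10 - ⟨r0, k0, k2, hcase⟩
    rw [inspect, WP_ite]
    refine ⟨fun hb => ?_, fun hb => ?_⟩
    · simp [r0, k0, k2, r10] at hb
      simp [r0, k0, k2, r8, r9, r10]
      refine ⟨hu, hv, hb.1, fun j hj hviol => ?_⟩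
      rcases Nat.lt_or_eq_of_le hj with hj | hj
      · have hj' : j < u * n + v := by omega
        rcases hcase with ⟨-, h2⟩ | ⟨h1, u', -, v', -, -, -, h2, -, h3⟩
        · exact absurd hviol (not_lt.2 (h2 j hj'))
        · rcases hb.2 with hb | hb
          · exact absurd hb h1
          · rw [h2] at hb
            exact hb.le.trans (h3 j hj' hviol)
      · have : j = u * n + v := by omega
        rw [this]
    · simp only [BExpr.Holds, RExpr.eval, NExpr.eval, r0, k0, k2, r10, not_and_or, not_or] at hb
      simp only [WP_skip]
      refine ⟨by simp, r0, k0, k2, ?_⟩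
      rcases hcase with ⟨h1, h2⟩ | ⟨h1, u', hu', v', hv', h4, h5, h2, h6, h3⟩
      · refine Or.inl ⟨h1, fun j hj => ?_⟩
        rcases Nat.lt_or_eq_of_le (Nat.le_of_lt_succ hj) with hj | rfl
        · exact h2 j hj
        · rcases hb with hb | hb
          · exact not_lt.1 hb
          · exact absurd h1 hb.1
      · refine Or.inr ⟨h1, u', hu', v', hv', h4, h5, h2, h6, fun j hj hviol => ?_⟩
        rcases Nat.lt_or_eq_of_le (Nat.le_of_lt_succ hj) with hj | rfl
        · exact h3 j hj hviol
        · rcases hb with hb | hb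
          · exact absurd hviol hb
          · rw [h2] at hb
            exact not_lt.1 hb.2
  · rintro s₁ c₁ - ⟨hc, -, -, -, hcase⟩
    rw [WP_block_nil]
    simp only [NExpr.cost] at hc
    exact ⟨by omega, hcase⟩

/-- Improve an entry of the distance matrix by going through the new edge. -/
def improve : Prog := .block [
  .setReal 3 (.add (.add (.arr 2 (.add (.arr 2 (.reg 8)) (.reg 11))) (.reg 2))
    (.arr 2 (.add (.arr 2 (.reg 12)) (.reg 9)))),
  .ite (.realLT (.reg 3) (.arr 2 (.reg 10))) (.storeReal 2 (.reg 10) (.reg 3)) .skip,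
  .setReal 3 (.add (.add (.arr 2 (.add (.arr 2 (.reg 8)) (.reg 12))) (.reg 2))
    (.arr 2 (.add (.arr 2 (.reg 11)) (.reg 9)))),
  .ite (.realLT (.reg 3) (.arr 2 (.reg 10))) (.storeReal 2 (.reg 10) (.reg 3)) .skip]

variable {n : ℕ} {M : Type*} [MetricSpace M] {p : Fin n → M} {B : ℝ}

theorem pair_inj {x y a b : ℕ} (hy : y < n) (hb : b < n) (h : x * n + y = a * n + b) :
    x = a ∧ y = b := by
  have hn : 0 < n := by omega
  have h1 : (x * n + y) / n = x := by
    rw [mul_comm, Nat.mul_add_div hn, Nat.div_eq_of_lt hy, add_zero]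
  have h2 : (a * n + b) / n = a := by
    rw [mul_comm, Nat.mul_add_div hn, Nat.div_eq_of_lt hb, add_zero]
  have h3 : x = a := by rw [← h1, h, h2]
  subst h3
  exact ⟨rfl, by omega⟩

/-- Replacing an entry of `D` by a smaller one keeps lower bounds for the matrix. -/
theorem update_min_bounds {L : Fin n → Fin n → ℝ} {D : ℕ → ℝ} {x y : Fin n} {r : ℝ}
    (hL : ∀ a b : Fin n, L a b ≤ D (a * n + b)) (hr : L x y ≤ r) (a b : Fin n) :
    L a b ≤ update D (x * n + y) r (a * n + b) := by
  by_cases h : (a : ℕ) * n + b = x * n + y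
  · obtain ⟨h1, h2⟩ := pair_inj b.2 y.2 h
    obtain rfl := Fin.ext h1
    obtain rfl := Fin.ext h2
    simpa using hr
  · rw [update_of_ne h]; exact hL a b

theorem improve_spec {s : State} {c : ℕ} {H : SimpleGraph (Fin n)} {u v x y : Fin n}
    (huv : u ≠ v) (r8 : s.natReg 8 = x) (r9 : s.natReg 9 = y) (r10 : s.natReg 10 = x * n + y)
    (r11 : s.natReg 11 = u) (r12 : s.natReg 12 = v) (hrow : ∀ i ≤ n, s.natArr 2 i = i * n)
    (hw : s.realReg 2 = dist (p u) (p v))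
    (hlow : ∀ a b : Fin n, truncDist (augment H {(u, v)}) p B a b ≤ s.realArr 2 (a * n + b))
    (hup : ∀ a b : Fin n, s.realArr 2 (a * n + b) ≤ truncDist H p B a b) :
    WP improve (fun s' c' => c' ≤ c + 80 ∧
      (∀ i, s'.realArr 2 i ≤ s.realArr 2 i) ∧
      (∀ a b : Fin n, truncDist (augment H {(u, v)}) p B a b ≤ s'.realArr 2 (a * n + b)) ∧
      s'.realArr 2 (x * n + y) = truncDist (augment H {(u, v)}) p B x y) s c := by
  have hadj : (augment H {(u, v)}).Adj u v := augment_adj.2 (Or.inr ⟨huv, by simp⟩)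
  have hd := truncDist_le_of_adj (p := p) (B := B) hadj
  set T' := truncDist (augment H {(u, v)}) p B with hT'
  have htri : ∀ a b c, T' a c ≤ T' a b + T' b c := fun a b c => truncDist_triangle
  have hcomm : T' v u = T' u v := truncDist_comm
  set w := dist (p u) (p v) with hw'
  have hx := hrow x x.2.le
  have hv := hrow v v.2.le
  have hu := hrow u u.2.le
  -- any matrix between the bounds gives admissible candidates
  have cand1 : ∀ D : ℕ → ℝ, (∀ a b : Fin n, T' a b ≤ D (a * n + b)) →
      T' x y ≤ D (x * n + u) + w + D (v * n + y) := fun D hD => by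
    linarith [hD x u, hD v y, htri x u y, htri u v y]
  have cand2 : ∀ D : ℕ → ℝ, (∀ a b : Fin n, T' a b ≤ D (a * n + b)) →
      T' x y ≤ D (x * n + v) + w + D (u * n + y) := fun D hD => by
    linarith [hD x v, hD u y, htri x v y, htri v u y]
  -- The matrix is overwritten in place, so the entries read may be old or new. In either case they
  -- lie between the new and the old distances: candidates never fall below the new distance, and
  -- never exceed those in the formula for it.
  have final : ∀ D : ℕ → ℝ, (∀ a b : Fin n, T' a b ≤ D (a * n + b)) →
      D (x * n + y) ≤ s.realArr 2 (x * n + y) →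
      D (x * n + y) ≤ truncDist H p B x u + w + truncDist H p B v y →
      D (x * n + y) ≤ truncDist H p B x v + w + truncDist H p B u y →
      D (x * n + y) = T' x y := fun D hD h1 h2 h3 => by
    refine le_antisymm ?_ (hD x y)
    rw [hT', truncDist_augment huv]
    exact le_min (h1.trans (hup x y)) (le_min h2 h3)
  have e1 := hup x u
  have e2 := hup v y
  have e3 := hup x v
  have e4 := hup u y
  have mono : ∀ {D : ℕ → ℝ} {i : ℕ} {r : ℝ}, (∀ j, D j ≤ s.realArr 2 j) → r < D i →
      ∀ j, update D i r j ≤ s.realArr 2 j := fun {D i r} hD hr j => by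
    by_cases h : j = i
    · subst h; rw [update_self]; exact hr.le.trans (hD j)
    · rw [update_of_ne h]; exact hD j
  simp only [improve, WP_block_cons, WP_block_nil, WP_setReal, WP_ite, WP_storeReal, WP_skip]
  refine ⟨fun hb => ⟨fun hb2 => ?_, fun hb2 => ?_⟩, fun hb => ⟨fun hb2 => ?_, fun hb2 => ?_⟩⟩
  · simp [r8, r9, r10, r11, r12, hx, hv, hu, hw] at hb hb2 ⊢
    have l1 := update_min_bounds hlow (cand1 _ hlow)
    have l2 := update_min_bounds l1 (cand2 _ l1)
    have m1 := mono (fun _ => le_rfl) hb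
    have m2 := mono (i := x * n + y) m1 (by simpa using hb2)
    rw [update_idem] at l2 m2
    refine ⟨m2, l2, ?_⟩
    have := final _ l2 (m2 _) ?_ ?_
    · simpa using this
    · rw [update_self]; exact hb2.le.trans (by linarith)
    · rw [update_self]; linarith [m1 (x * n + v), m1 (u * n + y)]
  · simp [r8, r9, r10, r11, r12, hx, hv, hu, hw] at hb hb2 ⊢
    have l1 := update_min_bounds hlow (cand1 _ hlow)
    have m1 := mono (fun _ => le_rfl) hb
    refine ⟨m1, l1, ?_⟩
    have := final _ l1 (m1 _) ?_ ?_
    · simpa using this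
    · rw [update_self]; linarith
    · rw [update_self]; linarith [m1 (x * n + v), m1 (u * n + y)]
  · simp [r8, r9, r10, r11, r12, hx, hv, hu, hw] at hb hb2 ⊢
    have l1 := update_min_bounds hlow (cand2 _ hlow)
    have m1 := mono (fun _ => le_rfl) hb2
    refine ⟨m1, l1, ?_⟩
    have := final _ l1 (m1 _) ?_ ?_
    · simpa using this
    · rw [update_self]; linarith
    · rw [update_self]; linarith
  · simp [r8, r9, r10, r11, r12, hx, hv, hu, hw] at hb hb2 ⊢
    exact ⟨hlow, final _ hlow le_rfl (by linarith) (by linarith)⟩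

/-- Update the distance matrix after the insertion of an edge. -/
def insertEdge : Prog := sweep improve

theorem insertEdge_spec {s : State} {c : ℕ} {H : SimpleGraph (Fin n)} {u v : Fin n}
    (huv : u ≠ v) (hn : s.natReg 1 = n)
    (r11 : s.natReg 11 = u) (r12 : s.natReg 12 = v) (hrow : ∀ i ≤ n, s.natArr 2 i = i * n)
    (hw : s.realReg 2 = dist (p u) (p v))
    (hD : ∀ a b : Fin n, s.realArr 2 (a * n + b) = truncDist H p B a b) :
    WP insertEdge (fun s' c' => c' ≤ c + 110 * (n * n) + 20 ∧
      ∀ a b : Fin n, s'.realArr 2 (a * n + b) = truncDist (augment H {(u, v)}) p B a b) s c := by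
  refine (sweep_spec (K := 80) hn (hrow n le_rfl) rfl rfl rfl rfl rfl
    (fun i s' => s'.natReg 11 = u ∧ s'.natReg 12 = v ∧ s'.realReg 2 = dist (p u) (p v) ∧
      (∀ a b : Fin n, truncDist (augment H {(u, v)}) p B a b ≤ s'.realArr 2 (a * n + b)) ∧
      (∀ a b : Fin n, s'.realArr 2 (a * n + b) ≤ truncDist H p B a b) ∧
      ∀ a b : Fin n, (a : ℕ) * n + b < i →
        s'.realArr 2 (a * n + b) = truncDist (augment H {(u, v)}) p B a b) ?_ ?_ ?_).conseq ?_
  · intro i s₁ x v h hx hx'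
    have e11 : 11 ≠ x := by omega
    have e12 : 12 ≠ x := by omega
    simpa [e11, e12] using h
  · exact ⟨r11, r12, hw, fun a b => (truncDist_anti (le_augment _)).trans_eq (hD a b).symm,
      fun a b => (hD a b).le, by simp⟩
  · rintro s₁ c₁ x y hx hy q8 q9 q10 a2 ⟨q11, q12, q2, hlow, hup, hdone⟩
    refine (improve_spec (x := ⟨x, hx⟩) (y := ⟨y, hy⟩) huv q8 q9 q10 q11 q12 (by simpa [a2] using hrow)
      q2 hlow hup).conseq ?_
    rintro s₂ c₂ fr ⟨hc, hle, hlow₂, hxy⟩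
    refine ⟨hc, (fr.natReg 11 rfl).trans q11, (fr.natReg 12 rfl).trans q12,
      (fr.realReg 2 rfl).trans q2, hlow₂, fun a b => (hle _).trans (hup a b), fun a b hab => ?_⟩
    rcases Nat.lt_or_eq_of_le (Nat.le_of_lt_succ hab) with h | h
    · exact le_antisymm ((hle _).trans_eq (hdone a b h)) (hlow₂ a b)
    · obtain ⟨h1, h2⟩ := pair_inj b.2 hy h
      obtain rfl : a = ⟨x, hx⟩ := Fin.ext h1
      obtain rfl : b = ⟨y, hy⟩ := Fin.ext h2
      exact hxy
  · rintro s₁ c₁ - ⟨hc, -, -, -, -, -, h⟩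
    exact ⟨hc, fun a b => h a b (mul_add_lt a.2 b.2)⟩

/-- Add up to `k` edges greedily, and write the answer into register `0`. -/
def greedy : Prog := .block [
  .setNat 7 (.lit 0),
  .setNat 14 (.lit 1),
  .while (.natEq (.reg 14) (.lit 1)) (.block [
    scan,
    .ite (.natEq (.reg 13) (.lit 0))
      (.block [.setNat 0 (.lit 1), .setNat 14 (.lit 0)])
      (.ite (.natLT (.reg 7) (.reg 3))
        (.block [insertEdge, .setNat 7 (.add (.reg 7) (.lit 1))])
        (.block [.setNat 0 (.lit 0), .setNat 14 (.lit 0)]))])]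

theorem greedy_spec {s : State} {c k : ℕ} {t : ℝ} {G : SimpleGraph (Fin n)} (ht : 1 ≤ t)
    (hn : s.natReg 1 = n) (hk : s.natReg 3 = k) (hrow : ∀ i ≤ n, s.natArr 2 i = i * n)
    (hst : s.realReg 0 = t)
    (hd : ∀ a b : Fin n, s.realArr 0 (a * n + b) = dist (p a) (p b))
    (hB : ∀ a b, t * dist (p a) (p b) < B)
    (hD : ∀ a b : Fin n, s.realArr 2 (a * n + b) = truncDist G p B a b) :
    WP greedy (fun s' c' => c' ≤ c + k * (280 * (n * n)) + 180 * (n * n) + 120 ∧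
      ((s'.natReg 0 = 1 ∧ ∃ i ≤ k, ∃ H, GreedyRun p t G i H ∧ ∀ e, ¬ IsViolating H p t e) ∨
        (s'.natReg 0 = 0 ∧ ∃ H, GreedyRun p t G (k + 1) H))) s c := by
  rw [greedy, WP_block_cons, WP_setNat, WP_block_cons, WP_setNat, WP_block_cons]
  refine WP.while (fun s' c' => s'.natReg 7 ≤ k ∧
      ((s'.natReg 14 = 1 ∧ c' ≤ c + s'.natReg 7 * (280 * (n * n)) + 5 ∧
        ∃ H, GreedyRun p t G (s'.natReg 7) H ∧
        ∀ a b : Fin n, s'.realArr 2 (a * n + b) = truncDist H p B a b) ∨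
      (s'.natReg 14 = 0 ∧ c' ≤ c + k * (280 * (n * n)) + 180 * (n * n) + 105 ∧
        ((s'.natReg 0 = 1 ∧ ∃ i ≤ k, ∃ H, GreedyRun p t G i H ∧ ∀ e, ¬ IsViolating H p t e) ∨
        (s'.natReg 0 = 0 ∧ ∃ H, GreedyRun p t G (k + 1) H)))))
    -- Register 14 says whether the loop is to continue. While it does, the number of inserted edges
    -- grows up to `k`; when it is cleared the variant drops to 0.
    (fun s' => if s'.natReg 14 = 1 then k + 1 - s'.natReg 7 else 0) ?_ ?_ ?_
  · exact ⟨by simp, Or.inl ⟨by simp, by simp, G, by simpa using GreedyRun.start, by simpa using hD⟩⟩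
  · rintro s₁ c₁ fr ⟨h7, hor⟩ hb
    have e1 := fr.natReg 1 rfl
    have e3 := fr.natReg 3 rfl
    have a2 := fr.natArr 2 rfl
    have r0 := fr.realReg 0 rfl
    have k0 := fr.realArr 0 rfl
    simp [hn, hk, hst] at e1 e3 a2 r0 k0
    simp only [BExpr.Holds, NExpr.eval] at hb
    rcases hor with ⟨-, hc, H, hrun, hH⟩ | ⟨h, -⟩
    swap
    · omega
    rw [WP_block_cons]
    refine (scan_spec e1 (by rw [a2]; exact hrow n le_rfl)).conseq ?_
    rintro s₂ c₂ fr₂ ⟨hc₂, hcase⟩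
    have q0 := fr₂.natReg 1 rfl
    have q3 := fr₂.natReg 3 rfl
    have q7 := fr₂.natReg 7 rfl
    have q14 := fr₂.natReg 14 rfl
    have qa2 := fr₂.natArr 2 rfl
    have qk2 := fr₂.realArr 2 rfl
    rw [r0, k0] at hcase
    simp only [BExpr.cost, NExpr.cost] at hc₂
    have hmul : (s₁.natReg 7 + 1) * (280 * (n * n)) =
      s₁.natReg 7 * (280 * (n * n)) + 280 * (n * n) := by ring
    have hmul' : s₁.natReg 7 * (280 * (n * n)) ≤ k * (280 * (n * n)) :=
      Nat.mul_le_mul_right _ h7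
    have hviol : ∀ e : Fin n × Fin n, IsViolating H p t e ↔
        t * s.realArr 0 (e.1 * n + e.2) < s₁.realArr 2 (e.1 * n + e.2) := fun e => by
      rw [isViolating_iff (by linarith) (hB _ _), hd, hH]
    rw [WP_block_cons, WP_ite]
    refine ⟨fun hb1 => ?_, fun hb1 => ?_⟩
    · simp only [BExpr.Holds, NExpr.eval] at hb1
      rcases hcase with ⟨-, hno⟩ | ⟨h, -⟩
      swap
      · exact absurd hb1 h
      simp only [WP_block_cons, WP_block_nil, WP_setNat]
      refine ⟨⟨by simp [q7, h7], Or.inr ⟨by simp, by simp; omega, Or.inl ⟨by simp, s₁.natReg 7, h7,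
        H, hrun, fun e he => ?_⟩⟩⟩, ?_⟩
      · exact absurd ((hviol e).1 he) (not_lt.2 (hno _ (mul_add_lt e.1.2 e.2.2)))
      · simp [hb]; omega
    · simp only [BExpr.Holds, NExpr.eval] at hb1
      rcases hcase with ⟨h, -⟩ | ⟨-, u, hu, v, hv, q11, q12, q2, huv, hmin⟩
      · exact absurd h hb1
      have hviol' : IsViolating H p t (⟨u, hu⟩, ⟨v, hv⟩) := (hviol _).2 huv
      -- Scanning and inserting take 70 + 110 times n² steps up to additive constants. Since n² is
      -- positive here, the remaining 100n² of the budget absorb these constants.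
      have hpos : 0 < n * n := Nat.mul_pos (by omega) (by omega)
      have hne : (⟨u, hu⟩ : Fin n) ≠ ⟨v, hv⟩ := fun h => by
        rw [h] at hviol'
        simp [IsViolating] at hviol'
      have hgreedy : IsGreedyEdge H p t (⟨u, hu⟩, ⟨v, hv⟩) := by
        refine ⟨hviol', fun f hf => ?_⟩
        have := hmin _ (mul_add_lt f.1.2 f.2.2) ((hviol f).1 hf)
        have h1 := hd ⟨u, hu⟩ ⟨v, hv⟩
        simp only at h1
        rwa [h1, hd] at this
      have hrun' := hrun.step hgreedy
      rw [WP_ite]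
      refine ⟨fun hb2 => ?_, fun hb2 => ?_⟩
      · simp only [BExpr.Holds, NExpr.eval, q7, q3, e3] at hb2
        rw [WP_block_cons]
        refine (insertEdge_spec (p := p) (B := B) (H := H) hne (q0.trans e1) q11 q12
          (by simpa [qa2, a2] using hrow) ?_ (by simpa [qk2] using hH)).conseq ?_
        · rw [q2]; exact hd ⟨u, hu⟩ ⟨v, hv⟩
        rintro s₃ c₃ fr₃ ⟨hc₃, hH'⟩
        have p7 := fr₃.natReg 7 rfl
        have p14 := fr₃.natReg 14 rfl
        rw [WP_block_cons, WP_setNat, WP_block_nil, WP_block_nil]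
        simp only [BExpr.cost, NExpr.cost] at hc₃
        refine ⟨⟨by simp [p7, q7]; omega, Or.inl ⟨by simp [p14, q14, hb], ?_,
          augment H {(⟨u, hu⟩, ⟨v, hv⟩)}, ?_, ?_⟩⟩, ?_⟩
        · simp [p7, q7, hmul]; omega
        · simpa [p7, q7] using hrun'
        · simpa using hH'
        · simp [p14, q14, hb, p7, q7]; omega
      · simp only [BExpr.Holds, NExpr.eval, q7, q3, e3] at hb2
        have h7k : s₁.natReg 7 = k := by omega
        simp only [WP_block_cons, WP_block_nil, WP_setNat]
        -- The (k+1)st greedy edge exists, which justifies NO; it need not be inserted into the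
        -- matrix.
        refine ⟨⟨by simp [q7, h7], Or.inr ⟨by simp, by simp; omega, Or.inr ⟨by simp,
          augment H {(⟨u, hu⟩, ⟨v, hv⟩)}, ?_⟩⟩⟩, ?_⟩
        · rwa [h7k] at hrun'
        · simp [hb]; omega
  · rintro s₁ c₁ fr ⟨h7, hor⟩ hb
    simp only [BExpr.Holds, NExpr.eval] at hb
    rcases hor with ⟨h, -⟩ | ⟨-, hc, hres⟩
    · exact absurd h hb
    · rw [WP_block_nil]
      exact ⟨by simp; omega, hres⟩

end Greedy

end Dilation

namespace Dilation

section Approximation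

open Finset

/-! ### The quality of the greedy construction -/

variable {n : ℕ} {M : Type*} [MetricSpace M] {G H K : SimpleGraph (Fin n)} {p : Fin n → M}
  {u v : Fin n} {t : ℝ} {k : ℕ}

theorem one_le_dilation : 1 ≤ dilation G p := le_sInf fun _ h => h.1

theorem one_le_minDilation : 1 ≤ minDilation G p k := le_iInf₂ fun _ _ => one_le_dilation

theorem graphDist_le_dilation_mul (hp : Function.Injective p) (u v : Fin n) :
    graphDist G p u v ≤ dilation G p * edist (p u) (p v) := by
  by_cases huv : u = v
  · simp [huv]
  have h0 : edist (p u) (p v) ≠ 0 := fun h => huv (hp (edist_eq_zero.1 h))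
  rw [← ENNReal.div_le_iff h0 (edist_ne_top _ _)]
  refine le_sInf fun τ hτ => ?_
  rw [ENNReal.div_le_iff h0 (edist_ne_top _ _)]
  exact hτ.2 u v

theorem IsViolating.ne {e : Fin n × Fin n} (h : IsViolating G p t e) : e.1 ≠ e.2 := fun he => by
  simp [IsViolating, he] at h

theorem IsViolating.anti {e : Fin n × Fin n} (hGH : G ≤ H) (h : IsViolating H p t e) :
    IsViolating G p t e :=
  lt_of_lt_of_le h (graphDist_anti hGH)

/-- Only an upper bound for the cardinality is needed, since the set will be padded. -/
theorem GreedyRun.exists_augment {i : ℕ} (h : GreedyRun p t G i H) :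
    ∃ S : Finset (Fin n × Fin n), S.card ≤ i ∧ H ≤ augment G S := by
  classical
  induction h with
  | start => exact ⟨∅, by simp, le_augment _⟩
  | @step i H e _ _ ih =>
    obtain ⟨S, hS, hle⟩ := ih
    refine ⟨insert e S, (card_insert_le _ _).trans (by omega), fun a b hab => ?_⟩
    rcases augment_adj.1 hab with h | ⟨hne, h⟩
    · rcases augment_adj.1 (hle h) with h | ⟨hne, h⟩
      · exact augment_adj.2 (Or.inl h)
      · exact augment_adj.2 (Or.inr ⟨hne, h.imp (mem_insert_of_mem ·) (mem_insert_of_mem ·)⟩)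
    · refine augment_adj.2 (Or.inr ⟨hne, h.imp (fun h => ?_) (fun h => ?_)⟩) <;>
      · rw [mem_singleton.1 h]; exact mem_insert_self _ _

theorem augment_mono {S T : Finset (Fin n × Fin n)} (h : S ⊆ T) : augment G S ≤ augment G T := by
  intro a b hab
  rcases augment_adj.1 hab with h' | ⟨hne, h'⟩
  · exact augment_adj.2 (Or.inl h')
  · exact augment_adj.2 (Or.inr ⟨hne, h'.imp (@h _) (@h _)⟩)

/-- If the greedy construction stops after at most `k` steps, it yields a good set of edges. -/
theorem minDilation_le_of_greedyRun {i : ℕ} (ht : 1 ≤ t) (hk : k ≤ n ^ 2) (hi : i ≤ k)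
    (h : GreedyRun p t G i H) (hH : ∀ e, ¬ IsViolating H p t e) :
    minDilation G p k ≤ ENNReal.ofReal t := by
  obtain ⟨S, hS, hle⟩ := h.exists_augment
  -- Padding to exactly `k` pairs is possible because `k` is at most the number n² of all pairs, and
  -- additional edges only shorten distances.
  obtain ⟨T, hST, hT⟩ := exists_superset_card_eq (hS.trans hi)
    (hk.trans_eq (by simp [sq] : n ^ 2 = Fintype.card (Fin n × Fin n)))
  refine (iInf₂_le T hT).trans (sInf_le ⟨?_, fun u v => ?_⟩)
  · simpa using ENNReal.ofReal_le_ofReal ht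
  · exact (graphDist_anti (hle.trans (augment_mono hST))).trans (not_lt.1 (hH (u, v)))

/-- The graphs and the edges that the greedy construction goes through. -/
theorem GreedyRun.exists_seq [Nonempty (Fin n)] {i : ℕ} (h : GreedyRun p t G i H) :
    ∃ (K : ℕ → SimpleGraph (Fin n)) (a : ℕ → Fin n × Fin n),
      (∀ j < i, G ≤ K j ∧ IsGreedyEdge (K j) p t (a j)) ∧
      (∀ j < i, ∀ l < j, K l ≤ K j ∧ (K j).Adj (a l).1 (a l).2) ∧
      G ≤ H ∧ ∀ l < i, K l ≤ H ∧ H.Adj (a l).1 (a l).2 := by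
  induction h with
  | start => exact ⟨fun _ => G, fun _ => Classical.arbitrary _, by simp, by simp, le_rfl, by simp⟩
  | @step i H e _ he ih =>
    obtain ⟨K, a, h1, h2, h3, h4⟩ := ih
    refine ⟨fun j => if j < i then K j else H, fun j => if j < i then a j else e, ?_, ?_,
      h3.trans (le_augment _), ?_⟩
    · intro j hj
      by_cases hji : j < i
      · simpa [hji] using h1 j hji
      · simpa [hji] using ⟨h3, he⟩
    · intro j hj l hl
      have hli : l < i := by omega
      by_cases hji : j < i
      · simpa [hji, hli] using h2 j hji l hl
      · simpa [hji, hli] using h4 l hli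
    · intro l hl
      by_cases hli : l < i
      · have := h4 l hli
        simpa [hli] using ⟨this.1.trans (le_augment _), le_augment _ this.2⟩
      · simpa [hli] using ⟨le_augment _, augment_adj.2 (Or.inr ⟨he.1.ne, by simp⟩)⟩

/-- The length of an edge. -/
noncomputable def weight (p : Fin n → M) (e : Sym2 (Fin n)) : ℝ :=
  e.lift ⟨fun a b => dist (p a) (p b), fun _ _ => dist_comm _ _⟩

@[simp] theorem weight_mk (a b : Fin n) : weight p s(a, b) = dist (p a) (p b) := rfl

theorem weight_nonneg (e : Sym2 (Fin n)) : 0 ≤ weight p e := by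
  induction e with
  | h a b => exact dist_nonneg

theorem walkLength_eq (q : G.Walk u v) :
    walkLength p q = ENNReal.ofReal (q.edges.map (weight p)).sum := by
  induction q with
  | nil => simp
  | cons h q ih =>
    rw [walkLength_cons, ih, edist_dist, ← ENNReal.ofReal_add dist_nonneg]
    · simp
    · exact List.sum_nonneg fun x hx => by
        obtain ⟨e, -, rfl⟩ := List.mem_map.1 hx
        exact weight_nonneg e

/-- There are finitely many paths and shortcutting a walk does not lengthen it, so the infimum is
attained by a path. Paths are needed since their edges are distinct, so that edge lists may be
treated as sets. -/
theorem exists_isPath_walkLength_le (h : graphDist G p u v ≠ ⊤) :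
    ∃ q : G.Walk u v, q.IsPath ∧ walkLength p q ≤ graphDist G p u v := by
  classical
  have hne : Nonempty (G.Walk u v) := by
    by_contra hc
    rw [not_nonempty_iff] at hc
    exact h (iInf_of_empty _)
  obtain ⟨q₀⟩ := hne
  have : Nonempty (G.Path u v) := ⟨q₀.toPath⟩
  obtain ⟨q, hq⟩ := Finite.exists_min fun q : G.Path u v => walkLength p q.1
  refine ⟨q.1, q.2, le_iInf fun r => (hq r.toPath).trans ?_⟩
  exact (r.darts_bypass_sublist_darts.map _).sum_le_sum fun _ _ => zero_le

/-- Replacing the edges of a walk by walks in `K`. -/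
theorem graphDist_le_sum_edges {φ : Sym2 (Fin n) → ℝ} (hφ : ∀ e, 0 ≤ φ e) (q : G.Walk u v)
    (h : ∀ a b, s(a, b) ∈ q.edges → graphDist K p a b ≤ ENNReal.ofReal (φ s(a, b))) :
    graphDist K p u v ≤ ENNReal.ofReal (q.edges.map φ).sum := by
  induction q with
  | nil => simp
  | cons hadj q ih =>
    have h0 : 0 ≤ (q.edges.map φ).sum := List.sum_nonneg fun x hx => by
      obtain ⟨e, -, rfl⟩ := List.mem_map.1 hx
      exact hφ e
    rw [SimpleGraph.Walk.edges_cons, List.map_cons, List.sum_cons, ENNReal.ofReal_add (hφ _) h0]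
    refine graphDist_triangle.trans (add_le_add (h _ _ (by simp)) (ih fun a b hab => h a b ?_))
    simp [hab]

theorem sum_edges_eq {A : Type*} [AddCommMonoid A] (φ : Sym2 (Fin n) → A) {q : G.Walk u v}
    (hq : q.IsPath) : (q.edges.map φ).sum = ∑ e ∈ q.edges.toFinset, φ e :=
  (List.sum_toFinset φ hq.isTrail.edges_nodup).symm

/-- The mod 2 coboundary of a function on the vertices. -/
def coboundary (f : Fin n → ZMod 2) (e : Sym2 (Fin n)) : ZMod 2 :=
  e.lift ⟨fun a b => f a + f b, fun _ _ => add_comm _ _⟩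

theorem sum_coboundary (f : Fin n → ZMod 2) (q : G.Walk u v) :
    (q.edges.map (coboundary f)).sum = f u + f v := by
  induction q with
  | nil => simp [CharTwo.add_self_eq_zero]
  | @cons a b c h q ih =>
    rw [SimpleGraph.Walk.edges_cons, List.map_cons, List.sum_cons, ih]
    change f a + f b + (f b + f c) = f a + f c
    rw [add_assoc, ← add_assoc (f b), CharTwo.add_self_eq_zero, zero_add]

/-- Among `k + 1` subsets of a set with at most `k` elements, some have an empty symmetric
difference. -/
theorem exists_dependent_sets {α : Type*} [DecidableEq α] {T : Finset α} (hT : T.card ≤ k)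
    (V : Fin (k + 1) → Finset α) (hV : ∀ i, V i ⊆ T) :
    ∃ I : Finset (Fin (k + 1)), I.Nonempty ∧
      ∀ h : α → ZMod 2, ∑ i ∈ I, ∑ e ∈ V i, h e = 0 := by
  -- The characteristic vectors of the `k + 1` sets live in a space of dimension at most `k` over
  -- 𝔽₂, where the nonzero coefficients of a relation are all 1.
  have hdep : ¬ LinearIndependent (ZMod 2)
      fun (i : Fin (k + 1)) (e : T) => if (e : α) ∈ V i then (1 : ZMod 2) else 0 := fun h => by
    have := h.fintype_card_le_finrank
    simp at this
    omega
  rw [Fintype.not_linearIndependent_iff] at hdep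
  obtain ⟨g, hg, i, hi⟩ := hdep
  refine ⟨univ.filter fun i => g i ≠ 0, ⟨i, by simpa using hi⟩, fun h => ?_⟩
  have hg1 : ∀ i, g i ≠ 0 → g i = 1 := by
    intro i; generalize g i = x; revert x; decide
  have hsum : ∀ i, ∑ e ∈ V i, h e = ∑ e : T, (if (e : α) ∈ V i then (1 : ZMod 2) else 0) * h e :=
    fun i => by
      rw [sum_coe_sort T fun e => (if e ∈ V i then (1 : ZMod 2) else 0) * h e]
      simp [inter_eq_right.2 (hV i)]
  calc ∑ i ∈ univ.filter fun i => g i ≠ 0, ∑ e ∈ V i, h e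
      = ∑ i, g i * ∑ e ∈ V i, h e := by
        rw [sum_filter]
        refine sum_congr rfl fun i _ => ?_
        split_ifs with hgi
        · rw [hg1 i hgi, one_mul]
        · rw [not_not.1 hgi, zero_mul]
    _ = ∑ e : T, (∑ i, g i * if (e : α) ∈ V i then (1 : ZMod 2) else 0) * h e := by
        simp only [hsum, mul_sum, sum_mul, mul_assoc]
        exact sum_comm
    _ = 0 := sum_eq_zero fun e _ => by
        have := congrFun hg e
        simp only [Finset.sum_apply, Pi.smul_apply, smul_eq_mul, Pi.zero_apply] at this
        rw [this, zero_mul]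

theorem sum_union_le {α : Type*} [DecidableEq α] {φ : α → ℝ} (hφ : ∀ a, 0 ≤ φ a)
    (s r : Finset α) : ∑ a ∈ s ∪ r, φ a ≤ ∑ a ∈ s, φ a + ∑ a ∈ r, φ a := by
  rw [← sum_union_inter]
  exact le_add_of_nonneg_right (sum_nonneg fun a _ => hφ a)

theorem sum_biUnion_le {α ι : Type*} [DecidableEq α] {φ : α → ℝ} (hφ : ∀ a, 0 ≤ φ a)
    (I : Finset ι) (A : ι → Finset α) : ∑ a ∈ I.biUnion A, φ a ≤ ∑ i ∈ I, ∑ a ∈ A i, φ a := by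
  classical
  induction I using Finset.induction_on with
  | empty => simp
  | insert i I hi ih =>
    rw [biUnion_insert, sum_insert hi]
    exact (sum_union_le hφ _ _).trans (by gcongr)

/-- A set of edges that connects `u` and `v` bounds their distance. -/
theorem graphDist_le_sum_of_reachable {F : Finset (Sym2 (Fin n))}
    (hF : ∀ a b, s(a, b) ∈ F → a ≠ b → K.Adj a b)
    (h : (SimpleGraph.fromEdgeSet (F : Set (Sym2 (Fin n)))).Reachable u v) :
    graphDist K p u v ≤ ENNReal.ofReal (∑ e ∈ F, weight p e) := by
  classical
  obtain ⟨q, hq⟩ := h.exists_isPath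
  have hsub : ∀ e ∈ q.edges, e ∈ F ∧ e ∈ K.edgeSet := fun e he => by
    have := q.edges_subset_edgeSet he
    induction e with
    | h a b =>
      simp only [SimpleGraph.mem_edgeSet, SimpleGraph.fromEdgeSet_adj, mem_coe] at this
      exact ⟨this.1, hF a b this.1 this.2⟩
  refine (graphDist_le_sum_edges (weight_nonneg (p := p)) q fun a b hab => ?_).trans
    (ENNReal.ofReal_le_ofReal ?_)
  · rw [weight_mk, ← edist_dist]
    exact graphDist_le_of_adj (hsub _ hab).2
  · rw [sum_edges_eq _ hq]
    exact sum_le_sum_of_subset_of_nonneg (fun e he => (hsub e (List.mem_toFinset.1 he)).1)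
      fun e _ _ => weight_nonneg e

end Approximation

end Dilation

namespace Dilation

/-! ### The lower bound for t* when the greedy construction adds k+1 edges. -/

section Approximation

open Finset

variable {n : ℕ} {M : Type*} [MetricSpace M] {G H K : SimpleGraph (Fin n)} {p : Fin n → M}
  {u v : Fin n} {t : ℝ} {k : ℕ}

/-- If the edges outside `G` that occur in the paths `q i`, `i ∈ I`, cancel, then the endpoints of
`q j` are connected by the remaining edges and by the pairs of the other endpoints. -/
theorem reachable_of_dependent {ι : Type*} [DecidableEq ι] {I : Finset ι} {j : ι} (hj : j ∈ I)
    {a : ι → Fin n × Fin n} (q : ∀ i, G.Walk (a i).1 (a i).2) (hq : ∀ i, (q i).IsPath)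
    {A V : ι → Finset (Sym2 (Fin n))} (hAV : ∀ i, Disjoint (A i) (V i))
    (hq' : ∀ i, (q i).edges.toFinset = A i ∪ V i)
    (hV : ∀ h : Sym2 (Fin n) → ZMod 2, ∑ i ∈ I, ∑ e ∈ V i, h e = 0) :
    (SimpleGraph.fromEdgeSet ((I.biUnion A ∪ (I.erase j).image fun i => s((a i).1, (a i).2) :
      Finset (Sym2 (Fin n))) : Set (Sym2 (Fin n)))).Reachable (a j).1 (a j).2 := by
  classical
  set F := I.biUnion A ∪ (I.erase j).image fun i => s((a i).1, (a i).2) with hF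
  set R := SimpleGraph.fromEdgeSet (F : Set (Sym2 (Fin n))) with hR
  -- The indicator of the component of one end point of a_j has zero coboundary on `F`. The aim is
  -- to show that it is 1 at the other end point.
  set f : Fin n → ZMod 2 := fun x => if R.Reachable (a j).1 x then 1 else 0 with hf
  have hfF : ∀ x y, s(x, y) ∈ F → f x + f y = 0 := fun x y hxy => by
    by_cases hne : x = y
    · rw [hne, CharTwo.add_self_eq_zero]
    have hadj : R.Adj x y := SimpleGraph.fromEdgeSet_adj _ |>.2 ⟨hxy, hne⟩
    have : R.Reachable (a j).1 x ↔ R.Reachable (a j).1 y :=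
      ⟨fun h => h.trans hadj.reachable, fun h => h.trans hadj.symm.reachable⟩
    have hxy : f x = f y := by simp only [hf, this]
    rw [hxy, CharTwo.add_self_eq_zero]
  have h1 : ∀ i ∈ I, ∑ e ∈ V i, coboundary f e = f (a i).1 + f (a i).2 := fun i hi => by
    rw [← sum_coboundary f (q i), sum_edges_eq _ (hq i), hq', sum_union (hAV i)]
    have : ∑ e ∈ A i, coboundary f e = 0 := sum_eq_zero fun e he => by
      induction e with
      | h x y => exact hfF x y (mem_union_left _ (mem_biUnion.2 ⟨i, hi, he⟩))
    rw [this, zero_add]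
  have h2 : f (a j).1 + f (a j).2 = 0 := by
    -- Along each path the coboundary sums to the values of `f` at the two ends, and only edges of
    -- `V i` contribute. Their total vanishes, and the pairs other than a_j contribute zero, so the
    -- contribution of a_j vanishes too.
    rw [← hV (coboundary f), sum_congr rfl h1, ← add_sum_erase _ _ hj, sum_eq_zero, add_zero]
    exact fun i hi => hfF _ _ (mem_union_right _ (mem_image_of_mem _ hi))
  have h3 : f (a j).1 = 1 := by simp [hf]
  rw [h3] at h2
  by_contra hc
  simp [hf, hc] at h2

/-- With r = ℓ_j/(k+1), the hypotheses give ℓ_i ≤ r + w_i. Hence each of the at most k indices i ≠ j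
contributes g_i + ℓ_i ≤ τℓ_j + r, while g_j ≤ τℓ_j − w_j ≤ τℓ_j − ℓ_j + r. In the total the k + 1
copies of r cancel against ℓ_j; this is where the factor k + 1 of the theorem comes from. -/
theorem sum_le_of_bounds {I : Finset (Fin (k + 1))} {j : Fin (k + 1)} (hj : j ∈ I)
    {ℓ g w : Fin (k + 1) → ℝ} {τ : ℝ} (hτ : 0 < τ) (hℓ : 0 ≤ ℓ j)
    (hw : ∀ i, 0 ≤ w i) (hlen : ∀ i, g i + w i ≤ τ * ℓ i)
    (hA : ∀ i, (k + 1) * τ * ℓ i ≤ g i + (k + 1) * τ * w i) (hmono : ∀ i ∈ I, ℓ i ≤ ℓ j) :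
    ∑ i ∈ I, g i + ∑ i ∈ I.erase j, ℓ i ≤ (k + 1) * τ * ℓ j := by
  have hN : (0 : ℝ) < k + 1 := by positivity
  set r := ℓ j / (k + 1) with hr
  have hr' : (k + 1) * r = ℓ j := by rw [hr]; field_simp
  have hr0 : 0 ≤ r := by positivity
  have key : ∀ i ∈ I, ℓ i ≤ r + w i := fun i hi => by
    have h1 : τ * ℓ i ≤ τ * ℓ j := mul_le_mul_of_nonneg_left (hmono i hi) hτ.le
    have h2 : (k + 1) * τ * ℓ i ≤ (k + 1) * τ * (r + w i) := by
      calc (k + 1) * τ * ℓ i ≤ g i + (k + 1) * τ * w i := hA i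
        _ ≤ τ * ℓ j + (k + 1) * τ * w i := by linarith [hlen i, hw i]
        _ = _ := by rw [← hr']; ring
    exact le_of_mul_le_mul_left h2 (by positivity)
  have h1 : ∀ i ∈ I.erase j, g i + ℓ i ≤ τ * ℓ j + r := fun i hi => by
    have hi' := mem_of_mem_erase hi
    have := mul_le_mul_of_nonneg_left (hmono i hi') hτ.le
    linarith [key i hi', hlen i]
  have h2 : ∑ i ∈ I.erase j, (g i + ℓ i) ≤ k * (τ * ℓ j + r) := by
    refine (sum_le_card_nsmul _ _ _ h1).trans ?_
    rw [nsmul_eq_mul]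
    refine mul_le_mul_of_nonneg_right ?_ (by positivity)
    have hc : (I.erase j).card ≤ k := by
      rw [card_erase_of_mem hj]
      have := card_le_univ I
      simp at this
      omega
    exact_mod_cast hc
  rw [sum_add_distrib] at h2
  rw [← add_sum_erase _ _ hj]
  have h3 := key j hj
  have h4 := hlen j
  have h5 : (k + 1) * τ * ℓ j = k * (τ * ℓ j + r) + τ * ℓ j + (r - (k + 1) * r) := by ring
  rw [hr'] at h5
  linarith

/-- If the greedy construction makes `k + 1` steps, no set of `k` edges is much better. -/
theorem lt_dilation_of_greedyRun (hp : Function.Injective p) (ht : 1 ≤ t)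
    {S : Finset (Fin n × Fin n)} (hS : S.card = k) (h : GreedyRun p t G (k + 1) H) :
    ENNReal.ofReal (t / (k + 1)) < dilation (augment G S) p := by
  classical
  by_contra hle
  rw [not_lt] at hle
  have hN : (0 : ℝ) < k + 1 := by positivity
  set τ := t / (k + 1) with hτ'
  have hτt : (k + 1) * τ = t := by rw [hτ']; field_simp
  have hτ : 0 < τ := by positivity
  have hdist : ∀ x y, graphDist (augment G S) p x y ≤ ENNReal.ofReal (τ * dist (p x) (p y)) :=
    fun x y => by
      rw [ENNReal.ofReal_mul hτ.le, ← edist_dist]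
      exact (graphDist_le_dilation_mul hp x y).trans (by gcongr)
  have hne : Nonempty (Fin n) := by
    cases h with
    | @step _ _ e _ _ => exact ⟨e.1⟩
  obtain ⟨K, a, h1, h2, -, -⟩ := h.exists_seq
  have hpath := fun i : Fin (k + 1) => exists_isPath_walkLength_le (p := p)
    (ne_top_of_le_ne_top ENNReal.ofReal_ne_top (hdist (a i).1 (a i).2))
  choose q hq hqlen using hpath
  set c := fun i => (q i).edges.toFinset with hc
  set A := fun i => (c i).filter (· ∈ G.edgeSet) with hA
  set V := fun i => (c i).filter (· ∉ G.edgeSet) with hV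
  set ℓ : Fin (k + 1) → ℝ := fun i => dist (p (a i).1) (p (a i).2) with hℓ
  have hAV : ∀ i, Disjoint (A i) (V i) := fun i => disjoint_filter_filter_not _ _ _
  have hcAV : ∀ i, c i = A i ∪ V i := fun i => (filter_union_filter_not_eq _ _).symm
  -- A pair that violates later violates earlier too, so it was a competitor when a_i was chosen.
  have hmono : ∀ i j, i ≤ j → ℓ i ≤ ℓ j := fun i j hij => by
    rcases hij.eq_or_lt with rfl | hij
    · exact le_rfl
    · exact (h1 i i.2).2.2 _ ((h1 j j.2).2.1.anti (h2 j j.2 i hij).1)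
  have hw : ∀ i, 0 ≤ ∑ e ∈ V i, weight p e := fun i => sum_nonneg fun e _ => weight_nonneg e
  have hlen : ∀ i, ∑ e ∈ A i, weight p e + ∑ e ∈ V i, weight p e ≤ τ * ℓ i := fun i => by
    have := (hqlen i).trans (hdist _ _)
    rw [walkLength_eq, sum_edges_eq _ (hq i), ENNReal.ofReal_le_ofReal_iff (by positivity)] at this
    rwa [← sum_union (hAV i), ← hcAV]
  have hbound : ∀ i, (k + 1) * τ * ℓ i ≤
      ∑ e ∈ A i, weight p e + (k + 1) * τ * ∑ e ∈ V i, weight p e := fun i => by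
    rw [hτt]
    have hg : 0 ≤ ∑ e ∈ A i, weight p e := sum_nonneg fun e _ => weight_nonneg e
    -- One edge outside `G` that is as long as a_i makes the inequality trivial. Otherwise all these
    -- edges are shorter than a_i.
    by_cases hlong : ∃ e ∈ V i, ℓ i ≤ weight p e
    · obtain ⟨e, he, hle⟩ := hlong
      have := hle.trans (single_le_sum (f := weight p) (fun e _ => weight_nonneg e) he)
      have := mul_le_mul_of_nonneg_left this (by linarith : 0 ≤ t)
      linarith
    push Not at hlong
    set φ : Sym2 (Fin n) → ℝ := fun e => if e ∈ G.edgeSet then weight p e else t * weight p e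
    have hφ : ∀ e, 0 ≤ φ e := fun e => by
      have := weight_nonneg (p := p) e
      simp only [φ]
      split_ifs <;> positivity
    have hub : graphDist (K i) p (a i).1 (a i).2 ≤ ENNReal.ofReal (∑ e ∈ c i, φ e) := by
      rw [← sum_edges_eq φ (hq i)]
      refine graphDist_le_sum_edges hφ (q i) fun x y hxy => ?_
      by_cases hG : s(x, y) ∈ G.edgeSet
      · simp only [φ, if_pos hG, weight_mk, ← edist_dist]
        exact graphDist_le_of_adj ((h1 i i.2).1 hG)
      · simp only [φ, if_neg hG, weight_mk]
        have hlt := hlong s(x, y) (mem_filter.2 ⟨List.mem_toFinset.2 hxy, hG⟩)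
        rw [ENNReal.ofReal_mul (by linarith), ← edist_dist]
        by_contra hviol
        -- A violating pair shorter than a_i would have been preferred to it; so each edge of `V i`
        -- is replaced by a walk at most `t` times as long in the current graph.
        exact absurd ((h1 i i.2).2.2 (x, y) (not_le.1 hviol)) (not_le.2 hlt)
    have hlt := lt_of_lt_of_le (h1 i i.2).2.1 hub
    rw [edist_dist, ← ENNReal.ofReal_mul (by linarith), ENNReal.ofReal_lt_ofReal_iff_of_nonneg
      (by positivity), hcAV, sum_union (hAV i)] at hlt
    have e1 : ∑ e ∈ A i, φ e = ∑ e ∈ A i, weight p e :=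
      sum_congr rfl fun e he => if_pos (mem_filter.1 he).2
    have e2 : ∑ e ∈ V i, φ e = t * ∑ e ∈ V i, weight p e := by
      rw [mul_sum]
      exact sum_congr rfl fun e he => if_neg (mem_filter.1 he).2
    rw [e1, e2] at hlt
    exact hlt.le
  obtain ⟨I, hI, hdep⟩ := exists_dependent_sets (k := k) (T := S.image fun e => s(e.1, e.2))
    (card_image_le.trans hS.le) V fun i e he => by
      obtain ⟨he, heG⟩ := mem_filter.1 he
      have := (q i).edges_subset_edgeSet (List.mem_toFinset.1 he)
      induction e with
      | h x y =>
        rcases augment_adj.1 this with h | ⟨-, h | h⟩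
        · exact absurd h heG
        · exact mem_image.2 ⟨_, h, rfl⟩
        · exact mem_image.2 ⟨_, h, Sym2.eq_swap⟩
  -- The last index: a_j is longest among the pairs of `I`, and all others were inserted before it
  -- was chosen.
  set j := I.max' hI with hj
  have hjI : j ∈ I := max'_mem I hI
  have hle := sum_le_of_bounds hjI (g := fun i => ∑ e ∈ A i, weight p e) (ℓ := ℓ) hτ dist_nonneg hw
    hlen hbound fun i hi => hmono i j (le_max' I i hi)
  have hreach := reachable_of_dependent (a := fun i : Fin (k + 1) => a i) hjI q hq hAV hcAV hdep
  have hub := graphDist_le_sum_of_reachable (K := K j) (p := p) ?_ hreach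
  · have hlt := lt_of_lt_of_le (h1 j j.2).2.1 hub
    rw [edist_dist, ← ENNReal.ofReal_mul (by linarith), ENNReal.ofReal_lt_ofReal_iff_of_nonneg
      (by positivity)] at hlt
    have b1 := sum_union_le (weight_nonneg (p := p)) (I.biUnion A)
      ((I.erase j).image fun i : Fin (k + 1) => s((a i).1, (a i).2))
    have b2 := sum_biUnion_le (weight_nonneg (p := p)) I A
    have b3 : ∑ e ∈ (I.erase j).image fun i : Fin (k + 1) => s((a i).1, (a i).2), weight p e ≤
        ∑ i ∈ I.erase j, ℓ i := sum_image_le_of_nonneg fun e _ => weight_nonneg e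
    rw [hτt] at hle
    change t * ℓ j < _ at hlt
    linarith
  · intro x y hxy hne
    rcases mem_union.1 hxy with h | h
    · obtain ⟨i, -, hi⟩ := mem_biUnion.1 h
      exact (h1 j j.2).1 (mem_filter.1 hi).2
    · obtain ⟨i, hi, he⟩ := mem_image.1 h
      have hij : i < j := lt_of_le_of_ne (le_max' I i (mem_of_mem_erase hi)) (ne_of_mem_erase hi)
      have hadj := (h2 j j.2 i hij).2
      rw [← SimpleGraph.mem_edgeSet, he] at hadj
      exact hadj

/-- There are only finitely many sets of `k` pairs, so the minimum is attained and the strict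
inequality survives the infimum. If there is no such set, the infimum is ∞. -/
theorem lt_minDilation_of_greedyRun (hp : Function.Injective p) (ht : 1 ≤ t)
    (h : GreedyRun p t G (k + 1) H) : ENNReal.ofReal (t / (k + 1)) < minDilation G p k := by
  by_cases hne : ∃ S : Finset (Fin n × Fin n), S.card = k
  · obtain ⟨S₀, hS₀⟩ := hne
    have : Nonempty {S : Finset (Fin n × Fin n) // S.card = k} := ⟨⟨S₀, hS₀⟩⟩
    obtain ⟨S, hS⟩ := Finite.exists_min
      fun S : {S : Finset (Fin n × Fin n) // S.card = k} => dilation (augment G S.1) p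
    exact (lt_dilation_of_greedyRun hp ht S.2 h).trans_le (le_iInf₂ fun S' hS' => hS ⟨S', hS'⟩)
  · have : minDilation G p k = ⊤ := by
      simp only [minDilation, iInf_eq_top]
      exact fun S hS => absurd ⟨S, hS⟩ hne
    rw [this]
    exact ENNReal.ofReal_lt_top

end Approximation

end Dilation

namespace Dilation

section Algorithm

open Finset

/-! ### The algorithm -/

/-- Decide approximately whether adding `k` edges suffices to bring the dilation down to `t`. -/
def algorithm : Prog :=
  .ite (.realLT (.reg 0) (.lit 1)) (.setNat 0 (.lit 0))
    (.block [rowTable, maxDist, buildArcs, allPairs, greedy])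

variable {n : ℕ} {M : Type*} [MetricSpace M] {G : SimpleGraph (Fin n)} {p : Fin n → M}
  {E : List (Fin n × Fin n)} {k : ℕ} {t : ℝ}

theorem inputState_dist (a b : Fin n) :
    (inputState p E k t).realArr 0 (a * n + b) = dist (p a) (p b) := by
  have hn : 0 < n := a.pos
  have h1 : ((a : ℕ) * n + b) / n = a := by
    rw [mul_comm, Nat.mul_add_div hn, Nat.div_eq_of_lt b.2, add_zero]
  have h2 : ((a : ℕ) * n + b) % n = b := by
    rw [mul_comm, Nat.mul_add_mod, Nat.mod_eq_of_lt b.2]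
  simp [inputState, h1, h2]

theorem inputState_edge {i : ℕ} (hi : i < (E.map fun q => ((q.1 : ℕ), (q.2 : ℕ))).length) :
    (inputState p E k t).natArr 0 i = (E.map fun q => ((q.1 : ℕ), (q.2 : ℕ)))[i].1 ∧
      (inputState p E k t).natArr 1 i = (E.map fun q => ((q.1 : ℕ), (q.2 : ℕ)))[i].2 := by
  rw [List.length_map] at hi
  simp [inputState, hi]

theorem IsEdgeList.adj_iff (h : IsEdgeList G E) (a b : Fin n) :
    G.Adj a b ↔ (a, b) ∈ E ∨ (b, a) ∈ E := by
  rw [← SimpleGraph.mem_edgeSet, ← h.2, List.mem_map]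
  constructor
  · rintro ⟨⟨x, y⟩, hxy, he⟩
    rcases Sym2.eq_iff.1 he with ⟨rfl, rfl⟩ | ⟨rfl, rfl⟩
    · exact Or.inl hxy
    · exact Or.inr hxy
  · rintro (h | h)
    · exact ⟨_, h, rfl⟩
    · exact ⟨_, h, Sym2.eq_swap⟩

theorem algorithm_spec (hE : IsEdgeList G E) :
    WP algorithm (fun s c => c ≤ 20 * n + 200 * (n * n) + 70 * E.length +
        (11000 * ((Nat.log 2 n + 1) * n) + 2600 * E.length) * n + k * (280 * (n * n)) + 300 ∧
      (t < 1 → s.natReg 0 = 0) ∧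
      (1 ≤ t →
        (s.natReg 0 = 1 ∧ ∃ i ≤ k, ∃ H, GreedyRun p t G i H ∧ ∀ e, ¬ IsViolating H p t e) ∨
        (s.natReg 0 = 0 ∧ ∃ H, GreedyRun p t G (k + 1) H))) (inputState p E k t) 0 := by
  have i1 : (inputState p E k t).natReg 1 = n := rfl
  have i2 : (inputState p E k t).natReg 2 = E.length := rfl
  have i3 : (inputState p E k t).natReg 3 = k := rfl
  have it : (inputState p E k t).realReg 0 = t := rfl
  have ia : ∀ a, 2 ≤ a → ∀ i, (inputState p E k t).natArr a i = 0 := fun a ha i => by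
    have h0 : a ≠ 0 := by omega
    have h1 : a ≠ 1 := by omega
    simp [inputState, h0, h1]
  have idist := inputState_dist (p := p) (E := E) (k := k) (t := t)
  have iedge := fun i => inputState_edge (p := p) (E := E) (k := k) (t := t) (i := i)
  generalize inputState p E k t = s at *
  rw [algorithm, WP_ite]
  refine ⟨fun hb => ?_, fun hb => ?_⟩
  · simp [it] at hb
    simp
    exact fun h => absurd hb (not_lt.2 h)
  simp [it] at hb
  have ht0 : 0 ≤ t := by linarith
  rw [WP_block_cons]
  refine (rowTable_spec i1).conseq ?_
  rintro s₁ c₁ f₁ ⟨hc₁, hrow₁⟩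
  simp only [BExpr.cost, RExpr.cost] at hc₁
  have t₁ : s₁.realReg 0 = t := (f₁.realReg 0 rfl).trans it
  have d₁ : s₁.realArr 0 = s.realArr 0 := f₁.realArr 0 rfl
  have n₁ : s₁.natReg 1 = n := (f₁.natReg 1 rfl).trans i1
  rw [WP_block_cons]
  refine (maxDist_spec n₁ (hrow₁ n le_rfl) (t₁ ▸ ht0)).conseq ?_
  rintro s₂ c₂ f₂ ⟨hc₂, hB0, hB⟩
  rw [t₁, d₁] at hB
  have n₂ : s₂.natReg 1 = n := (f₂.natReg 1 rfl).trans n₁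
  have t₂ : s₂.realReg 0 = t := (f₂.realReg 0 rfl).trans t₁
  have d₂ : s₂.realArr 0 = s.realArr 0 := (f₂.realArr 0 rfl).trans d₁
  have hrow₂ : ∀ i ≤ n, s₂.natArr 2 i = i * n := by rw [f₂.natArr 2 rfl]; exact hrow₁
  rw [WP_block_cons]
  refine (buildArcs_spec (n := n) (E := E.map fun q => ((q.1 : ℕ), (q.2 : ℕ))) ?_ ?_ ?_ ?_
    ?_).conseq ?_
  · rw [f₂.natReg 2 rfl, f₁.natReg 2 rfl, i2, List.length_map]
  · rw [f₂.natArr 0 rfl, f₁.natArr 0 rfl, f₂.natArr 1 rfl, f₁.natArr 1 rfl]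
    exact iedge
  · rintro q hq
    obtain ⟨e, -, rfl⟩ := List.mem_map.1 hq
    exact ⟨e.1.2, e.2.2⟩
  · rw [f₂.natArr 3 rfl, f₁.natArr 3 rfl]; exact ia 3 (by norm_num)
  · rw [f₂.natArr 4 rfl, f₁.natArr 4 rfl]; exact ia 4 (by norm_num)
  rintro s₃ c₃ f₃ ⟨hc₃, adj, harcs, hmem, hsum⟩
  rw [List.length_map] at hc₃ hsum
  have n₃ : s₃.natReg 1 = n := (f₃.natReg 1 rfl).trans n₂
  have t₃ : s₃.realReg 0 = t := (f₃.realReg 0 rfl).trans t₂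
  have d₃ : s₃.realArr 0 = s.realArr 0 := (f₃.realArr 0 rfl).trans d₂
  have hrow₃ : ∀ i ≤ n, s₃.natArr 2 i = i * n := by rw [f₃.natArr 2 rfl]; exact hrow₂
  have hadj : ∀ a b : Fin n, (b : ℕ) ∈ adj a ↔ G.Adj a b := fun a b => by
    rw [hmem, hE.adj_iff]
    simp [Fin.val_inj]
  have hlt : ∀ a < n, ∀ b ∈ adj a, b < n := fun a _ b hb => by
    rcases (hmem a b).1 hb with h | h <;> obtain ⟨e, -, he⟩ := List.mem_map.1 h
    · rw [← (Prod.mk.inj he).2]; exact e.2.2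
    · rw [← (Prod.mk.inj he).1]; exact e.1.2
  have hnet : s₃.Network n adj (fun a b => s.realArr 0 (a * n + b)) (s₂.realReg 1) := by
    refine ⟨n₃, f₃.realReg 1 rfl, hB0, hrow₃, fun u _ => harcs u, hlt, fun u v hu hv => ?_⟩
    rw [d₃]
    refine ⟨rfl, ?_⟩
    have := idist ⟨u, hu⟩ ⟨v, hv⟩
    simp only at this
    rw [this]
    exact dist_nonneg
  rw [WP_block_cons]
  refine (allPairs_spec hnet ?_).conseq ?_
  · rw [f₃.natArr 8 rfl, f₂.natArr 8 rfl, f₁.natArr 8 rfl]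
    exact fun y _ => ia 8 (by norm_num) y
  rintro s₄ c₄ f₄ ⟨hc₄, hrow₄, hset⟩
  rw [WP_block_cons]
  refine (greedy_spec (p := p) (t := t) (G := G) (B := s₂.realReg 1) (k := k) hb
    ((f₄.natReg 1 rfl).trans n₃) ?_ hrow₄ ((f₄.realReg 0 rfl).trans t₃) ?_ ?_ ?_).conseq ?_
  · rw [f₄.natReg 3 rfl, f₃.natReg 3 rfl, f₂.natReg 3 rfl, f₁.natReg 3 rfl, i3]
  · rw [f₄.realArr 0 rfl, d₃]; exact idist
  · intro a b
    rw [← idist]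
    exact hB _ (mul_add_lt a.2 b.2)
  · intro a b
    exact (hset a a.2).eq_truncDist hB0 hadj hlt (fun a b => idist a b) b
  rintro s₅ c₅ - ⟨hc₅, hres⟩
  rw [WP_block_nil]
  refine ⟨?_, fun h => absurd h (not_lt.2 hb), fun _ => hres⟩
  rw [hsum, show 1300 * (2 * E.length) = 2600 * E.length by ring] at hc₄
  omega

/-- The time bound, in terms of the logarithm. -/
theorem cost_le {m : ℕ} (hm : n = 0 → m = 0) :
    ((20 * n + 200 * (n * n) + 70 * m + (11000 * ((Nat.log 2 n + 1) * n) + 2600 * m) * n +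
      k * (280 * (n * n)) + 300 : ℕ) : ℝ) ≤
      50000 * (((m : ℝ) + n * Real.log n + k * n) * n + 1) := by
  rcases Nat.eq_zero_or_pos n with rfl | hn
  · simp [hm rfl]; norm_num
  have h1 : (1 : ℝ) ≤ n := by exact_mod_cast hn
  -- The factor 2 is sufficient because ln 2 > 1/2.
  have hlog : (Nat.log 2 n : ℝ) ≤ 2 * Real.log n := by
    have hpow : ((2 : ℝ) ^ Nat.log 2 n) ≤ n := by exact_mod_cast Nat.pow_log_le_self 2 hn.ne'
    have := Real.log_le_log (by positivity) hpow
    rw [Real.log_pow] at this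
    have h2 := Real.log_two_gt_d9
    have h3 : (0 : ℝ) ≤ Nat.log 2 n := by positivity
    nlinarith
  -- Terms in n² have to be absorbed by n² log n. The logarithm vanishes for n = 1, and there the
  -- summand 1 in the time bound is needed.
  have hone : (1 : ℝ) * (n * n) ≤ 2 * Real.log n * (n * n) + 1 := by
    rcases Nat.lt_or_ge n 2 with h | h
    · obtain rfl : n = 1 := by omega
      simp
    · have h2 : (2 : ℝ) ≤ n := by exact_mod_cast h
      have := Real.log_le_log (by norm_num) h2
      have h3 := Real.log_two_gt_d9
      have h4 : (1 : ℝ) ≤ 2 * Real.log n := by linarith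
      have := mul_le_mul_of_nonneg_right h4 (by positivity : (0 : ℝ) ≤ n * n)
      linarith
  have hlog' := mul_le_mul_of_nonneg_right hlog (by positivity : (0 : ℝ) ≤ n * n)
  have hnn : (n : ℝ) ≤ n * n := by nlinarith
  have hmn : (m : ℝ) ≤ m * n := le_mul_of_one_le_right (by positivity) h1
  have hk0 : (0 : ℝ) ≤ k * (n * n) := by positivity
  have hm0 : (0 : ℝ) ≤ m * n := by positivity
  have hl0 : (0 : ℝ) ≤ Real.log n * (n * n) := mul_nonneg (Real.log_nonneg h1) (by positivity)
  push_cast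
  have e : 50000 * (((m : ℝ) + n * Real.log n + k * n) * n + 1) =
    50000 * (m * n) + 50000 * (Real.log n * (n * n)) + 50000 * (k * (n * n)) + 50000 := by ring
  have e' : 20 * (n : ℝ) + 200 * (n * n) + 70 * m +
      (11000 * (((Nat.log 2 n : ℝ) + 1) * n) + 2600 * m) * n + k * (280 * (n * n)) + 300 =
    20 * (n : ℝ) + 11200 * (n * n) + 70 * m + 11000 * ((Nat.log 2 n : ℝ) * (n * n)) +
      2600 * (m * n) + 280 * (k * (n * n)) + 300 := by ring
  rw [e, e']
  linarith

end Algorithm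

end Dilation

theorem mainTheorem2 :
    ∃ (P : Dilation.Prog) (C : ℝ),
      ∀ (n : ℕ) (M : Type*) [MetricSpace M] (p : Fin n → M) (_ : Function.Injective p)
        (G : SimpleGraph (Fin n)) (E : List (Fin n × Fin n)) (_ : Dilation.IsEdgeList G E)
        (k : ℕ) (t : ℝ),
        ∃ (s : Dilation.State) (c : ℕ),
          -- the program halts after `c` steps, within the time bound, and answers YES or NO
          Dilation.Exec P (Dilation.inputState p E k t) s c ∧
          (c : ℝ) ≤ C * (((E.length : ℝ) + n * Real.log n + k * n) * n + 1) ∧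
          (Dilation.AnswersYes s ∨ Dilation.AnswersNo s) ∧
          -- the answer is correct, provided that sets `S ⊆ V × V` with `|S| = k` exist
          (k ≤ n ^ 2 →
            (Dilation.AnswersYes s →
              (Dilation.minDilation G p k : EReal) ≤ (t : EReal)) ∧
            (Dilation.AnswersNo s →
              ((t / (k + 1) : ℝ) : EReal) < (Dilation.minDilation G p k : EReal))) ∧
          -- the answer is that of the greedy construction with at most `k + 1` edges
          (1 ≤ t →
            (Dilation.AnswersYes s → ∃ i ≤ k, ∃ H, Dilation.GreedyRun p t G i H ∧
              ∀ e, ¬ Dilation.IsViolating H p t e) ∧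
            (Dilation.AnswersNo s → ∃ H, Dilation.GreedyRun p t G (k + 1) H)) := by
  refine ⟨Dilation.algorithm, 50000, fun n M _ p hp G E hE k t => ?_⟩
  obtain ⟨s, c, hexec, hc, hlt, hres⟩ := Dilation.algorithm_spec (p := p) (k := k) (t := t) hE
  rw [zero_add] at hc
  -- For n = 0 the time bound is constant, so it must be known that no edges are listed.
  have hm : n = 0 → E.length = 0 := fun hn => by
    subst hn
    cases E with
    | nil => rfl
    | cons e _ => exact e.1.elim0
  refine ⟨s, c, hexec, (Nat.cast_le.2 hc).trans (Dilation.cost_le hm), ?_, fun hk => ⟨?_, ?_⟩,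
    fun ht => ⟨?_, ?_⟩⟩
  · rcases lt_or_ge t 1 with ht | ht
    · exact Or.inr (hlt ht)
    · exact (hres ht).imp And.left And.left
  · intro hyes
    rcases lt_or_ge t 1 with ht | ht
    · exact absurd (hyes.symm.trans (hlt ht)) one_ne_zero
    rcases hres ht with ⟨-, i, hi, H, hrun, hH⟩ | ⟨hno, -⟩
    · have h := Dilation.minDilation_le_of_greedyRun ht hk hi hrun hH
      rw [← EReal.coe_ennreal_le_coe_ennreal_iff, EReal.coe_ennreal_ofReal,
        max_eq_left (by linarith)] at h
      exact h
    · exact absurd (hyes.symm.trans hno) one_ne_zero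
  · intro hno
    rcases lt_or_ge t 1 with ht | ht
    -- For t < 1 the answer is NO without any computation; every dilation is at least 1 by
    -- definition.
    · have h1 : t / (k + 1) < 1 := by
        rw [div_lt_one (by positivity)]
        have : (0 : ℝ) ≤ k := by positivity
        linarith
      have h2 : (1 : EReal) ≤ (Dilation.minDilation G p k : EReal) := by
        rw [← EReal.coe_ennreal_one, EReal.coe_ennreal_le_coe_ennreal_iff]
        exact Dilation.one_le_minDilation
      exact lt_of_lt_of_le (by exact_mod_cast h1) h2
    rcases hres ht with ⟨hyes, -⟩ | ⟨-, H, hrun⟩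
    · exact absurd (hyes.symm.trans hno) one_ne_zero
    · have h := Dilation.lt_minDilation_of_greedyRun hp ht hrun
      rw [← EReal.coe_ennreal_lt_coe_ennreal_iff, EReal.coe_ennreal_ofReal,
        max_eq_left (by positivity)] at h
      exact h
  · intro hyes
    rcases hres ht with ⟨-, h⟩ | ⟨hno, -⟩
    · exact h
    · exact absurd (hyes.symm.trans hno) one_ne_zero
  · intro hno
    rcases hres ht with ⟨hyes, -⟩ | ⟨-, h⟩
    · exact absurd (hyes.symm.trans hno) one_ne_zero
    · exact h
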